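/- For a positive integer $n$ let $\triangle_n$ be the probability simplex in $\mathbb R^n$ and for $x\in\triangle_n$ let $\operatorname{supp}(x)=\{i:x_i>0\}$. A Nash equilibrium of $A\in\mathbb R^{n\times m}$ is a pair $(x^*,y^*)\in\triangle_n\times\triangle_m$ with $\langle x,Ay^*\rangle\le\langle x^*,Ay^*\rangle\le\langle x^*,Ay\rangle$ for all $(x,y)\in\triangle_n\times\triangle_m$; write $V_A^*=\langle x^*,Ay^*\rangle$. Full-information repeated game. In round $t=1,\dots,T$ the row player chooses $x_t\in\triangle_n$ as a (measurable) function of the past observations $(\mathbf A_s,j_s)_{s<t}$; an adversary chooses $y_t\in\triangle_m$ with arbitrary knowledge of the past, of $A$ and of $x_t$; then a random matrix $\mathbf A_t\in[-1,1]^{n\times m}$ is drawn, i.i.d. over the rounds, independent of the past and with $\mathbb E[\mathbf A_t]=A$, and $i_t\sim x_t$, $j_t\sim y_t$ are drawn independently of each other and of $\mathbf A_t$. The row player then observes $\mathbf A_t$ and $j_t$. Theorem. There are real sequences $(\alpha_{1,k})_k$, $(\alpha_{2,k})_k$ such that for all $n,m,T\ge 1$ there is an algorithm for the row player, which does not know $A$,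 with the following property. Let $A\in[-1,1]^{n\times m}$ have a unique Nash equilibrium $(x^*,y^*)$, and let $k=|\operatorname{supp}(x^*)|$. Then $|\operatorname{supp}(y^*)|=k$. Let $B$ be the $k\times k$ submatrix of $A$ with rows $\operatorname{supp}(x^*)$ and columns $\operatorname{supp}(y^*)$, let $\mathbf 1$ be the all-ones vector, and put $$\Delta_{\min}=\min\Big\{\min_{i}|e_i^\top\operatorname{adj}(B)\mathbf 1|,\ \min_{j}|e_j^\top\operatorname{adj}(B^\top)\mathbf 1|\Big\},\qquad D=\mathbf 1^\top\operatorname{adj}(B)\mathbf 1,$$ $$\Delta_g=\min\Big\{V_A^*-\max_{i\notin\operatorname{supp}(x^*)}e_i^\top Ay^*,\ \min_{j\notin\operatorname{supp}(y^*)}x^{*\top}Ae_j-V_A^*\Big\},$$ where a term of $\Delta_g$ without any index is $+\infty$, and $1/\Delta_g=0$ if $\Delta_g=+\infty$. Then $\Delta_{\min}>0$, $D\ne0$, $\Delta_g>0$, and against every adversary $$T\cdot V_A^*-\sum_{t=1}^T\mathbb E[\langle x_t,Ay_t\rangle]\ \le\ \frac{\alpha_{1,k}\log(nmT)}{\Delta_{\min}\,\Delta_g}+\frac{\alpha_{2,k}(\log(nmT))^2}{|D|}.$$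 -/

import Mathlib

open MeasureTheory ProbabilityTheory Matrix
open scoped Matrix

noncomputable section

namespace MatrixGame

/-- Expected payoff `⟨x, A y⟩` to the (maximizing) row player. -/
def payoff {n m : ℕ} (A : Matrix (Fin n) (Fin m) ℝ) (x : Fin n → ℝ) (y : Fin m → ℝ) : ℝ :=
  x ⬝ᵥ (A *ᵥ y)

/-- `(x, y)` is a (mixed) Nash equilibrium of the zero-sum game `A`. -/
def IsNash {n m : ℕ} (A : Matrix (Fin n) (Fin m) ℝ) (x : Fin n → ℝ) (y : Fin m → ℝ) : Prop :=
  x ∈ stdSimplex ℝ (Fin n) ∧ y ∈ stdSimplex ℝ (Fin m) ∧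
    (∀ x' ∈ stdSimplex ℝ (Fin n), payoff A x' y ≤ payoff A x y) ∧
    (∀ y' ∈ stdSimplex ℝ (Fin m), payoff A x y ≤ payoff A x y')

/-- `(x, y)` is the unique Nash equilibrium of `A`. -/
def IsUniqueNash {n m : ℕ} (A : Matrix (Fin n) (Fin m) ℝ) (x : Fin n → ℝ) (y : Fin m → ℝ) :
    Prop :=
  IsNash A x y ∧ ∀ x' y', IsNash A x' y' → x' = x ∧ y' = y

open Classical in
/-- The support `{i | x i > 0}` of a mixed strategy. -/
def supp {n : ℕ} (x : Fin n → ℝ) : Finset (Fin n) := Finset.univ.filter fun i => 0 < x i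

/-- The `k × k` submatrix of `A` on rows `I` and columns `J`, both listed in increasing order. -/
def subMatrix {n m k : ℕ} (A : Matrix (Fin n) (Fin m) ℝ) (I : Finset (Fin n)) (J : Finset (Fin m))
    (hI : I.card = k) (hJ : J.card = k) : Matrix (Fin k) (Fin k) ℝ :=
  A.submatrix (I.orderEmbOfFin hI) (J.orderEmbOfFin hJ)

/-- `Δ_min = min { min_i |e_iᵀ adj(B) 1|, min_j |e_jᵀ adj(Bᵀ) 1| }` (used for `k ≥ 1`). -/
def deltaMin {k : ℕ} (B : Matrix (Fin k) (Fin k) ℝ) : ℝ :=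
  min (⨅ i : Fin k, |(B.adjugate *ᵥ 1) i|) (⨅ j : Fin k, |(Bᵀ.adjugate *ᵥ 1) j|)

/-- `D = 1ᵀ adj(B) 1`. -/
def detD {k : ℕ} (B : Matrix (Fin k) (Fin k) ℝ) : ℝ :=
  (1 : Fin k → ℝ) ⬝ᵥ (B.adjugate *ᵥ 1)

/-- `Δ_{g,1} = V - max_{i ∉ supp x} e_iᵀ A y`, the smallest loss of a row off the support;
it is `⊤` if there is no such row. -/
def rowGap {n m : ℕ} (A : Matrix (Fin n) (Fin m) ℝ) (x : Fin n → ℝ) (y : Fin m → ℝ) : EReal :=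
  ⨅ i : Fin n, ⨅ _ : i ∉ supp x, ((payoff A x y - (A *ᵥ y) i : ℝ) : EReal)

/-- `Δ_{g,2} = min_{j ∉ supp y} xᵀ A e_j - V`; it is `⊤` if there is no such column. -/
def colGap {n m : ℕ} (A : Matrix (Fin n) (Fin m) ℝ) (x : Fin n → ℝ) (y : Fin m → ℝ) : EReal :=
  ⨅ j : Fin m, ⨅ _ : j ∉ supp y, (((x ᵥ* A) j - payoff A x y : ℝ) : EReal)

/-- `Δ_g = min {Δ_{g,1}, Δ_{g,2}}`, the gap of the actions off the support. -/
def deltaG {n m : ℕ} (A : Matrix (Fin n) (Fin m) ℝ) (x : Fin n → ℝ) (y : Fin m → ℝ) : EReal :=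
  min (rowGap A x y) (colGap A x y)

/-- A row-player algorithm under full-information feedback for `n × m` games. Rounds are numbered
`0, 1, 2, …`. In round `t` it chooses a mixed strategy from the payoff matrices and the opponent's
columns that were observed in the rounds `0, …, t - 1`, and from nothing else. -/
structure RowAlgorithm (n m : ℕ) where
  /-- the mixed strategy played in round `t`, given the past observations -/
  play : (t : ℕ) → (Fin t → (Fin n → Fin m → ℝ)) × (Fin t → Fin m) → (Fin n → ℝ)
  play_mem : ∀ t h, play t h ∈ stdSimplex ℝ (Fin n)
  measurable_play : ∀ t, Measurable (play t)

/-- The mixed strategy `x_t` that the algorithm plays in round `t`, when `M s` is the payoff matrix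
and `j s` the column realized in round `s`. -/
def RowAlgorithm.strategy {n m : ℕ} (alg : RowAlgorithm n m) {Ω : Type*}
    (M : ℕ → Ω → (Fin n → Fin m → ℝ)) (j : ℕ → Ω → Fin m) (t : ℕ) (ω : Ω) : Fin n → ℝ :=
  alg.play t (fun s => M s ω, fun s => j s ω)

/-- The processes below are a `T`-round play of `alg` on the game `A` against an adaptive adversary.
`ℱ t` is all that is known before the draws of round `t`: it contains the past payoff matrices,
rows and columns, and whatever else the adversary knows, such as private randomness. -/
structure IsPlay {n m : ℕ} (alg : RowAlgorithm n m) (A : Matrix (Fin n) (Fin m) ℝ) (T : ℕ)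
    {Ω : Type*} [mΩ : MeasurableSpace Ω] (P : Measure Ω) (ℱ : Filtration ℕ mΩ)
    (M : ℕ → Ω → (Fin n → Fin m → ℝ)) (i : ℕ → Ω → Fin n) (j : ℕ → Ω → Fin m)
    (y : ℕ → Ω → (Fin m → ℝ)) : Prop where
  /-- the outcome of round `t` is known after round `t` -/
  measurable_matrix : ∀ t < T, Measurable[ℱ (t + 1)] (M t)
  measurable_row : ∀ t < T, Measurable[ℱ (t + 1)] (i t)
  measurable_col : ∀ t < T, Measurable[ℱ (t + 1)] (j t)
  /-- the adversary picks a mixed strategy `y t` with any knowledge of the past, the current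
  `x_t` included -/
  measurable_adversary : ∀ t < T, Measurable[ℱ t] (y t)
  adversary_mem : ∀ t < T, ∀ ω, y t ω ∈ stdSimplex ℝ (Fin m)
  /-- the random payoff matrices are IID with entries in `[-1, 1]` and mean `A` -/
  indep_matrix : ∀ t < T, Indep (MeasurableSpace.comap (M t) inferInstance) (ℱ t) P
  identDistrib_matrix : ∀ s < T, ∀ t < T, IdentDistrib (M s) (M t) P P
  matrix_mem : ∀ t < T, ∀ᵐ ω ∂P, ∀ a b, M t ω a b ∈ Set.Icc (-1 : ℝ) 1
  mean_matrix : ∀ t < T, ∀ a b, ∫ ω, M t ω a b ∂P = A a b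
  /-- given the past and the payoff matrix of round `t`, the row and the column are drawn
  independently from `x_t` and `y_t` -/
  sampling : ∀ t < T, ∀ a b,
    P⟦{ω | i t ω = a ∧ j t ω = b} | ℱ t ⊔ MeasurableSpace.comap (M t) inferInstance⟧
      =ᵐ[P] fun ω => alg.strategy M j t ω a * y t ω b

/-- The Nash regret `T · V - ∑_{t < T} E⟨x_t, A y_t⟩`, where `V` is the value of the game `A`. -/
def nashRegret {n m : ℕ} (alg : RowAlgorithm n m) (A : Matrix (Fin n) (Fin m) ℝ) (V : ℝ) (T : ℕ)
    {Ω : Type*} [MeasurableSpace Ω] (P : Measure Ω) (M : ℕ → Ω → (Fin n → Fin m → ℝ))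
    (j : ℕ → Ω → Fin m) (y : ℕ → Ω → (Fin m → ℝ)) : ℝ :=
  T * V - ∑ t ∈ Finset.range T, ∫ ω, payoff A (alg.strategy M j t ω) (y t ω) ∂P

end MatrixGame

end

noncomputable section

namespace MatrixGame

/-! ### Adjugates and constant shifts -/

/-! Constants depending on `k` are suppressed here, `J` is the all-ones matrix, and `x*`, `y*` is
the equilibrium. Time is cut into epochs of doubling length. At the start of epoch `q` the mean of
the first `2 ^ q` matrices is known, and with probability at least `1 - 2 / T` it is within `ε ≈
sqrt (log (nmT) / 2 ^ q)` of `A` in every entry. From it a finite set `E` of grid strategies is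
selected, and exponential weights run on `E` during the epoch. Their regret is at most `2 * diam E *
sqrt (2 ^ q * log |E|)` with the `ℓ¹`-diameter, so a small `E` containing a point near `x*` is
wanted.

Diameter: for a zero-sum `z` one has `D z = (z B) (adj (B + J) - adj B)` (`detD_smul_eq`). Hence
strategies on `supp x*` that equalize the columns of `supp y*` up to `O(ε)` lie within `O(ε / |D|)`
of each other (`detD_mul_expertDiam_le`). Exponential weights on them lose `O(log / |D|)` in an
epoch, and the `O(log T)` epochs give the `log ^ 2 / |D|` term.

Finding the supports: uniqueness yields strict complementarity (`IsUniqueNash.mulVec_lt`) and an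
injective shifted `B`, whence equal support sizes, `D ≠ 0` and positive gaps. Moreover `adj(B) 1 = D
y*` and `adj(Bᵀ) 1 = D x*`. If `A` moves by `δ`, these vectors move by `O(δ)`, so their
normalizations move by `O(δ / Δ_min)`; the actions off the supports stay strictly worse as long as
`δ` is below a multiple of `Δ_min Δ_g` (`IsUniqueNash.supp_eq_of_near`). So the supports are
certified from the data as soon as `ε` is that small. In an earlier, coarse epoch the pure
strategies lose `O(sqrt (2 ^ q log))`. These losses grow geometrically, and the last one is `O(log /
(Δ_min Δ_g))`, which is the first term of the bound.

Fully mixed equilibria have `Δ_g = +∞`, so nothing may be spent on waiting for a certificate.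
Therefore, if both players of a square game have nearly equalizing full strategies, those are used
at once. When the equilibrium is fully mixed this is the right set; otherwise each of them is
`O(ε)`-optimal against every column (`le_vecMul_of_fullyMixedPlausible`), which costs no more than
the pure strategies.

All this holds pathwise for the realized matrices and columns. `IsPlay.integral_mul_entry` passes to
the expected payoffs, since the strategy of a round is fixed before its matrix and column are drawn.
-/

lemma adjugate_add_const_mulVec_one {k : ℕ} (B : Matrix (Fin k) (Fin k) ℝ) (c : ℝ) :
    (B + Matrix.of fun _ _ => c).adjugate *ᵥ 1 = B.adjugate *ᵥ 1 := by
  ext i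
  rw [← cramer_eq_adjugate_mulVec, ← cramer_eq_adjugate_mulVec, cramer_apply, cramer_apply,
    ← det_transpose, ← det_transpose (B.updateCol i 1)]
  -- By Cramer's rule column `i` has been replaced by ones, so the shift of the other columns only
  -- adds multiples of that column.
  refine det_eq_of_forall_row_eq_smul_add_const (fun a => if a = i then 0 else c) i (by simp) ?_
  intro a b
  by_cases h : a = i
  · subst h; simp
  · simp [h, updateCol_ne]

lemma one_vecMul_adjugate_add_const {k : ℕ} (B : Matrix (Fin k) (Fin k) ℝ) (c : ℝ) :
    1 ᵥ* (B + Matrix.of fun _ _ => c).adjugate = 1 ᵥ* B.adjugate := by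
  have h := adjugate_add_const_mulVec_one Bᵀ c
  have e : Bᵀ + Matrix.of (fun _ _ => c) = (B + Matrix.of fun _ _ => c)ᵀ := by
    ext; simp
  rw [e, ← adjugate_transpose, ← adjugate_transpose, mulVec_transpose, mulVec_transpose] at h
  exact h

lemma detD_eq_sum {k : ℕ} (B : Matrix (Fin k) (Fin k) ℝ) :
    detD B = ∑ i, (B.adjugate *ᵥ 1) i := by
  simp [detD, dotProduct]

lemma detD_transpose {k : ℕ} (B : Matrix (Fin k) (Fin k) ℝ) : detD Bᵀ = detD B := by
  unfold detD
  rw [← adjugate_transpose, mulVec_transpose, dotProduct_comm, ← dotProduct_mulVec]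

/-- Apply the shifted matrix to `adj(B) 1`, which is also the adjugate vector of the shifted matrix:
every entry of the result is its determinant, and also `det B + c D`. -/
lemma det_add_const {k : ℕ} (B : Matrix (Fin k) (Fin k) ℝ) (c : ℝ) :
    (B + Matrix.of fun _ _ => c).det = B.det + c * detD B := by
  rcases k.eq_zero_or_pos with rfl | hk
  · simp [detD]
  · have h1 := congrArg (· *ᵥ (1 : Fin k → ℝ)) (mul_adjugate (B + Matrix.of fun _ _ => c))
    have h2 := congrArg (· *ᵥ (1 : Fin k → ℝ)) (mul_adjugate B)
    simp only [← mulVec_mulVec, adjugate_add_const_mulVec_one, add_mulVec] at h1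
    have h3 := congrFun h1 ⟨0, hk⟩
    simp only [Pi.add_apply, smul_mulVec, one_mulVec, Pi.smul_apply, Pi.one_apply, smul_eq_mul,
      mul_one] at h3
    rw [← h3, mulVec_mulVec, h2, detD_eq_sum]
    simp [mulVec, dotProduct, Finset.mul_sum]
    simp [Matrix.one_apply]

/-- A zero-sum `z` does not see the all-ones matrix, so `z B = z (B + J)`. Multiplication by the two
adjugates gives `(det B + D) z` and `(det B) z`; subtracting them leaves `D z`, also for singular
`B`. -/
lemma detD_smul_eq {k : ℕ} (B : Matrix (Fin k) (Fin k) ℝ) (z : Fin k → ℝ) (hz : ∑ i, z i = 0) :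
    detD B • z = (z ᵥ* B) ᵥ* ((B + Matrix.of fun _ _ => 1).adjugate - B.adjugate) := by
  have e : z ᵥ* (B + Matrix.of fun _ _ => (1 : ℝ)) = z ᵥ* B := by
    rw [vecMul_add]
    ext j
    simp [vecMul, dotProduct, hz]
  rw [vecMul_sub]
  nth_rewrite 1 [← e]
  rw [vecMul_vecMul, vecMul_vecMul, mul_adjugate, mul_adjugate, det_add_const]
  ext j
  simp [vecMul_smul, add_mul]

/-- A zero-sum vector on which `B` is nearly constant is small compared with `1 / |detD B|`. -/
lemma abs_detD_mul_le {k : ℕ} (B : Matrix (Fin k) (Fin k) ℝ) (z : Fin k → ℝ) (hz : ∑ i, z i = 0)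
    {c η : ℝ}
    (hc : ∀ i j, |((B + Matrix.of fun _ _ => 1).adjugate - B.adjugate) i j| ≤ c)
    (hη : ∀ i j, |(z ᵥ* B) i - (z ᵥ* B) j| ≤ η) (i : Fin k) :
    |detD B * z i| ≤ k * (η * c) := by
  set K := (B + Matrix.of fun _ _ => (1 : ℝ)).adjugate - B.adjugate with hK
  set w := z ᵥ* B with hw
  have h1 : detD B * z i = ∑ j, w j * K j i := by
    have := congrFun (detD_smul_eq B z hz) i
    rw [← hK, ← hw] at this
    exact this
  -- The columns of `K` sum to zero, so `w` matters only up to an additive constant.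
  have h2 : ∑ j, K j i = 0 := by
    have : 1 ᵥ* K = 0 := by rw [hK, vecMul_sub, one_vecMul_adjugate_add_const, sub_self]
    have := congrFun this i
    simpa [vecMul, dotProduct] using this
  have h3 : detD B * z i = ∑ j, (w j - w i) * K j i := by
    simp_rw [sub_mul, Finset.sum_sub_distrib, ← Finset.mul_sum, h2]
    rw [h1]; simp
  rw [h3]
  calc |∑ j, (w j - w i) * K j i| ≤ ∑ j, |(w j - w i) * K j i| := Finset.abs_sum_le_sum_abs _ _
    _ ≤ ∑ _j : Fin k, η * c := by
        refine Finset.sum_le_sum fun j _ => ?_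
        rw [abs_mul]
        exact mul_le_mul (hη j i) (hc j i) (abs_nonneg _) ((abs_nonneg _).trans (hη j i))
    _ = k * (η * c) := by simp

lemma eq_zero_of_vecMul_eq_const {k : ℕ} {B : Matrix (Fin k) (Fin k) ℝ} (hB : detD B ≠ 0)
    {z : Fin k → ℝ} (hz : ∑ i, z i = 0) (h : ∀ i j, (z ᵥ* B) i = (z ᵥ* B) j) : z = 0 := by
  ext i
  set K := (B + Matrix.of fun _ _ => (1 : ℝ)).adjugate - B.adjugate with hK
  have := abs_detD_mul_le B z hz (c := ∑ i, ∑ j, |K i j|) (η := 0) (fun i j => by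
      rw [← hK]
      exact (Finset.single_le_sum (f := fun j => |K i j|) (fun _ _ => abs_nonneg _)
        (Finset.mem_univ j)).trans
        (Finset.single_le_sum (f := fun i => ∑ j, |K i j|)
          (fun _ _ => Finset.sum_nonneg fun _ _ => abs_nonneg _) (Finset.mem_univ i)))
    (fun i j => by simp [h i j]) i
  simp only [zero_mul, mul_zero] at this
  have h0 := abs_eq_zero.1 (le_antisymm this (abs_nonneg _))
  simpa [hB] using h0

/-- After a shift by `1 - v` the equalizing vector solves `C y = 1`, hence `adj(C) 1 = (det C) y`.
Summing the entries identifies `det C` with `detD B`; no matrix has to be invertible. -/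
lemma adjugate_mulVec_one_of_mulVec_eq {k : ℕ} {B : Matrix (Fin k) (Fin k) ℝ} {y : Fin k → ℝ}
    {v : ℝ} (hy : ∑ i, y i = 1) (h : ∀ i, (B *ᵥ y) i = v) :
    B.adjugate *ᵥ 1 = detD B • y := by
  set C := B + Matrix.of fun _ _ => (1 - v) with hC
  have h1 : C *ᵥ y = 1 := by
    ext i
    rw [hC, add_mulVec, Pi.add_apply, h i]
    simp [mulVec, dotProduct, ← Finset.mul_sum, hy]
  have h2 : B.adjugate *ᵥ 1 = C.det • y := by
    rw [← adjugate_add_const_mulVec_one B (1 - v), ← hC, ← h1, mulVec_mulVec, adjugate_mul]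
    simp [smul_mulVec]
  have h3 : detD B = C.det := by
    rw [detD_eq_sum, h2]
    simp [← Finset.mul_sum, hy]
  rw [h2, h3]

/-! ### Bounds on adjugates of bounded matrices -/

/-- The adjugate is polynomial in the entries, so it is bounded and Lipschitz on a compact ball.
Radius 2 leaves room for a payoff matrix that has been perturbed or shifted by 1. -/
lemma exists_adjugate_lipschitz (k : ℕ) : ∃ c : ℝ, 0 ≤ c ∧
    (∀ B : Matrix (Fin k) (Fin k) ℝ, (∀ i j, |B i j| ≤ 2) → ∀ i j, |B.adjugate i j| ≤ c) ∧
    ∀ B B' : Matrix (Fin k) (Fin k) ℝ, (∀ i j, |B i j| ≤ 2) → (∀ i j, |B' i j| ≤ 2) →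
      ∀ δ, 0 ≤ δ → (∀ i j, |B i j - B' i j| ≤ δ) →
        ∀ i j, |B.adjugate i j - B'.adjugate i j| ≤ c * δ := by
  let F : (Fin k → Fin k → ℝ) → (Fin k → Fin k → ℝ) := fun B => (Matrix.of B).adjugate
  have hF : ContDiff ℝ 1 F := by
    refine contDiff_pi.2 fun i => contDiff_pi.2 fun j => ?_
    simp only [F, adjugate_apply, det_apply]
    refine ContDiff.sum fun σ _ => ?_
    refine ContDiff.const_smul _ ?_
    refine contDiff_prod fun a _ => ?_
    by_cases h : σ a = j
    · simp only [updateRow_apply, h, if_true]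
      exact contDiff_const
    · simp only [updateRow_apply, h, if_false, Matrix.of_apply]
      fun_prop
  obtain ⟨K, hK⟩ := (hF.locallyLipschitz.locallyLipschitzOn (s := Metric.closedBall 0 2)
    ).exists_lipschitzOnWith_of_compact (isCompact_closedBall _ _)
  obtain ⟨C, hC⟩ := (isCompact_closedBall (0 : Fin k → Fin k → ℝ) 2).exists_bound_of_continuousOn
    hF.continuous.continuousOn
  have hmem : ∀ B : Fin k → Fin k → ℝ, (∀ i j, |B i j| ≤ 2) →
      B ∈ Metric.closedBall (0 : Fin k → Fin k → ℝ) 2 := by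
    intro B hB
    rw [mem_closedBall_zero_iff, pi_norm_le_iff_of_nonneg (by norm_num)]
    intro i
    rw [pi_norm_le_iff_of_nonneg (by norm_num)]
    exact fun j => hB i j
  have hentry : ∀ (G : Fin k → Fin k → ℝ) i j, |G i j| ≤ ‖G‖ := fun G i j =>
    (norm_le_pi_norm (G i) j).trans (norm_le_pi_norm G i)
  refine ⟨max K (max C 0), by positivity, fun B hB i j => ?_, fun B B' hB hB' δ hδ h i j => ?_⟩
  · have h1 := (hentry (F fun i j => B i j) i j).trans (hC _ (hmem _ hB))
    exact h1.trans (by simp)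
  · have h1 := hK.dist_le_mul _ (hmem _ hB) _ (hmem _ hB')
    have h2 : dist (fun i j => B i j) (fun i j => B' i j) ≤ δ :=
      (dist_pi_le_iff hδ).2 fun i => (dist_pi_le_iff hδ).2 fun j => h i j
    calc |B.adjugate i j - B'.adjugate i j|
        ≤ ‖F (fun i j => B i j) - F fun i j => B' i j‖ :=
          hentry (F (fun i j => B i j) - F fun i j => B' i j) i j
      _ = dist (F fun i j => B i j) (F fun i j => B' i j) := (dist_eq_norm _ _).symm
      _ ≤ K * δ := h1.trans (by gcongr)
      _ ≤ _ := by gcongr; exact le_max_left _ _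

/-- A constant `c ≥ 1` that bounds the adjugate-related quantities of bounded `k × k` matrices. -/
structure AdjBound (k : ℕ) (c : ℝ) : Prop where
  one_le : 1 ≤ c
  shift : ∀ B : Matrix (Fin k) (Fin k) ℝ, (∀ i j, |B i j| ≤ 1) →
    ∀ i j, |((B + Matrix.of fun _ _ => 1).adjugate - B.adjugate) i j| ≤ c
  lip : ∀ B B' : Matrix (Fin k) (Fin k) ℝ, (∀ i j, |B i j| ≤ 2) → (∀ i j, |B' i j| ≤ 2) →
    ∀ δ, 0 ≤ δ → (∀ i j, |B i j - B' i j| ≤ δ) →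
      ∀ i, |(B.adjugate *ᵥ 1) i - (B'.adjugate *ᵥ 1) i| ≤ c * δ
  entry : ∀ B : Matrix (Fin k) (Fin k) ℝ, (∀ i j, |B i j| ≤ 1) →
    ∀ i, |(B.adjugate *ᵥ 1) i| ≤ c
  detD_le : ∀ B : Matrix (Fin k) (Fin k) ℝ, (∀ i j, |B i j| ≤ 1) → |detD B| ≤ c

lemma exists_adjBound (k : ℕ) : ∃ c, AdjBound k c := by
  obtain ⟨c, hc, hb, hl⟩ := exists_adjugate_lipschitz k
  have e1 : ∀ B : Matrix (Fin k) (Fin k) ℝ, (∀ i j, |B i j| ≤ 1) →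
      ∀ i, |(B.adjugate *ᵥ 1) i| ≤ k * c := by
    intro B hB i
    simp only [mulVec, dotProduct, Pi.one_apply, mul_one]
    refine (Finset.abs_sum_le_sum_abs _ _).trans ?_
    refine (Finset.sum_le_sum fun j _ => hb B (fun i j => (hB i j).trans (by norm_num)) i j).trans ?_
    simp
  have e2 : ∀ B : Matrix (Fin k) (Fin k) ℝ, (∀ i j, |B i j| ≤ 1) → |detD B| ≤ k * (k * c) := by
    intro B hB
    rw [detD_eq_sum]
    refine (Finset.abs_sum_le_sum_abs _ _).trans ?_
    refine (Finset.sum_le_sum fun j _ => e1 B hB j).trans ?_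
    simp
  have p1 : 0 ≤ k * c := by positivity
  have p2 : 0 ≤ k * (k * c) := by positivity
  refine ⟨1 + c + k * c + k * (k * c), by linarith, fun B hB i j => ?_,
    fun B B' hB hB' δ hδ h i => ?_, fun B hB i => (e1 B hB i).trans (by linarith),
    fun B hB => (e2 B hB).trans (by linarith)⟩
  · have := hl (B + Matrix.of fun _ _ => 1) B (fun i j => by
      rw [Matrix.add_apply, Matrix.of_apply]
      have := abs_le.1 (hB i j)
      exact abs_le.2 ⟨by linarith, by linarith⟩) (fun i j => (hB i j).trans (by norm_num)) 1
      (by norm_num) (fun i j => by simp) i j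
    rw [Matrix.sub_apply]
    linarith
  · have : |(B.adjugate *ᵥ 1) i - (B'.adjugate *ᵥ 1) i| ≤ k * (c * δ) := by
      simp only [mulVec, dotProduct, Pi.one_apply, mul_one, ← Finset.sum_sub_distrib]
      refine (Finset.abs_sum_le_sum_abs _ _).trans ?_
      refine (Finset.sum_le_sum fun j _ => hl B B' hB hB' δ hδ h i j).trans ?_
      simp
    nlinarith

/-- A choice of constant as in `AdjBound`. -/
def adjConst (k : ℕ) : ℝ := (exists_adjBound k).choose

lemma adjBound_adjConst (k : ℕ) : AdjBound k (adjConst k) := (exists_adjBound k).choose_spec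

end MatrixGame

end

noncomputable section

namespace MatrixGame

variable {n m : ℕ}

/-! ### Nash equilibria -/

lemma payoff_eq_sum_left (A : Matrix (Fin n) (Fin m) ℝ) (x : Fin n → ℝ) (y : Fin m → ℝ) :
    payoff A x y = ∑ i, x i * (A *ᵥ y) i := rfl

lemma payoff_eq_sum_right (A : Matrix (Fin n) (Fin m) ℝ) (x : Fin n → ℝ) (y : Fin m → ℝ) :
    payoff A x y = ∑ j, (x ᵥ* A) j * y j := by
  rw [payoff, dotProduct_mulVec]; rfl

lemma mem_supp {x : Fin n → ℝ} {i : Fin n} : i ∈ supp x ↔ 0 < x i := by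
  simp [supp]

lemma eq_zero_of_notMem_supp {x : Fin n → ℝ} (hx : x ∈ stdSimplex ℝ (Fin n)) {i : Fin n}
    (h : i ∉ supp x) : x i = 0 :=
  le_antisymm (not_lt.1 fun h' => h (mem_supp.2 h')) (hx.1 i)

lemma sum_mul_le_of_mem_stdSimplex {x : Fin n → ℝ} (hx : x ∈ stdSimplex ℝ (Fin n)) {f : Fin n → ℝ}
    {v : ℝ} (h : ∀ i, f i ≤ v) : ∑ i, x i * f i ≤ v := by
  calc ∑ i, x i * f i ≤ ∑ i, x i * v :=
        Finset.sum_le_sum fun i _ => mul_le_mul_of_nonneg_left (h i) (hx.1 i)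
    _ = v := by rw [← Finset.sum_mul, hx.2, one_mul]

lemma le_sum_mul_of_mem_stdSimplex {x : Fin n → ℝ} (hx : x ∈ stdSimplex ℝ (Fin n)) {f : Fin n → ℝ}
    {v : ℝ} (h : ∀ i, v ≤ f i) : v ≤ ∑ i, x i * f i := by
  calc v = ∑ i, x i * v := by rw [← Finset.sum_mul, hx.2, one_mul]
    _ ≤ ∑ i, x i * f i :=
        Finset.sum_le_sum fun i _ => mul_le_mul_of_nonneg_left (h i) (hx.1 i)

lemma abs_sum_mul_le_of_mem_stdSimplex {x : Fin n → ℝ} (hx : x ∈ stdSimplex ℝ (Fin n))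
    {f : Fin n → ℝ} {v : ℝ} (h : ∀ i, |f i| ≤ v) : |∑ i, x i * f i| ≤ v :=
  abs_le.2 ⟨le_sum_mul_of_mem_stdSimplex hx fun i => (abs_le.1 (h i)).1,
    sum_mul_le_of_mem_stdSimplex hx fun i => (abs_le.1 (h i)).2⟩

lemma payoff_le_of_mulVec_le {A : Matrix (Fin n) (Fin m) ℝ} {x : Fin n → ℝ} {y : Fin m → ℝ}
    (hx : x ∈ stdSimplex ℝ (Fin n)) {v : ℝ} (h : ∀ i, (A *ᵥ y) i ≤ v) : payoff A x y ≤ v :=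
  sum_mul_le_of_mem_stdSimplex hx h

lemma le_payoff_of_le_vecMul {A : Matrix (Fin n) (Fin m) ℝ} {x : Fin n → ℝ} {y : Fin m → ℝ}
    (hy : y ∈ stdSimplex ℝ (Fin m)) {v : ℝ} (h : ∀ j, v ≤ (x ᵥ* A) j) : v ≤ payoff A x y := by
  rw [payoff_eq_sum_right]
  simp_rw [mul_comm]
  exact le_sum_mul_of_mem_stdSimplex hy h

lemma payoff_neg_transpose (A : Matrix (Fin n) (Fin m) ℝ) (x : Fin n → ℝ) (y : Fin m → ℝ) :
    payoff (-Aᵀ) y x = -payoff A x y := by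
  simp only [payoff, neg_mulVec, mulVec_transpose, dotProduct_neg]
  rw [dotProduct_comm, dotProduct_mulVec]

lemma IsNash.swap {A : Matrix (Fin n) (Fin m) ℝ} {x : Fin n → ℝ} {y : Fin m → ℝ}
    (h : IsNash A x y) : IsNash (-Aᵀ) y x :=
  ⟨h.2.1, h.1, fun y' hy' => by
      rw [payoff_neg_transpose, payoff_neg_transpose]; exact neg_le_neg (h.2.2.2 y' hy'),
    fun x' hx' => by
      rw [payoff_neg_transpose, payoff_neg_transpose]; exact neg_le_neg (h.2.2.1 x' hx')⟩

lemma IsUniqueNash.swap {A : Matrix (Fin n) (Fin m) ℝ} {x : Fin n → ℝ} {y : Fin m → ℝ}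
    (h : IsUniqueNash A x y) : IsUniqueNash (-Aᵀ) y x :=
  ⟨h.1.swap, fun y' x' h' => by
    have := h'.swap
    rw [transpose_neg, transpose_transpose, neg_neg] at this
    exact (h.2 x' y' this).symm⟩

lemma IsNash.mulVec_le {A : Matrix (Fin n) (Fin m) ℝ} {x : Fin n → ℝ} {y : Fin m → ℝ}
    (h : IsNash A x y) (i : Fin n) : (A *ᵥ y) i ≤ payoff A x y := by
  have := h.2.2.1 (Pi.single i 1) (single_mem_stdSimplex ℝ i)
  simpa [payoff] using this

lemma IsNash.le_vecMul {A : Matrix (Fin n) (Fin m) ℝ} {x : Fin n → ℝ} {y : Fin m → ℝ}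
    (h : IsNash A x y) (j : Fin m) : payoff A x y ≤ (x ᵥ* A) j := by
  have := h.swap.mulVec_le j
  rw [payoff_neg_transpose, neg_mulVec, mulVec_transpose] at this
  simpa using this

lemma isNash_of_le {A : Matrix (Fin n) (Fin m) ℝ} {x : Fin n → ℝ} {y : Fin m → ℝ}
    (hx : x ∈ stdSimplex ℝ (Fin n)) (hy : y ∈ stdSimplex ℝ (Fin m)) {v : ℝ}
    (h1 : ∀ i, (A *ᵥ y) i ≤ v) (h2 : ∀ j, v ≤ (x ᵥ* A) j) : IsNash A x y :=
  ⟨hx, hy, fun _ hx' => (payoff_le_of_mulVec_le hx' h1).trans (le_payoff_of_le_vecMul hy h2),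
    fun _ hy' => (payoff_le_of_mulVec_le hx h1).trans (le_payoff_of_le_vecMul hy' h2)⟩

lemma eq_of_sum_mul_eq {x f : Fin n → ℝ} (hx : x ∈ stdSimplex ℝ (Fin n)) {v : ℝ}
    (h : ∀ i, f i ≤ v) (hs : ∑ i, x i * f i = v) {i : Fin n} (hi : 0 < x i) : f i = v := by
  have h0 : ∑ i, x i * (v - f i) = 0 := by
    simp_rw [mul_sub, Finset.sum_sub_distrib, ← Finset.sum_mul, hx.2, hs]; ring
  have := (Finset.sum_eq_zero_iff_of_nonneg fun i _ =>
    mul_nonneg (hx.1 i) (sub_nonneg.2 (h i))).1 h0 i (Finset.mem_univ i)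
  rcases mul_eq_zero.1 this with h | h
  · exact absurd h hi.ne'
  · linarith

lemma IsNash.mulVec_eq {A : Matrix (Fin n) (Fin m) ℝ} {x : Fin n → ℝ} {y : Fin m → ℝ}
    (h : IsNash A x y) {i : Fin n} (hi : i ∈ supp x) : (A *ᵥ y) i = payoff A x y :=
  eq_of_sum_mul_eq h.1 h.mulVec_le rfl (mem_supp.1 hi)

lemma IsNash.vecMul_eq {A : Matrix (Fin n) (Fin m) ℝ} {x : Fin n → ℝ} {y : Fin m → ℝ}
    (h : IsNash A x y) {j : Fin m} (hj : j ∈ supp y) : (x ᵥ* A) j = payoff A x y := by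
  have := h.swap.mulVec_eq hj
  rw [payoff_neg_transpose, neg_mulVec, mulVec_transpose] at this
  simpa using this

/-! ### Strict complementarity -/

/-- If no nonzero vector has nonpositive product with all `a k`, then these vectors span the whole
space as a convex cone. -/
lemma exists_nonneg_combination {ι : Type*} [Fintype ι] (a : ι → Fin m → ℝ)
    (h : ∀ d : Fin m → ℝ, (∀ k, a k ⬝ᵥ d ≤ 0) → d = 0) (p : Fin m → ℝ) :
    ∃ w : ι → ℝ, (∀ k, 0 ≤ w k) ∧ p = ∑ k, w k • a k := by
  classical
  let g : (Fin m → ℝ) → ℝ := fun d => ∑ k, max 0 (a k ⬝ᵥ d)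
  have hg0 : ∀ d, d ≠ 0 → 0 < g d := by
    intro d hd
    by_contra hn
    refine hd (h d fun k => ?_)
    have hz : g d = 0 := le_antisymm (not_lt.1 hn) (Finset.sum_nonneg fun _ _ => le_max_left _ _)
    have := (Finset.sum_eq_zero_iff_of_nonneg fun _ _ => le_max_left _ _).1 hz k
      (Finset.mem_univ k)
    exact max_eq_left_iff.1 this
  have hgc : Continuous g := by
    refine continuous_finsetSum _ fun k _ => continuous_const.max ?_
    exact Continuous.dotProduct continuous_const continuous_id
  -- `g` is positively homogeneous and positive off zero, so compactness of the unit sphere gives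
  -- `ρ`. The sphere is empty for `m = 0`.
  obtain ⟨ρ, hρ, hρg⟩ : ∃ ρ > 0, ∀ d, ρ * ‖d‖ ≤ g d := by
    rcases (Metric.sphere (0 : Fin m → ℝ) 1).eq_empty_or_nonempty with he | hne
    · refine ⟨1, one_pos, fun d => ?_⟩
      by_cases hd : d = 0
      · subst hd; simp [g]
      · exfalso
        have : ‖d‖⁻¹ • d ∈ Metric.sphere (0 : Fin m → ℝ) 1 := by
          simp [norm_smul, norm_ne_zero_iff.2 hd]
        rw [he] at this
        exact this
    · obtain ⟨d₀, hd₀, hmin⟩ := (isCompact_sphere _ _).exists_isMinOn hne hgc.continuousOn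
      have hd₀' : d₀ ≠ 0 := by
        rintro rfl; simp at hd₀
      refine ⟨g d₀, hg0 _ hd₀', fun d => ?_⟩
      by_cases hd : d = 0
      · subst hd; simp [g]
      · have hm : ‖d‖⁻¹ • d ∈ Metric.sphere (0 : Fin m → ℝ) 1 := by
          simp [norm_smul, norm_ne_zero_iff.2 hd]
        have h1 : g d₀ ≤ g (‖d‖⁻¹ • d) := hmin hm
        have h2 : g (‖d‖⁻¹ • d) = ‖d‖⁻¹ * g d := by
          simp only [g, Finset.mul_sum, dotProduct_smul, smul_eq_mul]
          refine Finset.sum_congr rfl fun k _ => ?_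
          rw [mul_max_of_nonneg _ _ (by positivity), mul_zero]
        rw [h2] at h1
        have hdp : 0 < ‖d‖ := norm_pos_iff.2 hd
        calc g d₀ * ‖d‖ ≤ ‖d‖⁻¹ * g d * ‖d‖ := by gcongr
          _ = g d := by field_simp
  -- With this size of the box, a functional `d` separating `p` from its image would satisfy `R g(d)
  -- < p ⬝ᵥ d ≤ (∑ |p j|) ‖d‖ ≤ R g(d)`.
  set R : ℝ := (∑ j, |p j|) / ρ with hR
  have hR0 : 0 ≤ R := by positivity
  let K : Set (Fin m → ℝ) := (fun w : ι → ℝ => ∑ k, w k • a k) '' Set.Icc 0 (fun _ => R)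
  have hlin : IsLinearMap ℝ (fun w : ι → ℝ => ∑ k, w k • a k) :=
    ⟨fun w w' => by simp [add_smul, Finset.sum_add_distrib],
      fun c w => by simp [Finset.smul_sum, mul_smul]⟩
  have hKc : IsCompact K := by
    refine isCompact_Icc.image ?_
    fun_prop
  have hKconv : Convex ℝ K := (convex_Icc _ _).is_linear_image hlin
  by_cases hp : p ∈ K
  · obtain ⟨w, hw, rfl⟩ := hp
    exact ⟨w, fun k => hw.1 k, rfl⟩
  · exfalso
    obtain ⟨f, u, hu, hup⟩ := geometric_hahn_banach_closed_point hKconv hKc.isClosed hp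
    let d : Fin m → ℝ := fun j => f (Pi.single j 1)
    have hf : ∀ v : Fin m → ℝ, f v = v ⬝ᵥ d := by
      intro v
      conv_lhs => rw [pi_eq_sum_univ' v]
      rw [map_sum]
      refine Finset.sum_congr rfl fun j _ => ?_
      rw [map_smul, smul_eq_mul]
    have h1 : R * g d < f p := by
      let w : ι → ℝ := fun k => if 0 < a k ⬝ᵥ d then R else 0
      have hw : ∑ k, w k • a k ∈ K := ⟨w, ⟨fun k => by simp only [w]; split_ifs <;> simp [hR0],
        fun k => by simp only [w]; split_ifs <;> simp [hR0]⟩, rfl⟩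
      have h3 := (hu _ hw).trans hup
      rw [map_sum] at h3
      refine lt_of_le_of_lt (le_of_eq ?_) h3
      simp only [g, Finset.mul_sum]
      refine Finset.sum_congr rfl fun k _ => ?_
      rw [map_smul, hf, smul_eq_mul]
      simp only [w]
      split_ifs with hk
      · rw [max_eq_right hk.le]
      · rw [max_eq_left (not_lt.1 hk)]; simp
    have h2 : f p ≤ (∑ j, |p j|) * ‖d‖ := by
      rw [hf, dotProduct, Finset.sum_mul]
      refine Finset.sum_le_sum fun j _ => ?_
      calc p j * d j ≤ |p j * d j| := le_abs_self _
        _ = |p j| * |d j| := abs_mul _ _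
        _ ≤ |p j| * ‖d‖ := by gcongr; exact norm_le_pi_norm d j
    have h4 : (∑ j, |p j|) * ‖d‖ ≤ R * g d := by
      calc (∑ j, |p j|) * ‖d‖ = R * (ρ * ‖d‖) := by rw [hR]; field_simp
        _ ≤ R * g d := by gcongr; exact hρg d
    linarith

/-- The column strategy of a unique equilibrium has no feasible direction along which it stays
optimal. -/
lemma IsUniqueNash.eq_zero_of_feasible {A : Matrix (Fin n) (Fin m) ℝ} {x : Fin n → ℝ}
    {y : Fin m → ℝ} (h : IsUniqueNash A x y) {d : Fin m → ℝ} (hs : ∑ j, d j = 0)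
    (h1 : ∀ i, (A *ᵥ y) i = payoff A x y → (A *ᵥ d) i ≤ 0) (h2 : ∀ j, j ∉ supp y → 0 ≤ d j) :
    d = 0 := by
  -- For small `t > 0` the slack constraints survive by continuity and the tight ones by hypothesis,
  -- so `y + t • d` is again optimal, against uniqueness unless `d = 0`.
  have e1 : ∀ᶠ t : ℝ in nhdsWithin 0 (Set.Ioi 0), ∀ j, 0 ≤ y j + t * d j := by
    refine Filter.eventually_all.2 fun j => ?_
    by_cases hj : j ∈ supp y
    · have hc : Filter.Tendsto (fun t : ℝ => y j + t * d j) (nhds 0) (nhds (y j + 0 * d j)) :=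
        Continuous.tendsto (by fun_prop) 0
      have : ∀ᶠ t : ℝ in nhds 0, 0 < y j + t * d j :=
        hc.eventually (lt_mem_nhds (by simpa using mem_supp.1 hj))
      exact Filter.Eventually.mono (nhdsWithin_le_nhds this) fun t ht => le_of_lt ht
    · filter_upwards [self_mem_nhdsWithin] with t ht
      exact add_nonneg (h.1.2.1.1 j) (mul_nonneg (le_of_lt ht) (h2 j hj))
  have e2 : ∀ᶠ t : ℝ in nhdsWithin 0 (Set.Ioi 0),
      ∀ i, (A *ᵥ y) i + t * (A *ᵥ d) i ≤ payoff A x y := by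
    refine Filter.eventually_all.2 fun i => ?_
    rcases (h.1.mulVec_le i).eq_or_lt with hi | hi
    · filter_upwards [self_mem_nhdsWithin] with t ht
      have := mul_nonneg (le_of_lt ht) (neg_nonneg.2 (h1 i hi))
      linarith
    · have hc : Filter.Tendsto (fun t : ℝ => (A *ᵥ y) i + t * (A *ᵥ d) i) (nhds 0)
          (nhds ((A *ᵥ y) i + 0 * (A *ᵥ d) i)) := Continuous.tendsto (by fun_prop) 0
      have : ∀ᶠ t : ℝ in nhds 0, (A *ᵥ y) i + t * (A *ᵥ d) i < payoff A x y :=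
        hc.eventually (gt_mem_nhds (by simpa using hi))
      exact Filter.Eventually.mono (nhdsWithin_le_nhds this) fun t ht => le_of_lt ht
  obtain ⟨t, ⟨ht1, ht2⟩, ht⟩ := ((e1.and e2).and self_mem_nhdsWithin).exists
  have ht : 0 < t := ht
  have hN : IsNash A x (y + t • d) := by
    refine isNash_of_le h.1.1 ⟨fun j => by simpa using ht1 j, ?_⟩ (v := payoff A x y)
      (fun i => ?_) h.1.le_vecMul
    · simp [Finset.sum_add_distrib, ← Finset.mul_sum, hs, h.1.2.1.2]
    · rw [mulVec_add, mulVec_smul]; simpa using ht2 i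
  have := (h.2 _ _ hN).2
  simpa [ht.ne'] using this

/-- Strict complementarity, by conic duality: if an unused row were a best reply to `y`, there would
be an optimal row strategy that uses it. -/
lemma IsUniqueNash.mulVec_lt {A : Matrix (Fin n) (Fin m) ℝ} {x : Fin n → ℝ} {y : Fin m → ℝ}
    (h : IsUniqueNash A x y) {i : Fin n} (hi : i ∉ supp x) : (A *ᵥ y) i < payoff A x y := by
  classical
  refine (h.1.mulVec_le i).lt_of_ne fun heq => ?_
  set V := payoff A x y with hV
  -- These vectors describe the constraints active at `y`: tight rows, vanishing coordinates and
  -- zero sum. Their polar cone is trivial by uniqueness. Inactive indices contribute the zero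
  -- vector.
  let a : Fin n ⊕ Fin m ⊕ Bool → Fin m → ℝ := fun s => match s with
    | .inl i => if (A *ᵥ y) i = V then A i else 0
    | .inr (.inl j) => if j ∈ supp y then 0 else -Pi.single j 1
    | .inr (.inr b) => if b then 1 else -1
  obtain ⟨w, hw, hp⟩ := exists_nonneg_combination a (fun d hd => by
    refine h.eq_zero_of_feasible ?_ (fun i' hi' => ?_) fun j hj => ?_
    · have h1 := hd (.inr (.inr true))
      have h2 := hd (.inr (.inr false))
      simp [a, dotProduct] at h1 h2
      exact le_antisymm h1 h2
    · have := hd (.inl i')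
      simp only [a] at this
      rw [if_pos hi'] at this
      exact this
    · have := hd (.inr (.inl j))
      simp only [a] at this
      rw [if_neg hj] at this
      simpa using this) (-A i)
  -- Moving `-A i` to the other side of the conic identity gives nonnegative weights on tight rows,
  -- at least 1 on row `i`, whose mixture is constant on `supp y` and no smaller elsewhere.
  let μ : Fin n → ℝ := fun i' => (if (A *ᵥ y) i' = V then w (.inl i') else 0) + if i' = i then 1 else 0
  have hμ0 : ∀ i', 0 ≤ μ i' := fun i' => by
    simp only [μ]
    have := hw (.inl i')
    split_ifs <;> linarith
  have hμi : 1 ≤ μ i := by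
    simp only [μ, if_true]
    have := hw (.inl i)
    split_ifs
    linarith
  have hμV : ∀ i', μ i' * (A *ᵥ y) i' = μ i' * V := by
    intro i'
    by_cases hc : (A *ᵥ y) i' = V
    · rw [hc]
    · have : i' ≠ i := fun e => hc (e ▸ heq)
      simp [μ, hc, this]
  set c : ℝ := w (.inr (.inr false)) - w (.inr (.inr true)) with hc
  have hcol : ∀ j, (μ ᵥ* A) j = c + if j ∈ supp y then 0 else w (.inr (.inl j)) := by
    intro j
    have h1 := congrFun hp j
    simp only [Fintype.sum_sum_type, Fintype.sum_bool, Finset.sum_apply,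
      Pi.smul_apply, smul_eq_mul, Pi.neg_apply, a, if_true] at h1
    have h2 : (μ ᵥ* A) j = (∑ i', w (.inl i') * (if (A *ᵥ y) i' = V then A i' else 0) j) + A i j := by
      simp only [vecMul, dotProduct, μ, add_mul, Finset.sum_add_distrib]
      congr 1
      · refine Finset.sum_congr rfl fun i' _ => ?_
        split_ifs <;> simp
      · simp
    have h3 : ∑ j', w (.inr (.inl j')) * (if j' ∈ supp y then (0 : Fin m → ℝ) else -Pi.single j' 1) j
        = - if j ∈ supp y then 0 else w (.inr (.inl j)) := by
      rw [Finset.sum_eq_single j]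
      · split_ifs <;> simp
      · intro j' _ hj'
        split_ifs
        · simp
        · simp [Pi.single_eq_of_ne hj'.symm]
      · simp
    rw [h3] at h1
    simp at h1
    rw [h2]
    linarith
  set S := ∑ i', μ i' with hS
  have hS1 : 1 ≤ S := hμi.trans (Finset.single_le_sum (fun i' _ => hμ0 i') (Finset.mem_univ i))
  -- The constant is found by pairing the mixture with `y`, which is carried by `supp y`.
  have hcV : c = S * V := by
    have h1 : payoff A μ y = S * V := by
      rw [payoff_eq_sum_left, Finset.sum_congr rfl fun i' _ => hμV i', ← Finset.sum_mul]
    rw [← h1, payoff_eq_sum_right]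
    have : ∀ j, (μ ᵥ* A) j * y j = c * y j := by
      intro j
      rw [hcol j]
      by_cases hj : j ∈ supp y
      · simp [hj]
      · simp [eq_zero_of_notMem_supp h.1.2.1 hj]
    rw [Finset.sum_congr rfl fun j _ => this j, ← Finset.mul_sum, h.1.2.1.2, mul_one]
  have hN : IsNash A (S⁻¹ • μ) y := by
    refine isNash_of_le ⟨fun i' => ?_, ?_⟩ h.1.2.1 (v := V) h.1.mulVec_le fun j => ?_
    · exact mul_nonneg (by positivity) (hμ0 i')
    · simp only [Pi.smul_apply, smul_eq_mul, ← Finset.mul_sum]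
      rw [← hS]; field_simp
    · rw [smul_vecMul, Pi.smul_apply, hcol, hcV, smul_eq_mul]
      have : 0 ≤ if j ∈ supp y then (0 : ℝ) else w (.inr (.inl j)) := by
        split_ifs
        · rfl
        · exact hw _
      calc V = S⁻¹ * (S * V + 0) := by field_simp; ring
        _ ≤ _ := by gcongr
  have := congrFun (h.2 _ _ hN).1 i
  refine hi (mem_supp.2 ?_)
  rw [← this]
  exact mul_pos (by positivity) (by linarith)

lemma IsUniqueNash.lt_vecMul {A : Matrix (Fin n) (Fin m) ℝ} {x : Fin n → ℝ} {y : Fin m → ℝ}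
    (h : IsUniqueNash A x y) {j : Fin m} (hj : j ∉ supp y) : payoff A x y < (x ᵥ* A) j := by
  have := h.swap.mulVec_lt hj
  rw [payoff_neg_transpose, neg_mulVec, mulVec_transpose] at this
  simpa using this

end MatrixGame

end

noncomputable section

namespace MatrixGame

variable {n m k : ℕ}

/-! ### Restriction to the support -/

lemma sum_orderEmbOfFin {I : Finset (Fin n)} (hI : I.card = k) {f : Fin n → ℝ}
    (hf : ∀ i, i ∉ I → f i = 0) : ∑ a, f (I.orderEmbOfFin hI a) = ∑ i, f i := by
  have h1 : ∑ a, f (I.orderEmbOfFin hI a) = ∑ i ∈ I, f i := by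
    conv_rhs => rw [← Finset.map_orderEmbOfFin_univ I hI]
    rw [Finset.sum_map]; rfl
  rw [h1]
  exact Finset.sum_subset (Finset.subset_univ _) fun i _ hi => hf i hi

/-- Extension by zero of a vector indexed by the elements of `I`. -/
def extendZero (I : Finset (Fin n)) (hI : I.card = k) (z : Fin k → ℝ) : Fin n → ℝ :=
  Function.extend (I.orderEmbOfFin hI) z 0

lemma extendZero_apply (I : Finset (Fin n)) (hI : I.card = k) (z : Fin k → ℝ) (a : Fin k) :
    extendZero I hI z (I.orderEmbOfFin hI a) = z a :=
  (I.orderEmbOfFin hI).injective.extend_apply _ _ _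

lemma extendZero_of_notMem (I : Finset (Fin n)) (hI : I.card = k) (z : Fin k → ℝ) {i : Fin n}
    (hi : i ∉ I) : extendZero I hI z i = 0 := by
  refine Function.extend_apply' _ _ _ ?_
  rintro ⟨a, rfl⟩
  exact hi (Finset.orderEmbOfFin_mem _ _ _)

lemma exists_orderEmbOfFin_eq {I : Finset (Fin n)} (hI : I.card = k) {i : Fin n} (hi : i ∈ I) :
    ∃ a, I.orderEmbOfFin hI a = i := by
  have : i ∈ Set.range (I.orderEmbOfFin hI) := by rw [Finset.range_orderEmbOfFin]; exact hi
  exact this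

lemma submatrix_mulVec_eq {l : ℕ} (A : Matrix (Fin n) (Fin m) ℝ) (I : Finset (Fin n))
    (J : Finset (Fin m)) (hI : I.card = l) (hJ : J.card = k) {y : Fin m → ℝ}
    (hy : ∀ j, j ∉ J → y j = 0) (a : Fin l) :
    (A.submatrix (I.orderEmbOfFin hI) (J.orderEmbOfFin hJ) *ᵥ fun b => y (J.orderEmbOfFin hJ b)) a =
      (A *ᵥ y) (I.orderEmbOfFin hI a) := by
  simp only [mulVec, dotProduct, submatrix_apply]
  exact sum_orderEmbOfFin hJ (f := fun j => A (I.orderEmbOfFin hI a) j * y j)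
    fun j hj => by simp [hy j hj]

lemma subMatrix_mulVec_eq (A : Matrix (Fin n) (Fin m) ℝ) (I : Finset (Fin n))
    (J : Finset (Fin m)) (hI : I.card = k) (hJ : J.card = k) {y : Fin m → ℝ}
    (hy : ∀ j, j ∉ J → y j = 0) (a : Fin k) :
    (subMatrix A I J hI hJ *ᵥ fun b => y (J.orderEmbOfFin hJ b)) a =
      (A *ᵥ y) (I.orderEmbOfFin hI a) :=
  submatrix_mulVec_eq A I J hI hJ hy a

lemma subMatrix_transpose (A : Matrix (Fin n) (Fin m) ℝ) (I : Finset (Fin n))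
    (J : Finset (Fin m)) (hI : I.card = k) (hJ : J.card = k) :
    subMatrix Aᵀ J I hJ hI = (subMatrix A I J hI hJ)ᵀ := rfl

lemma vecMul_subMatrix_eq (A : Matrix (Fin n) (Fin m) ℝ) (I : Finset (Fin n))
    (J : Finset (Fin m)) (hI : I.card = k) (hJ : J.card = k) {x : Fin n → ℝ}
    (hx : ∀ i, i ∉ I → x i = 0) (b : Fin k) :
    ((fun a => x (I.orderEmbOfFin hI a)) ᵥ* subMatrix A I J hI hJ) b =
      (x ᵥ* A) (J.orderEmbOfFin hJ b) := by
  rw [← mulVec_transpose, ← mulVec_transpose, ← subMatrix_transpose]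
  exact subMatrix_mulVec_eq Aᵀ J I hJ hI hx b

/-! ### The equilibrium matrix of a unique equilibrium -/

/-- The shift `1 - V` forces a zero sum: averaging the rows with `x` gives `V ∑ d + (1 - V) ∑ d =
0`. The extension of `d` by zero then keeps every tight row fixed, since by strict complementarity
the tight rows are those of `supp x`; hence it is a feasible direction. -/
lemma IsUniqueNash.eq_zero_of_submatrix_mulVec {A : Matrix (Fin n) (Fin m) ℝ} {x : Fin n → ℝ}
    {y : Fin m → ℝ} (h : IsUniqueNash A x y) {l : ℕ} (hx : (supp x).card = l)
    (hy : (supp y).card = k) {d : Fin k → ℝ}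
    (hd : (A.submatrix ((supp x).orderEmbOfFin hx) ((supp y).orderEmbOfFin hy) +
      Matrix.of fun _ _ => (1 - payoff A x y)) *ᵥ d = 0) : d = 0 := by
  set D := extendZero (supp y) hy d with hD
  have hDJ : ∀ j, j ∉ supp y → D j = 0 := fun j hj => extendZero_of_notMem _ _ _ hj
  have hDd : (fun b => D ((supp y).orderEmbOfFin hy b)) = d := by
    ext b; exact extendZero_apply _ _ _ _
  set V := payoff A x y with hV
  have hrow : ∀ i ∈ supp x, (A *ᵥ D) i + (1 - V) * ∑ j, D j = 0 := by
    intro i hi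
    obtain ⟨a, rfl⟩ := exists_orderEmbOfFin_eq hx hi
    have h1 := congrFun hd a
    rw [add_mulVec, Pi.add_apply, ← hDd, submatrix_mulVec_eq A _ _ hx hy hDJ] at h1
    rw [← sum_orderEmbOfFin hy hDJ, Finset.mul_sum]
    simpa [mulVec, dotProduct] using h1
  have hsum : ∑ j, D j = 0 := by
    have h1 : ∑ i, x i * ((A *ᵥ D) i + (1 - V) * ∑ j, D j) = 0 := by
      refine Finset.sum_eq_zero fun i _ => ?_
      by_cases hi : i ∈ supp x
      · rw [hrow i hi, mul_zero]
      · rw [eq_zero_of_notMem_supp h.1.1 hi, zero_mul]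
    simp_rw [mul_add, Finset.sum_add_distrib] at h1
    rw [← Finset.sum_mul, h.1.1.2, ← payoff_eq_sum_left, payoff_eq_sum_right] at h1
    have h2 : ∑ j, (x ᵥ* A) j * D j = V * ∑ j, D j := by
      rw [Finset.mul_sum]
      refine Finset.sum_congr rfl fun j _ => ?_
      by_cases hj : j ∈ supp y
      · rw [h.1.vecMul_eq hj]
      · rw [hDJ j hj, mul_zero, mul_zero]
    rw [h2] at h1
    linarith
  have hD0 : D = 0 := by
    refine h.eq_zero_of_feasible hsum (fun i hi => ?_) fun j hj => (hDJ j hj).ge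
    have hi' : i ∈ supp x := by
      by_contra hn
      exact (h.mulVec_lt hn).ne hi
    have := hrow i hi'
    rw [hsum, mul_zero, add_zero] at this
    exact this.le
  rw [← hDd, hD0]
  rfl

/-- The shifted support matrix is injective, so it has at least as many rows as columns. Exchanging
the players gives the other inequality. -/
lemma IsUniqueNash.card_supp_le {A : Matrix (Fin n) (Fin m) ℝ} {x : Fin n → ℝ}
    {y : Fin m → ℝ} (h : IsUniqueNash A x y) : (supp y).card ≤ (supp x).card := by
  set C := A.submatrix ((supp x).orderEmbOfFin rfl) ((supp y).orderEmbOfFin rfl) +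
      Matrix.of fun _ _ => (1 - payoff A x y) with hC
  have hinj : Function.Injective C.mulVecLin := by
    rw [← LinearMap.ker_eq_bot, LinearMap.ker_eq_bot']
    intro d hd
    exact h.eq_zero_of_submatrix_mulVec rfl rfl hd
  simpa using LinearMap.finrank_le_finrank_of_injective hinj

lemma IsUniqueNash.card_supp_eq {A : Matrix (Fin n) (Fin m) ℝ} {x : Fin n → ℝ}
    {y : Fin m → ℝ} (h : IsUniqueNash A x y) : (supp y).card = (supp x).card :=
  le_antisymm h.card_supp_le h.swap.card_supp_le

lemma IsNash.sum_supp_right {A : Matrix (Fin n) (Fin m) ℝ} {x : Fin n → ℝ}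
    {y : Fin m → ℝ} (h : IsNash A x y) (hy : (supp y).card = k) :
    ∑ b, y ((supp y).orderEmbOfFin hy b) = 1 := by
  rw [sum_orderEmbOfFin hy fun j hj => eq_zero_of_notMem_supp h.2.1 hj, h.2.1.2]

/-- This and its transpose show that `deltaMin` is `|D|` times the smallest positive equilibrium
probability. -/
lemma IsNash.adjugate_mulVec_one {A : Matrix (Fin n) (Fin m) ℝ} {x : Fin n → ℝ}
    {y : Fin m → ℝ} (h : IsNash A x y) (hx : (supp x).card = k) (hy : (supp y).card = k)
    (b : Fin k) :
    ((subMatrix A (supp x) (supp y) hx hy).adjugate *ᵥ 1) b =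
      detD (subMatrix A (supp x) (supp y) hx hy) * y ((supp y).orderEmbOfFin hy b) := by
  have := adjugate_mulVec_one_of_mulVec_eq (B := subMatrix A (supp x) (supp y) hx hy)
    (y := fun b => y ((supp y).orderEmbOfFin hy b)) (v := payoff A x y) (h.sum_supp_right hy)
    (fun a => by
      rw [subMatrix_mulVec_eq A _ _ hx hy fun j hj => eq_zero_of_notMem_supp h.2.1 hj]
      exact h.mulVec_eq (Finset.orderEmbOfFin_mem _ _ _))
  rw [this]
  simp

lemma IsNash.adjugate_transpose_mulVec_one {A : Matrix (Fin n) (Fin m) ℝ} {x : Fin n → ℝ}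
    {y : Fin m → ℝ} (h : IsNash A x y) (hx : (supp x).card = k) (hy : (supp y).card = k)
    (a : Fin k) :
    ((subMatrix A (supp x) (supp y) hx hy)ᵀ.adjugate *ᵥ 1) a =
      detD (subMatrix A (supp x) (supp y) hx hy) * x ((supp x).orderEmbOfFin hx a) := by
  have := adjugate_mulVec_one_of_mulVec_eq (B := (subMatrix A (supp x) (supp y) hx hy)ᵀ)
    (y := fun b => x ((supp x).orderEmbOfFin hx b)) (v := payoff A x y) (h.swap.sum_supp_right hx)
    (fun b => by
      rw [mulVec_transpose,
        vecMul_subMatrix_eq A _ _ hx hy fun j hj => eq_zero_of_notMem_supp h.1 hj]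
      exact h.vecMul_eq (Finset.orderEmbOfFin_mem _ _ _))
  rw [this, detD_transpose]
  simp

lemma IsNash.card_supp_pos {A : Matrix (Fin n) (Fin m) ℝ} {x : Fin n → ℝ}
    {y : Fin m → ℝ} (h : IsNash A x y) (hx : (supp x).card = k) : 0 < k := by
  rcases k.eq_zero_or_pos with rfl | hk
  · have := h.swap.sum_supp_right hx
    simp at this
  · exact hk

/-- If `D = 0`, then `adj(C) 1 = D y = 0` for the shifted matrix `C`, so `det C = 0`, although `C`
has trivial kernel. -/
lemma IsUniqueNash.detD_ne_zero {A : Matrix (Fin n) (Fin m) ℝ} {x : Fin n → ℝ}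
    {y : Fin m → ℝ} (h : IsUniqueNash A x y) (hx : (supp x).card = k) (hy : (supp y).card = k) :
    detD (subMatrix A (supp x) (supp y) hx hy) ≠ 0 := by
  intro h0
  set B := subMatrix A (supp x) (supp y) hx hy with hB
  set C := B + Matrix.of fun _ _ => (1 - payoff A x y) with hC
  have h1 : C.adjugate *ᵥ 1 = 0 := by
    rw [hC, adjugate_add_const_mulVec_one]
    ext b
    rw [h.1.adjugate_mulVec_one hx hy b, ← hB, h0, zero_mul]; rfl
  have h2 : C.det = 0 := by
    have := congrArg (· *ᵥ (1 : Fin k → ℝ)) (mul_adjugate C)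
    simp only [← mulVec_mulVec, h1, mulVec_zero, smul_mulVec, one_mulVec] at this
    simpa using (congrFun this ⟨0, h.1.card_supp_pos hx⟩).symm
  obtain ⟨d, hd, hd0⟩ := Matrix.exists_mulVec_eq_zero_iff.2 h2
  exact hd (h.eq_zero_of_submatrix_mulVec hx hy hd0)

lemma deltaMin_le_left (B : Matrix (Fin k) (Fin k) ℝ) (i : Fin k) :
    deltaMin B ≤ |(B.adjugate *ᵥ 1) i| :=
  (min_le_left _ _).trans (ciInf_le (Set.finite_range _).bddBelow i)

lemma deltaMin_le_right (B : Matrix (Fin k) (Fin k) ℝ) (i : Fin k) :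
    deltaMin B ≤ |(Bᵀ.adjugate *ᵥ 1) i| :=
  (min_le_right _ _).trans (ciInf_le (Set.finite_range _).bddBelow i)

lemma IsUniqueNash.deltaMin_pos {A : Matrix (Fin n) (Fin m) ℝ} {x : Fin n → ℝ}
    {y : Fin m → ℝ} (h : IsUniqueNash A x y) (hx : (supp x).card = k) (hy : (supp y).card = k) :
    0 < deltaMin (subMatrix A (supp x) (supp y) hx hy) := by
  have : Nonempty (Fin k) := ⟨⟨0, h.1.card_supp_pos hx⟩⟩
  have hD := h.detD_ne_zero hx hy
  refine lt_min ?_ ?_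
  · obtain ⟨b, hb⟩ := exists_eq_ciInf_of_finite
      (f := fun i => |((subMatrix A (supp x) (supp y) hx hy).adjugate *ᵥ 1) i|)
    rw [← hb, h.1.adjugate_mulVec_one hx hy b]
    exact abs_pos.2 (mul_ne_zero hD (mem_supp.1 (Finset.orderEmbOfFin_mem _ hy b)).ne')
  · obtain ⟨b, hb⟩ := exists_eq_ciInf_of_finite
      (f := fun i => |((subMatrix A (supp x) (supp y) hx hy)ᵀ.adjugate *ᵥ 1) i|)
    rw [← hb, h.1.adjugate_transpose_mulVec_one hx hy b]
    exact abs_pos.2 (mul_ne_zero hD (mem_supp.1 (Finset.orderEmbOfFin_mem _ hx b)).ne')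

lemma iInf_iInf_coe_pos [NeZero n] {p : Fin n → Prop} {f : Fin n → ℝ} (h : ∀ i, p i → 0 < f i) :
    (0 : EReal) < ⨅ i, ⨅ _ : p i, (f i : EReal) := by
  obtain ⟨i, hi⟩ := exists_eq_ciInf_of_finite (f := fun i => ⨅ _ : p i, (f i : EReal))
  rw [← hi]
  by_cases hp : p i
  · simpa [hp] using h i hp
  · simp [hp]

lemma IsUniqueNash.deltaG_pos {A : Matrix (Fin n) (Fin m) ℝ} {x : Fin n → ℝ}
    {y : Fin m → ℝ} (h : IsUniqueNash A x y) : 0 < deltaG A x y := by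
  have hn : NeZero n := ⟨by
    rintro rfl
    have := h.1.1.2
    simp at this⟩
  have hm : NeZero m := ⟨by
    rintro rfl
    have := h.1.2.1.2
    simp at this⟩
  exact lt_min (iInf_iInf_coe_pos fun i hi => sub_pos.2 (h.mulVec_lt hi))
    (iInf_iInf_coe_pos fun j hj => sub_pos.2 (h.lt_vecMul hj))

lemma le_sub_mulVec_of_le_deltaG {A : Matrix (Fin n) (Fin m) ℝ} {x : Fin n → ℝ}
    {y : Fin m → ℝ} {G : ℝ} (hG : (G : EReal) ≤ deltaG A x y) {i : Fin n} (hi : i ∉ supp x) :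
    G ≤ payoff A x y - (A *ᵥ y) i := by
  have := hG.trans ((min_le_left _ _).trans (iInf₂_le i hi))
  exact_mod_cast this

lemma le_vecMul_sub_of_le_deltaG {A : Matrix (Fin n) (Fin m) ℝ} {x : Fin n → ℝ}
    {y : Fin m → ℝ} {G : ℝ} (hG : (G : EReal) ≤ deltaG A x y) {j : Fin m} (hj : j ∉ supp y) :
    G ≤ (x ᵥ* A) j - payoff A x y := by
  have := hG.trans ((min_le_right _ _).trans (iInf₂_le j hj))
  exact_mod_cast this

/-! ### Stability of the supports -/

lemma abs_mulVec_le_sum {A : Matrix (Fin n) (Fin m) ℝ} {c : ℝ} (hA : ∀ i j, |A i j| ≤ c)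
    (d : Fin m → ℝ) (i : Fin n) : |(A *ᵥ d) i| ≤ c * ∑ j, |d j| := by
  simp only [mulVec, dotProduct, Finset.mul_sum]
  refine (Finset.abs_sum_le_sum_abs _ _).trans (Finset.sum_le_sum fun j _ => ?_)
  rw [abs_mul]
  gcongr
  exact hA i j

/-- The strategy is `adj(B') 1 / D'`. The entries of `adj(B) 1 = D y` have one sign and modulus at
least `Δ`; a change by `c δ ≤ Δ / 2` keeps the sign, so the quotient is positive on `J`. Summation
gives `|D| ≥ k Δ`, hence `|D'| ≥ k Δ / 2` and an `ℓ¹`-error of `4 c δ / Δ`. Entries of `A'` up to 2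
double it, and replacing `A'` by `A` adds `δ`. -/
lemma exists_perturbed_equalizer {c δ Δ : ℝ} (hc : AdjBound k c) (hk : 0 < k)
    {A A' : Matrix (Fin n) (Fin m) ℝ} (hA : ∀ i j, |A i j| ≤ 1) (hA' : ∀ i j, |A' i j| ≤ 2)
    (hδ : 0 ≤ δ) (hAA' : ∀ i j, |A' i j - A i j| ≤ δ) (I : Finset (Fin n)) (J : Finset (Fin m))
    (hI : I.card = k) (hJ : J.card = k) {y : Fin m → ℝ} (hy : y ∈ stdSimplex ℝ (Fin m))
    (hyJ : ∀ j, j ∉ J → y j = 0)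
    (hadj : ∀ b, ((subMatrix A I J hI hJ).adjugate *ᵥ 1) b =
      detD (subMatrix A I J hI hJ) * y (J.orderEmbOfFin hJ b))
    (hΔ : 0 < Δ) (hΔle : ∀ b, Δ ≤ |((subMatrix A I J hI hJ).adjugate *ᵥ 1) b|)
    (hδΔ : 2 * c * δ ≤ Δ) :
    detD (subMatrix A' I J hI hJ) ≠ 0 ∧
    ∃ y' ∈ stdSimplex ℝ (Fin m), supp y' = J ∧
      (∀ i ∈ I, (A' *ᵥ y') i =
        (subMatrix A' I J hI hJ).det / detD (subMatrix A' I J hI hJ)) ∧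
      ∀ i, |(A' *ᵥ y') i - (A *ᵥ y) i| ≤ δ + 8 * c * δ / Δ := by
  set B := subMatrix A I J hI hJ with hB
  set B' := subMatrix A' I J hI hJ with hB'
  set v := B'.adjugate *ᵥ 1 with hv
  set D := detD B with hD
  set D' := detD B' with hD'
  have hc0 : 0 ≤ c := zero_le_one.trans hc.one_le
  have hcδ : 0 ≤ c * δ := mul_nonneg hc0 hδ
  have hyn : ∀ b, 0 ≤ y (J.orderEmbOfFin hJ b) := fun b => hy.1 _
  have hysum : ∑ b, y (J.orderEmbOfFin hJ b) = 1 := by rw [sum_orderEmbOfFin hJ hyJ, hy.2]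
  have hkR : (0 : ℝ) < k := by exact_mod_cast hk
  have hclose : ∀ b, |v b - D * y (J.orderEmbOfFin hJ b)| ≤ c * δ := by
    intro b
    rw [← hadj b]
    exact hc.lip B' B (fun a b => hA' _ _) (fun a b => (hA _ _).trans (by norm_num)) δ hδ
      (fun a b => hAA' _ _) b
  have hD'v : D' = ∑ b, v b := detD_eq_sum B'
  have hDD' : |D' - D| ≤ k * (c * δ) := by
    have : D' - D = ∑ b, (v b - D * y (J.orderEmbOfFin hJ b)) := by
      rw [Finset.sum_sub_distrib, ← Finset.mul_sum, hysum, ← hD'v, mul_one]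
    rw [this]
    refine (Finset.abs_sum_le_sum_abs _ _).trans ((Finset.sum_le_sum fun b _ => hclose b).trans ?_)
    simp
  have hDΔ : k * Δ ≤ |D| := by
    have : ∑ b, |D * y (J.orderEmbOfFin hJ b)| = |D| := by
      simp_rw [abs_mul, abs_of_nonneg (hyn _), ← Finset.mul_sum, hysum, mul_one]
    rw [← this]
    refine le_trans (by simp) (Finset.sum_le_sum fun b _ => (hadj b) ▸ hΔle b)
  have hD'Δ : k * Δ / 2 ≤ |D'| := by
    have h1 : |D| ≤ |D'| + |D' - D| := by
      have := abs_sub_abs_le_abs_sub D D'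
      rw [abs_sub_comm] at this
      linarith
    nlinarith
  have hD'0 : D' ≠ 0 := by
    have : 0 < k * Δ / 2 := by positivity
    exact abs_pos.1 (this.trans_le hD'Δ)
  set u : Fin k → ℝ := fun b => v b / D' with hu
  have hupos : ∀ b, 0 < u b := by
    have hcases : (∀ b, 0 < v b) ∨ ∀ b, v b < 0 := by
      have hD0 : D ≠ 0 := by
        rintro h0
        rw [h0, abs_zero] at hDΔ
        nlinarith
      rcases lt_or_gt_of_ne hD0 with hneg | hpos
      · right
        intro b
        have h1 := hΔle b
        rw [hadj b, abs_of_nonpos (mul_nonpos_of_nonpos_of_nonneg hneg.le (hyn b))] at h1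
        have h2 := (abs_le.1 (hclose b)).2
        nlinarith
      · left
        intro b
        have h1 := hΔle b
        rw [hadj b, abs_of_nonneg (mul_nonneg hpos.le (hyn b))] at h1
        have h2 := (abs_le.1 (hclose b)).1
        nlinarith
    have : Nonempty (Fin k) := ⟨⟨0, hk⟩⟩
    rcases hcases with h | h
    · have : 0 < D' := hD'v ▸ Finset.sum_pos (fun b _ => h b) Finset.univ_nonempty
      exact fun b => div_pos (h b) this
    · have : D' < 0 := hD'v ▸ Finset.sum_neg (fun b _ => h b) Finset.univ_nonempty
      exact fun b => div_pos_of_neg_of_neg (h b) this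
  have husum : ∑ b, u b = 1 := by
    rw [hu, ← Finset.sum_div, ← hD'v, div_self hD'0]
  have hudiff : ∑ b, |u b - y (J.orderEmbOfFin hJ b)| ≤ 4 * c * δ / Δ := by
    have h1 : ∀ b, |D'| * |u b - y (J.orderEmbOfFin hJ b)| ≤
        c * δ + k * (c * δ) * y (J.orderEmbOfFin hJ b) := by
      intro b
      rw [← abs_mul]
      have e : D' * (u b - y (J.orderEmbOfFin hJ b)) =
          (v b - D * y (J.orderEmbOfFin hJ b)) + -((D' - D) * y (J.orderEmbOfFin hJ b)) := by
        simp only [hu]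
        field_simp
        ring
      rw [e]
      refine (abs_add_le _ _).trans (add_le_add (hclose b) ?_)
      rw [abs_neg, abs_mul, abs_of_nonneg (hyn b)]
      exact mul_le_mul_of_nonneg_right hDD' (hyn b)
    have h2 : |D'| * ∑ b, |u b - y (J.orderEmbOfFin hJ b)| ≤ 2 * k * (c * δ) := by
      rw [Finset.mul_sum]
      refine (Finset.sum_le_sum fun b _ => h1 b).trans ?_
      rw [Finset.sum_add_distrib, Finset.sum_const, ← Finset.mul_sum, hysum]
      simp
      linarith
    have h3 : 0 ≤ ∑ b, |u b - y (J.orderEmbOfFin hJ b)| := by positivity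
    rw [le_div_iff₀ hΔ]
    have h4 := mul_le_mul_of_nonneg_right hD'Δ h3
    have h5 : (k : ℝ) * (Δ / 2 * ∑ b, |u b - y (J.orderEmbOfFin hJ b)|) ≤ k * (2 * (c * δ)) := by
      linarith
    have h6 := le_of_mul_le_mul_left h5 hkR
    linarith
  set y' := extendZero J hJ u with hy'
  have hy'J : ∀ j, j ∉ J → y' j = 0 := fun j hj => extendZero_of_notMem _ _ _ hj
  have hy'u : (fun b => y' (J.orderEmbOfFin hJ b)) = u := by
    ext b; exact extendZero_apply _ _ _ _
  have hsupp : supp y' = J := by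
    ext j
    rw [mem_supp]
    constructor
    · intro h
      by_contra hj
      rw [hy'J j hj] at h
      exact lt_irrefl _ h
    · intro h
      obtain ⟨b, rfl⟩ := exists_orderEmbOfFin_eq hJ h
      rw [hy', extendZero_apply]
      exact hupos b
  have hdiff : ∑ j, |y' j - y j| ≤ 4 * c * δ / Δ := by
    rw [← sum_orderEmbOfFin hJ (f := fun j => |y' j - y j|) fun j hj => by
      rw [hy'J j hj, hyJ j hj]; simp]
    simpa only [hy', extendZero_apply] using hudiff
  refine ⟨hD'0, y', ⟨fun j => ?_, ?_⟩, hsupp, fun i hi => ?_, fun i => ?_⟩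
  · by_cases hj : j ∈ J
    · exact (mem_supp.1 (hsupp.symm ▸ hj)).le
    · exact (hy'J j hj).ge
  · rw [← sum_orderEmbOfFin hJ hy'J]
    simpa only [hy', extendZero_apply] using husum
  · obtain ⟨a, rfl⟩ := exists_orderEmbOfFin_eq hI hi
    rw [← subMatrix_mulVec_eq A' I J hI hJ hy'J, hy'u]
    have e : u = D'⁻¹ • v := by ext b; simp [hu, div_eq_inv_mul]
    rw [← hB', e, mulVec_smul, hv, mulVec_mulVec, mul_adjugate]
    simp [smul_mulVec, div_eq_inv_mul]
  · have e : (A' *ᵥ y') i - (A *ᵥ y) i = (A' *ᵥ (y' - y)) i + ((A' - A) *ᵥ y) i := by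
      rw [mulVec_sub, sub_mulVec]; simp
    rw [e]
    have h1 := abs_mulVec_le_sum hA' (y' - y) i
    have h2 := abs_mulVec_le_sum (A := A' - A) hAA' y i
    have h3 : ∑ j, |y j| = 1 := by simp_rw [abs_of_nonneg (hy.1 _)]; exact hy.2
    rw [h3] at h2
    simp only [Pi.sub_apply] at h1
    refine (abs_add_le _ _).trans ?_
    have h4 : 2 * ∑ j, |y' j - y j| ≤ 2 * (4 * c * δ / Δ) := by gcongr
    have h5 : 2 * (4 * c * δ / Δ) = 8 * c * δ / Δ := by ring
    linarith

/-- `(x', y')` is a strictly complementary equilibrium of value `v`. Equilibria are interchangeable,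
so `x` is a best reply to `y'` and lives on `supp x'`, and it equalizes the columns of `supp y'`; by
`hns` only `x'` does both. -/
lemma IsNash.left_eq_of_strict {A : Matrix (Fin n) (Fin m) ℝ} {x x' : Fin n → ℝ}
    {y y' : Fin m → ℝ} (h : IsNash A x y) {v : ℝ} (hx' : x' ∈ stdSimplex ℝ (Fin n))
    (hy' : y' ∈ stdSimplex ℝ (Fin m)) (h1 : ∀ i ∈ supp x', (A *ᵥ y') i = v)
    (h2 : ∀ i, i ∉ supp x' → (A *ᵥ y') i < v) (h3 : ∀ j ∈ supp y', (x' ᵥ* A) j = v)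
    (h4 : ∀ j, v ≤ (x' ᵥ* A) j)
    (hns : ∀ z : Fin n → ℝ, ∑ i, z i = 0 → (∀ i, i ∉ supp x' → z i = 0) →
      (∀ j ∈ supp y', (z ᵥ* A) j = 0) → z = 0) : x = x' := by
  have hle : ∀ i, (A *ᵥ y') i ≤ v := fun i => by
    by_cases hi : i ∈ supp x'
    · exact (h1 i hi).le
    · exact (h2 i hi).le
  have e1 : payoff A x y ≤ payoff A x y' := h.2.2.2 y' hy'
  have e2 : payoff A x y' ≤ v := payoff_le_of_mulVec_le h.1 hle
  have e3 : v ≤ payoff A x' y := le_payoff_of_le_vecMul h.2.1 h4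
  have e4 : payoff A x' y ≤ payoff A x y := h.2.2.1 x' hx'
  have e5 : payoff A x y' = v := by linarith
  have e6 : payoff A x y = v := by linarith
  have hsub : ∀ i, i ∉ supp x' → x i = 0 := by
    intro i hi
    by_contra hne
    exact (h2 i hi).ne (eq_of_sum_mul_eq h.1 hle e5 (lt_of_le_of_ne (h.1.1 i) (Ne.symm hne)))
  have hcol : ∀ j ∈ supp y', (x ᵥ* A) j = v := by
    intro j hj
    have := eq_of_sum_mul_eq (f := fun j => -(x ᵥ* A) j) (v := -v) hy'
      (fun j => neg_le_neg (e6 ▸ h.le_vecMul j)) (by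
        rw [← e5, payoff_eq_sum_right, ← Finset.sum_neg_distrib]
        exact Finset.sum_congr rfl fun j _ => by ring) (mem_supp.1 hj)
    simpa using this
  have := hns (x - x') (by simp [Finset.sum_sub_distrib, h.1.2, hx'.2])
    (fun i hi => by simp [hsub i hi, eq_zero_of_notMem_supp hx' hi])
    (fun j hj => by rw [sub_vecMul]; simp [hcol j hj, h3 j hj])
  exact sub_eq_zero.1 this

lemma eq_zero_of_vecMul_supp_eq_zero {A : Matrix (Fin n) (Fin m) ℝ} {I : Finset (Fin n)}
    {J : Finset (Fin m)} (hI : I.card = k) (hJ : J.card = k)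
    (hD : detD (subMatrix A I J hI hJ) ≠ 0) {z : Fin n → ℝ} (hz : ∑ i, z i = 0)
    (hzI : ∀ i, i ∉ I → z i = 0) (h : ∀ j ∈ J, (z ᵥ* A) j = 0) : z = 0 := by
  have := eq_zero_of_vecMul_eq_const hD (z := fun a => z (I.orderEmbOfFin hI a))
    (by rw [sum_orderEmbOfFin hI hzI, hz]) (fun a b => by
      rw [vecMul_subMatrix_eq A I J hI hJ hzI, vecMul_subMatrix_eq A I J hI hJ hzI,
        h _ (Finset.orderEmbOfFin_mem _ _ _), h _ (Finset.orderEmbOfFin_mem _ _ _)])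
  ext i
  by_cases hi : i ∈ I
  · obtain ⟨a, rfl⟩ := exists_orderEmbOfFin_eq hI hi
    exact congrFun this a
  · exact hzI i hi

/-- The perturbed equalizers on the old supports change the value and the payoffs of all pure
actions by at most `δ + 8 c δ / Δ ≤ 9 c δ / Δ`, because `Δ ≤ c`. Twice this is below the gap `G`,
whence the constant 18. So they form a strictly complementary equilibrium of `A'`, with nonzero
`D'`, and every equilibrium of `A'` equals it. -/
lemma IsUniqueNash.supp_eq_of_near {A A' : Matrix (Fin n) (Fin m) ℝ} {x : Fin n → ℝ}
    {y : Fin m → ℝ} (h : IsUniqueNash A x y) (hA : ∀ i j, |A i j| ≤ 1) (hx : (supp x).card = k)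
    (hy : (supp y).card = k) {c G δ : ℝ} (hc : AdjBound k c) (hG2 : G ≤ 2)
    (hG : (G : EReal) ≤ deltaG A x y) (hδ : 0 ≤ δ) (hAA' : ∀ i j, |A' i j - A i j| ≤ δ)
    (hsmall : 18 * c * δ < G * deltaMin (subMatrix A (supp x) (supp y) hx hy))
    {x' : Fin n → ℝ} {y' : Fin m → ℝ} (h' : IsNash A' x' y') :
    supp x' = supp x ∧ supp y' = supp y := by
  set B := subMatrix A (supp x) (supp y) hx hy with hB
  set Δ := deltaMin B with hΔ
  have hk := h.1.card_supp_pos hx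
  have hΔ0 : 0 < Δ := h.deltaMin_pos hx hy
  have hc1 := hc.one_le
  have hΔc : Δ ≤ c := (deltaMin_le_left B ⟨0, hk⟩).trans (hc.entry B (fun a b => hA _ _) _)
  have hcδ : 0 ≤ c * δ := mul_nonneg (zero_le_one.trans hc1) hδ
  have hGΔ : G * Δ ≤ 2 * Δ := by gcongr
  have hδΔ : 2 * c * δ ≤ Δ := by nlinarith
  have hδ1 : δ ≤ 1 := by
    by_contra hn
    nlinarith
  have hA' : ∀ i j, |A' i j| ≤ 2 := by
    intro i j
    have h1 := abs_sub_abs_le_abs_sub (A' i j) (A i j)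
    linarith [hA i j, hAA' i j]
  have hgap : 2 * (δ + 8 * c * δ / Δ) < G := by
    have h1 : δ ≤ c * δ / Δ := by
      rw [le_div_iff₀ hΔ0, mul_comm c]
      gcongr
    have h2 : 18 * (c * δ / Δ) < G := by
      rw [← mul_div_assoc, div_lt_iff₀ hΔ0]
      linarith
    have h3 : 8 * c * δ / Δ = 8 * (c * δ / Δ) := by ring
    linarith
  obtain ⟨hD', q, hq, hqJ, hqV, hqd⟩ := exists_perturbed_equalizer hc hk hA hA' hδ hAA' (supp x)
    (supp y) hx hy h.1.2.1 (fun j hj => eq_zero_of_notMem_supp h.1.2.1 hj)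
    (h.1.adjugate_mulVec_one hx hy) hΔ0 (deltaMin_le_left B) hδΔ
  obtain ⟨-, p, hp, hpI, hpV, hpd⟩ := exists_perturbed_equalizer (A := Aᵀ) (A' := A'ᵀ) hc hk
    (fun i j => hA j i) (fun i j => hA' j i) hδ (fun i j => hAA' j i) (supp y)
    (supp x) hy hx h.1.1 (fun j hj => eq_zero_of_notMem_supp h.1.1 hj)
    (fun b => by
      rw [subMatrix_transpose, detD_transpose]
      exact h.1.adjugate_transpose_mulVec_one hx hy b) hΔ0 (deltaMin_le_right B) hδΔ
  rw [subMatrix_transpose, detD_transpose, det_transpose] at hpV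
  simp only [mulVec_transpose] at hpV hpd
  set v := (subMatrix A' (supp x) (supp y) hx hy).det / detD (subMatrix A' (supp x) (supp y) hx hy)
    with hv
  set V := payoff A x y with hV
  set ε := δ + 8 * c * δ / Δ with hε
  have hvV : |v - V| ≤ ε := by
    have := Finset.orderEmbOfFin_mem (supp x) hx ⟨0, hk⟩
    rw [← hqV _ this, hV, ← h.1.mulVec_eq this]
    exact hqd _
  have hvV' := abs_le.1 hvV
  have hrow : ∀ i, i ∉ supp x → (A' *ᵥ q) i < v := by
    intro i hi
    have h1 := le_sub_mulVec_of_le_deltaG hG hi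
    have h2 := (abs_le.1 (hqd i)).2
    linarith
  have hcol : ∀ j, j ∉ supp y → v < (p ᵥ* A') j := by
    intro j hj
    have h1 := le_vecMul_sub_of_le_deltaG hG hj
    have h2 := (abs_le.1 (hpd j)).1
    linarith
  constructor
  · have := h'.left_eq_of_strict hp hq (v := v) (hpI ▸ hqV) (hpI ▸ hrow) (hqJ ▸ hpV)
      (fun j => by
        by_cases hj : j ∈ supp y
        · exact (hpV j hj).ge
        · exact (hcol j hj).le)
      (fun z hz hzI hzJ => eq_zero_of_vecMul_supp_eq_zero hx hy hD' hz (hpI ▸ hzI) (hqJ ▸ hzJ))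
    rw [this, hpI]
  · have := h'.swap.left_eq_of_strict hq hp (v := -v)
      (fun j hj => by
        rw [neg_mulVec, mulVec_transpose, Pi.neg_apply, hpV j (hqJ ▸ hj)])
      (fun j hj => by
        rw [neg_mulVec, mulVec_transpose, Pi.neg_apply]
        exact neg_lt_neg (hcol j (hqJ ▸ hj)))
      (fun i hi => by
        rw [vecMul_neg, vecMul_transpose, Pi.neg_apply, hqV i (hpI ▸ hi)])
      (fun i => by
        rw [vecMul_neg, vecMul_transpose, Pi.neg_apply]
        refine neg_le_neg ?_
        by_cases hi : i ∈ supp x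
        · exact (hqV i hi).le
        · exact (hrow i hi).le)
      (fun z hz hzJ hzI => by
        refine eq_zero_of_vecMul_supp_eq_zero (A := A'ᵀ) hy hx ?_ hz (hqJ ▸ hzJ) ?_
        · rwa [subMatrix_transpose, detD_transpose]
        · intro i hi
          have := hzI i (hpI.symm ▸ hi)
          rw [vecMul_neg, Pi.neg_apply, neg_eq_zero] at this
          exact this)
    rw [this, hqJ]

/-- Two strategies on `supp x` that nearly equalize the columns of `supp y` are close. -/
lemma sum_abs_sub_le_of_equalizing {A : Matrix (Fin n) (Fin m) ℝ} (hA : ∀ i j, |A i j| ≤ 1)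
    {I : Finset (Fin n)} {J : Finset (Fin m)} (hI : I.card = k) (hJ : J.card = k) {c η : ℝ}
    (hc : AdjBound k c) {z : Fin n → ℝ} (hz : ∑ i, z i = 0) (hzI : ∀ i, i ∉ I → z i = 0)
    (h : ∀ j ∈ J, ∀ j' ∈ J, |(z ᵥ* A) j - (z ᵥ* A) j'| ≤ η) :
    |detD (subMatrix A I J hI hJ)| * ∑ i, |z i| ≤ k * (k * (η * c)) := by
  have h1 := abs_detD_mul_le (subMatrix A I J hI hJ) (fun a => z (I.orderEmbOfFin hI a))
    (by rw [sum_orderEmbOfFin hI hzI, hz]) (hc.shift _ fun a b => hA _ _) (η := η) (fun a b => by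
      rw [vecMul_subMatrix_eq A I J hI hJ hzI, vecMul_subMatrix_eq A I J hI hJ hzI]
      exact h _ (Finset.orderEmbOfFin_mem _ _ _) _ (Finset.orderEmbOfFin_mem _ _ _))
  rw [← sum_orderEmbOfFin hI (f := fun i => |z i|) fun i hi => by rw [hzI i hi, abs_zero],
    Finset.mul_sum]
  refine (Finset.sum_le_sum fun a _ => ?_).trans_eq (b := ∑ _a : Fin k, (k : ℝ) * (η * c)) (by simp)
  rw [← abs_mul]
  exact h1 a

end MatrixGame

end

noncomputable section

namespace MatrixGame

/-! ### Exponential weights -/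

section Hedge

variable {ι : Type*}

/-- Valid for all real `x`, so the regret bound needs no upper limit on the learning rate. -/
lemma exp_le_add_exp_sq (x : ℝ) : Real.exp x ≤ x + Real.exp (x ^ 2) := by
  have h1 := Real.add_one_le_exp (x ^ 2)
  rcases le_or_gt |x| 1 with h | h
  · have := (abs_le.1 (Real.abs_exp_sub_one_sub_id_le h)).2
    linarith
  · rcases lt_abs.1 h with h | h
    · have : Real.exp x ≤ Real.exp (x ^ 2) := Real.exp_le_exp.2 (by nlinarith)
      linarith
    · have : Real.exp x ≤ 1 := Real.exp_le_one_iff.2 (by linarith)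
      nlinarith

/-- The exponential weights with learning rate `η` on the finite set `E`, for cumulative gains
`S`. -/
def hedgeWeight (η : ℝ) (E : Finset ι) (S : ι → ℝ) (e : ι) : ℝ :=
  Real.exp (η * S e) / ∑ e' ∈ E, Real.exp (η * S e')

lemma hedgeWeight_nonneg (η : ℝ) (E : Finset ι) (S : ι → ℝ) (e : ι) : 0 ≤ hedgeWeight η E S e := by
  unfold hedgeWeight
  positivity

lemma sum_exp_pos (η : ℝ) {E : Finset ι} (hE : E.Nonempty) (S : ι → ℝ) :
    0 < ∑ e' ∈ E, Real.exp (η * S e') :=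
  Finset.sum_pos (fun _ _ => Real.exp_pos _) hE

lemma sum_hedgeWeight (η : ℝ) {E : Finset ι} (hE : E.Nonempty) (S : ι → ℝ) :
    ∑ e ∈ E, hedgeWeight η E S e = 1 := by
  simp only [hedgeWeight, ← Finset.sum_div]
  exact div_self (sum_exp_pos η hE S).ne'

/-- Each gain is within `r` of the mean, and the linear term of the previous inequality averages to
zero around the mean. -/
lemma sum_mul_exp_le {E : Finset ι} {p a : ι → ℝ} (hp : ∀ e ∈ E, 0 ≤ p e) (hs : ∑ e ∈ E, p e = 1)
    {η r : ℝ} (ha : ∀ e ∈ E, ∀ e' ∈ E, |a e - a e'| ≤ r) :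
    ∑ e ∈ E, p e * Real.exp (η * a e) ≤
      Real.exp (η * (∑ e ∈ E, p e * a e) + η ^ 2 * r ^ 2) := by
  set μ := ∑ e ∈ E, p e * a e with hμ
  have hdev : ∀ e ∈ E, |a e - μ| ≤ r := by
    intro e he
    have : a e - μ = ∑ e' ∈ E, p e' * (a e - a e') := by
      simp_rw [mul_sub, Finset.sum_sub_distrib, ← Finset.sum_mul, hs, one_mul, hμ]
    rw [this]
    calc |∑ e' ∈ E, p e' * (a e - a e')| ≤ ∑ e' ∈ E, |p e' * (a e - a e')| :=
          Finset.abs_sum_le_sum_abs _ _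
      _ ≤ ∑ e' ∈ E, p e' * r := Finset.sum_le_sum fun e' he' => by
          rw [abs_mul, abs_of_nonneg (hp e' he')]
          exact mul_le_mul_of_nonneg_left (ha e he e' he') (hp e' he')
      _ = r := by rw [← Finset.sum_mul, hs, one_mul]
  have h1 : ∀ e ∈ E, p e * Real.exp (η * (a e - μ)) ≤
      p e * (η * (a e - μ)) + p e * Real.exp (η ^ 2 * r ^ 2) := by
    intro e he
    rw [← mul_add]
    refine mul_le_mul_of_nonneg_left ((exp_le_add_exp_sq _).trans ?_) (hp e he)
    gcongr
    rw [mul_pow]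
    have := sq_le_sq' (by linarith [(abs_le.1 (hdev e he)).1]) (abs_le.1 (hdev e he)).2
    gcongr
  have h2 := Finset.sum_le_sum h1
  have h3 : ∑ e ∈ E, p e * (η * (a e - μ)) = 0 := by
    have : ∀ e, p e * (η * (a e - μ)) = η * (p e * a e - p e * μ) := fun e => by ring
    simp_rw [this, ← Finset.mul_sum, Finset.sum_sub_distrib, ← Finset.sum_mul, hs, ← hμ]
    ring
  rw [Finset.sum_add_distrib, h3, ← Finset.sum_mul, hs, zero_add, one_mul] at h2
  calc ∑ e ∈ E, p e * Real.exp (η * a e)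
      = Real.exp (η * μ) * ∑ e ∈ E, p e * Real.exp (η * (a e - μ)) := by
        rw [Finset.mul_sum]
        refine Finset.sum_congr rfl fun e _ => ?_
        rw [mul_left_comm, ← Real.exp_add]
        ring_nf
    _ ≤ Real.exp (η * μ) * Real.exp (η ^ 2 * r ^ 2) := by gcongr
    _ = _ := by rw [← Real.exp_add]

/-- The potential is the logarithm of the total weight: it starts at `log |E|`, grows in a round by
at most `η` times the mixture's gain plus `η ^ 2 r ^ 2`, and finally dominates `η` times the gain of
`u`. -/
lemma hedge_regret_le {E : Finset ι} {a : ℕ → ι → ℝ} {L : ℕ} {η r : ℝ} (hη : 0 < η)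
    (ha : ∀ s < L, ∀ e ∈ E, ∀ e' ∈ E, |a s e - a s e'| ≤ r) {u : ι} (hu : u ∈ E) :
    ∑ s ∈ Finset.range L, (a s u -
      ∑ e ∈ E, hedgeWeight η E (fun e => ∑ τ ∈ Finset.range s, a τ e) e * a s e) ≤
      Real.log E.card / η + η * r ^ 2 * L := by
  have hE : E.Nonempty := ⟨u, hu⟩
  set S : ℕ → ι → ℝ := fun s e => ∑ τ ∈ Finset.range s, a τ e with hS
  set Φ : ℕ → ℝ := fun s => ∑ e ∈ E, Real.exp (η * S s e) with hΦ
  have hΦ0 : ∀ s, 0 < Φ s := fun s => sum_exp_pos η hE _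
  have hstep : ∀ s < L, Real.log (Φ (s + 1)) ≤
      Real.log (Φ s) + (η * (∑ e ∈ E, hedgeWeight η E (S s) e * a s e) + η ^ 2 * r ^ 2) := by
    intro s hs
    have h1 : Φ (s + 1) = Φ s * ∑ e ∈ E, hedgeWeight η E (S s) e * Real.exp (η * a s e) := by
      rw [Finset.mul_sum]
      refine Finset.sum_congr rfl fun e _ => ?_
      have : Φ s = ∑ e' ∈ E, Real.exp (η * S s e') := rfl
      rw [hedgeWeight, ← this, hS]
      simp only [Finset.sum_range_succ, mul_add, Real.exp_add]
      have := (hΦ0 s).ne'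
      field_simp
    have h2 := sum_mul_exp_le (fun e _ => hedgeWeight_nonneg η E (S s) e)
      (sum_hedgeWeight η hE (S s)) (η := η) (ha s hs)
    have h3 : Φ (s + 1) ≤ Φ s * Real.exp (η * (∑ e ∈ E, hedgeWeight η E (S s) e * a s e) +
        η ^ 2 * r ^ 2) := by
      rw [h1]; exact mul_le_mul_of_nonneg_left h2 (hΦ0 s).le
    have h4 := Real.log_le_log (hΦ0 _) h3
    rwa [Real.log_mul (hΦ0 s).ne' (Real.exp_pos _).ne', Real.log_exp] at h4
  have htot : ∀ M ≤ L, Real.log (Φ M) ≤ Real.log (Φ 0) +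
      ∑ s ∈ Finset.range M,
        (η * (∑ e ∈ E, hedgeWeight η E (S s) e * a s e) + η ^ 2 * r ^ 2) := by
    intro M
    induction M with
    | zero => simp
    | succ M ih =>
      intro hM
      rw [Finset.sum_range_succ]
      have := ih (by omega)
      have := hstep M (by omega)
      linarith
  have h0 : Φ 0 = E.card := by simp [hΦ, hS]
  have hL : η * S L u ≤ Real.log (Φ L) := by
    rw [← Real.log_exp (η * S L u)]
    exact Real.log_le_log (Real.exp_pos _)
      (Finset.single_le_sum (f := fun e => Real.exp (η * S L e)) (fun _ _ => (Real.exp_pos _).le) hu)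
  have h5 := hL.trans (htot L le_rfl)
  rw [h0, Finset.sum_add_distrib, ← Finset.mul_sum] at h5
  simp only [Finset.sum_const, Finset.card_range, nsmul_eq_mul] at h5
  rw [Finset.sum_sub_distrib]
  have h6 : ∑ s ∈ Finset.range L, a s u = S L u := rfl
  rw [h6, div_add' _ _ _ hη.ne', le_div_iff₀ hη]
  nlinarith

/-- The learning rate for horizon `L` and gains of range `r`. -/
def hedgeRate (E : Finset ι) (L : ℕ) (r : ℝ) : ℝ := Real.sqrt (Real.log E.card / L) / r

/-- The rate is tuned to the planned length `L`, while only `L'` rounds may be played, as in the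
last epoch. For `r = 0` the rate is 0 by division by zero, but then all gains coincide. -/
lemma hedge_regret_le_sqrt {E : Finset ι} {a : ℕ → ι → ℝ} {L L' : ℕ} (hL : L' ≤ L) {r : ℝ}
    (hr : 0 ≤ r) (ha : ∀ s < L', ∀ e ∈ E, ∀ e' ∈ E, |a s e - a s e'| ≤ r) {u : ι} (hu : u ∈ E)
    (hE : 0 < r → 2 ≤ E.card) :
    ∑ s ∈ Finset.range L', (a s u -
      ∑ e ∈ E, hedgeWeight (hedgeRate E L r) E (fun e => ∑ τ ∈ Finset.range s, a τ e) e * a s e) ≤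
      2 * r * Real.sqrt (L * Real.log E.card) := by
  have hEn : E.Nonempty := ⟨u, hu⟩
  rcases L.eq_zero_or_pos with rfl | hL0
  · have : L' = 0 := by omega
    subst this
    simp
  rcases hr.eq_or_lt with rfl | hr
  · simp only [mul_zero, zero_mul]
    refine Finset.sum_nonpos fun s hs => ?_
    have : ∀ e ∈ E, a s e = a s u := fun e he => by
      have := ha s (Finset.mem_range.1 hs) e he u hu
      exact sub_eq_zero.1 (abs_eq_zero.1 (le_antisymm this (abs_nonneg _)))
    rw [Finset.sum_congr rfl fun e he => by rw [this e he], ← Finset.sum_mul,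
      sum_hedgeWeight _ hEn]
    simp
  · have hlog : 0 < Real.log E.card := Real.log_pos (by exact_mod_cast hE hr)
    have hLR : (0 : ℝ) < L := by exact_mod_cast hL0
    set η := hedgeRate E L r with hη
    have hη0 : 0 < η := div_pos (Real.sqrt_pos.2 (by positivity)) hr
    refine (hedge_regret_le hη0 ha hu).trans ?_
    have hL'L : (L' : ℝ) ≤ L := by exact_mod_cast hL
    calc Real.log E.card / η + η * r ^ 2 * L' ≤ Real.log E.card / η + η * r ^ 2 * L := by gcongr
      _ = 2 * r * Real.sqrt (L * Real.log E.card) := by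
        rw [hη, hedgeRate, Real.sqrt_div hlog.le, Real.sqrt_mul hLR.le]
        set sl := Real.sqrt (Real.log E.card)
        set sL := Real.sqrt (L : ℝ)
        have e1 : Real.log E.card = sl ^ 2 := (Real.sq_sqrt hlog.le).symm
        have e2 : (L : ℝ) = sL ^ 2 := (Real.sq_sqrt hLR.le).symm
        have p1 : 0 < sl := Real.sqrt_pos.2 hlog
        have p2 : 0 < sL := Real.sqrt_pos.2 hLR
        rw [e1, e2]
        field_simp
        ring

end Hedge

end MatrixGame

end

noncomputable section

namespace MatrixGame

variable {n m k N : ℕ}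

/-! ### A grid in the simplex -/

/-- The point `g / N`. -/
def gridPoint (g : Fin n → Fin (N + 1)) : Fin n → ℝ := fun i => (g i : ℝ) / N

/-- The integer vector `g` represents a point of the simplex. -/
def IsGridPoint (g : Fin n → Fin (N + 1)) : Prop := ∑ i, (g i : ℕ) = N

lemma gridPoint_mem (hN : 0 < N) {g : Fin n → Fin (N + 1)} (hg : IsGridPoint g) :
    gridPoint g ∈ stdSimplex ℝ (Fin n) := by
  refine ⟨fun i => by unfold gridPoint; positivity, ?_⟩
  have : (∑ i, (g i : ℝ)) = N := by exact_mod_cast congrArg (Nat.cast (R := ℝ)) hg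
  simp only [gridPoint, ← Finset.sum_div, this]
  have : (N : ℝ) ≠ 0 := by positivity
  exact div_self this

/-- Round every `N * x i` down and put the missing mass, at most `n` units, on one coordinate that
is already positive, so that the support does not grow. -/
lemma exists_gridPoint_near (hN : 0 < N) {x : Fin n → ℝ} (hx : x ∈ stdSimplex ℝ (Fin n)) :
    ∃ g : Fin n → Fin (N + 1), IsGridPoint g ∧ (∀ i, x i = 0 → g i = 0) ∧
      ∑ i, |gridPoint g i - x i| ≤ 2 * n / N := by
  classical
  have hNR : (0 : ℝ) < N := by exact_mod_cast hN
  obtain ⟨i₀, hi₀⟩ : ∃ i, x i ≠ 0 := by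
    by_contra hn
    push Not at hn
    have := hx.2
    simp [hn] at this
  let f : Fin n → ℕ := fun i => ⌊N * x i⌋₊
  have hnn : ∀ i, 0 ≤ N * x i := fun i => mul_nonneg hNR.le (hx.1 i)
  have hf1 : ∀ i, (f i : ℝ) ≤ N * x i := fun i => Nat.floor_le (hnn i)
  have hf2 : ∀ i, N * x i ≤ f i + 1 := fun i => (Nat.lt_floor_add_one _).le
  have hxN : ∑ i, (N : ℝ) * x i = N := by rw [← Finset.mul_sum, hx.2, mul_one]
  have hs1 : ∑ i, f i ≤ N := by
    have : ((∑ i, f i : ℕ) : ℝ) ≤ N := by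
      push_cast
      rw [← hxN]
      exact Finset.sum_le_sum fun i _ => hf1 i
    exact_mod_cast this
  have hs2 : N - ∑ i, f i ≤ n := by
    have : (N : ℝ) ≤ (∑ i, f i : ℕ) + n := by
      push_cast
      conv_lhs => rw [← hxN]
      refine (Finset.sum_le_sum fun i _ => hf2 i).trans ?_
      simp [Finset.sum_add_distrib]
    have : N ≤ ∑ i, f i + n := by exact_mod_cast this
    omega
  let r := N - ∑ i, f i
  let g' : Fin n → ℕ := fun i => f i + if i = i₀ then r else 0
  have hsum : ∑ i, g' i = N := by
    simp only [g', Finset.sum_add_distrib, Finset.sum_ite_eq', Finset.mem_univ, if_true, r]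
    omega
  have hle : ∀ i, g' i < N + 1 := fun i => by
    have := Finset.single_le_sum (f := g') (fun _ _ => Nat.zero_le _) (Finset.mem_univ i)
    omega
  refine ⟨fun i => ⟨g' i, hle i⟩, hsum, fun i hi => ?_, ?_⟩
  · have h1 : i ≠ i₀ := by rintro rfl; exact hi₀ hi
    ext
    simp [g', h1, f, hi]
  · have hterm : ∀ i, |gridPoint (fun i => (⟨g' i, hle i⟩ : Fin (N + 1))) i - x i| ≤
        (1 + if i = i₀ then (r : ℝ) else 0) / N := by
      intro i
      have e : gridPoint (fun i => (⟨g' i, hle i⟩ : Fin (N + 1))) i - x i =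
          ((f i - N * x i) + if i = i₀ then (r : ℝ) else 0) / N := by
        simp only [gridPoint, g']
        push_cast
        field_simp
        ring
      rw [e, abs_div, abs_of_pos hNR]
      gcongr
      refine (abs_add_le _ _).trans (add_le_add (abs_le.2 ⟨?_, ?_⟩) ?_)
      · linarith [hf2 i]
      · linarith [hf1 i]
      · split_ifs <;> simp
    refine (Finset.sum_le_sum fun i _ => hterm i).trans ?_
    rw [← Finset.sum_div]
    gcongr
    simp only [Finset.sum_add_distrib, Finset.sum_const, Finset.card_univ, Fintype.card_fin,
      nsmul_eq_mul, mul_one, Finset.sum_ite_eq', Finset.mem_univ, if_true]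
    have : (r : ℝ) ≤ n := by exact_mod_cast hs2
    linarith

/-! ### Finite sets of experts -/

/-- Every game at distance at most `ε` from `M` has only equilibria with supports `I` and `J`. -/
def Certified (ε : ℝ) (I : Finset (Fin n)) (J : Finset (Fin m)) (M : Fin n → Fin m → ℝ) : Prop :=
  ENNReal.ofReal ε < Metric.infEDist M
    {M' | ∃ x y, IsNash (Matrix.of M') x y ∧ ¬(supp x = I ∧ supp y = J)}

/-- The coordinates of `v` in `J` differ by at most `η`. -/
def Equalizes (J : Finset (Fin m)) (v : Fin m → ℝ) (η : ℝ) : Prop :=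
  ∀ j ∈ J, ∀ j' ∈ J, |v j - v j'| ≤ η

open Classical in
/-- The grid strategies on `I` that nearly equalize the columns in `J`. -/
def equalizingExperts (ε : ℝ) (N : ℕ) (I : Finset (Fin n)) (J : Finset (Fin m))
    (M : Fin n → Fin m → ℝ) : Finset (Fin n → Fin (N + 1)) :=
  Finset.univ.filter fun g => IsGridPoint g ∧ (∀ i, i ∉ I → g i = 0) ∧
    Equalizes J (gridPoint g ᵥ* Matrix.of M) (4 * ε)

open Classical in
/-- The grid strategies that fit to a certified pair of supports. -/
def certifiedExperts (ε : ℝ) (N : ℕ) (M : Fin n → Fin m → ℝ) : Finset (Fin n → Fin (N + 1)) :=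
  Finset.univ.filter fun g => ∃ I J, Certified ε I J M ∧ g ∈ equalizingExperts ε N I J M

/-- The data do not exclude a completely mixed equilibrium of a square game. -/
def FullyMixedPlausible (ε : ℝ) (N : ℕ) (M : Fin n → Fin m → ℝ) : Prop :=
  n = m ∧ (equalizingExperts ε N Finset.univ Finset.univ M).Nonempty ∧
    (equalizingExperts ε N Finset.univ Finset.univ (fun j i => M i j)).Nonempty

open Classical in
/-- The pure strategies. -/
def pureExperts (n N : ℕ) : Finset (Fin n → Fin (N + 1)) :=
  Finset.univ.image fun i => Pi.single i (Fin.last N)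

open Classical in
/-- The set of experts that is used when `M` is the empirical mean of the payoff matrices. -/
def experts (ε : ℝ) (N : ℕ) (M : Fin n → Fin m → ℝ) : Finset (Fin n → Fin (N + 1)) :=
  if (certifiedExperts ε N M).Nonempty then certifiedExperts ε N M
  else if FullyMixedPlausible ε N M then equalizingExperts ε N Finset.univ Finset.univ M
  else pureExperts n N

lemma mem_equalizingExperts {ε : ℝ} {I : Finset (Fin n)} {J : Finset (Fin m)}
    {M : Fin n → Fin m → ℝ} {g : Fin n → Fin (N + 1)} :
    g ∈ equalizingExperts ε N I J M ↔ IsGridPoint g ∧ (∀ i, i ∉ I → g i = 0) ∧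
      Equalizes J (gridPoint g ᵥ* Matrix.of M) (4 * ε) := by
  simp [equalizingExperts]

lemma mem_certifiedExperts {ε : ℝ} {M : Fin n → Fin m → ℝ} {g : Fin n → Fin (N + 1)} :
    g ∈ certifiedExperts ε N M ↔
      ∃ I J, Certified ε I J M ∧ g ∈ equalizingExperts ε N I J M := by
  simp [certifiedExperts]

lemma mem_pureExperts {g : Fin n → Fin (N + 1)} :
    g ∈ pureExperts n N ↔ ∃ i, Pi.single i (Fin.last N) = g := by
  simp [pureExperts]

lemma experts_nonempty [NeZero n] (ε : ℝ) (M : Fin n → Fin m → ℝ) : (experts ε N M).Nonempty := by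
  unfold experts
  split_ifs with h1 h2
  · exact h1
  · exact h2.2.1
  · exact ⟨_, mem_pureExperts.2 ⟨0, rfl⟩⟩

lemma gridPoint_single (hN : 0 < N) (i : Fin n) :
    gridPoint (Pi.single i (Fin.last N) : Fin n → Fin (N + 1)) = Pi.single i 1 := by
  have : (N : ℝ) ≠ 0 := by positivity
  ext i'
  by_cases h : i' = i
  · subst h; simp [gridPoint, this]
  · simp [gridPoint, h]

lemma isGridPoint_of_mem_experts {ε : ℝ} {M : Fin n → Fin m → ℝ} {g : Fin n → Fin (N + 1)}
    (hg : g ∈ experts ε N M) : IsGridPoint g := by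
  unfold experts at hg
  split_ifs at hg with h1 h2
  · obtain ⟨I, J, -, h⟩ := mem_certifiedExperts.1 hg
    exact (mem_equalizingExperts.1 h).1
  · exact (mem_equalizingExperts.1 hg).1
  · obtain ⟨i, rfl⟩ := mem_pureExperts.1 hg
    unfold IsGridPoint
    rw [Finset.sum_eq_single i]
    · simp
    · intro i' _ h; simp [h]
    · simp

lemma card_pureExperts_le : (pureExperts n N).card ≤ n := by
  unfold pureExperts
  exact Finset.card_image_le.trans (by simp)

lemma card_equalizingExperts_le (ε : ℝ) {I : Finset (Fin n)} (hI : I.card = k)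
    (J : Finset (Fin m)) (M : Fin n → Fin m → ℝ) :
    (equalizingExperts ε N I J M).card ≤ (N + 1) ^ k := by
  have h := Finset.card_le_card_of_injOn (s := equalizingExperts ε N I J M)
    (t := (Finset.univ : Finset (Fin k → Fin (N + 1))))
    (fun g a => g (I.orderEmbOfFin hI a)) (fun _ _ => Finset.mem_univ _) (by
      intro g hg g' hg' h
      have hg := (mem_equalizingExperts.1 hg).2.1
      have hg' := (mem_equalizingExperts.1 hg').2.1
      ext i : 1
      by_cases hi : i ∈ I
      · obtain ⟨a, rfl⟩ := exists_orderEmbOfFin_eq hI hi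
        exact congrFun h a
      · rw [hg i hi, hg' i hi])
  simpa using h

/-! ### The experts on the event that the empirical mean is accurate -/

lemma abs_vecMul_sub_le {A M : Matrix (Fin n) (Fin m) ℝ} {ε : ℝ} (h : ∀ i j, |M i j - A i j| ≤ ε)
    (z : Fin n → ℝ) (j : Fin m) : |(z ᵥ* M) j - (z ᵥ* A) j| ≤ ε * ∑ i, |z i| := by
  have := abs_mulVec_le_sum (A := (M - A)ᵀ) (fun j i => h i j) z j
  rwa [mulVec_transpose, vecMul_sub] at this

lemma sum_abs_of_mem_stdSimplex {x : Fin n → ℝ} (hx : x ∈ stdSimplex ℝ (Fin n)) :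
    ∑ i, |x i| = 1 := by
  simp_rw [abs_of_nonneg (hx.1 _)]; exact hx.2

/-- On `supp y` the columns of the rounded strategy are within `2 ε` of the value, `ε` for the
estimate and `ε` for the rounding. Two of them differ by at most `4 ε`, the tolerance in
`equalizingExperts`. -/
lemma exists_mem_equalizingExperts (hN : 0 < N) {A : Matrix (Fin n) (Fin m) ℝ}
    {M : Fin n → Fin m → ℝ} {x : Fin n → ℝ} {y : Fin m → ℝ} (h : IsNash A x y)
    (hA : ∀ i j, |A i j| ≤ 1) {ε : ℝ} (hM : ∀ i j, |M i j - A i j| ≤ ε)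
    (hε : 2 * n / N ≤ ε) :
    ∃ u ∈ equalizingExperts ε N (supp x) (supp y) M,
      ∑ i, |gridPoint u i - x i| ≤ 2 * n / N := by
  obtain ⟨u, hu, hu0, hux⟩ := exists_gridPoint_near hN h.1
  refine ⟨u, mem_equalizingExperts.2 ⟨hu, fun i hi => hu0 i (eq_zero_of_notMem_supp h.1 hi), ?_⟩,
    hux⟩
  have hd : ∀ j ∈ supp y, |(gridPoint u ᵥ* Matrix.of M) j - payoff A x y| ≤ 2 * ε := by
    intro j hj
    have h1 := abs_vecMul_sub_le (M := Matrix.of M) hM (gridPoint u) j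
    rw [sum_abs_of_mem_stdSimplex (gridPoint_mem hN hu), mul_one] at h1
    have h2 := abs_mulVec_le_sum (A := Aᵀ) (fun j i => hA i j) (gridPoint u - x) j
    rw [mulVec_transpose, sub_vecMul, Pi.sub_apply, h.vecMul_eq hj, one_mul] at h2
    have h3 := h2.trans (hux.trans hε)
    have h1 := abs_le.1 h1
    have h3 := abs_le.1 h3
    exact abs_le.2 ⟨by linarith, by linarith⟩
  intro j hj j' hj'
  have h1 := abs_le.1 (hd j hj)
  have h2 := abs_le.1 (hd j' hj')
  exact abs_le.2 ⟨by linarith, by linarith⟩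

/-- The `ℓ¹`-diameter of a set of grid strategies. -/
def expertDiam (E : Finset (Fin n → Fin (N + 1))) : ℝ :=
  ⨆ p : E × E, ∑ i, |gridPoint p.1.1 i - gridPoint p.2.1 i|

lemma expertDiam_nonneg (E : Finset (Fin n → Fin (N + 1))) : 0 ≤ expertDiam E :=
  Real.iSup_nonneg fun _ => Finset.sum_nonneg fun _ _ => abs_nonneg _

lemma le_expertDiam {E : Finset (Fin n → Fin (N + 1))} {g g' : Fin n → Fin (N + 1)} (hg : g ∈ E)
    (hg' : g' ∈ E) : ∑ i, |gridPoint g i - gridPoint g' i| ≤ expertDiam E :=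
  le_ciSup (f := fun p : E × E => ∑ i, |gridPoint p.1.1 i - gridPoint p.2.1 i|)
    (Set.finite_range _).bddAbove (⟨g, hg⟩, ⟨g', hg'⟩)

lemma expertDiam_le {E : Finset (Fin n → Fin (N + 1))} {c : ℝ} (hc : 0 ≤ c)
    (h : ∀ g ∈ E, ∀ g' ∈ E, ∑ i, |gridPoint g i - gridPoint g' i| ≤ c) : expertDiam E ≤ c :=
  Real.iSup_le (fun p => h _ p.1.2 _ p.2.2) hc

lemma two_le_card_of_expertDiam_pos {E : Finset (Fin n → Fin (N + 1))} (h : 0 < expertDiam E) :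
    2 ≤ E.card := by
  by_contra hn
  have h1 : E.card ≤ 1 := by omega
  refine absurd (expertDiam_le le_rfl fun g hg g' hg' => ?_) (not_le.2 h)
  rw [Finset.card_le_one.1 h1 g hg g' hg']
  simp

/-- For the difference of two experts the columns under `M` agree up to `4 ε + 4 ε`, and passing to
`A` costs `2 ε` at each of two columns; this makes `12 ε`. -/
lemma detD_mul_expertDiam_le (hN : 0 < N) {A : Matrix (Fin n) (Fin m) ℝ} {M : Fin n → Fin m → ℝ}
    (hA : ∀ i j, |A i j| ≤ 1) {ε c : ℝ} (hc : AdjBound k c) (hε : 0 ≤ ε)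
    (hM : ∀ i j, |M i j - A i j| ≤ ε) {I : Finset (Fin n)} {J : Finset (Fin m)} (hI : I.card = k)
    (hJ : J.card = k) (hD : detD (subMatrix A I J hI hJ) ≠ 0) :
    |detD (subMatrix A I J hI hJ)| * expertDiam (equalizingExperts ε N I J M) ≤
      k * (k * (12 * ε * c)) := by
  have hDp := abs_pos.2 hD
  have hc0 : 0 ≤ c := zero_le_one.trans hc.one_le
  rw [mul_comm, ← le_div_iff₀ hDp]
  refine expertDiam_le (by positivity) fun g hg g' hg' => ?_
  rw [le_div_iff₀ hDp, mul_comm]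
  obtain ⟨hg1, hg2, hg3⟩ := mem_equalizingExperts.1 hg
  obtain ⟨hg1', hg2', hg3'⟩ := mem_equalizingExperts.1 hg'
  have hp := gridPoint_mem hN hg1
  have hp' := gridPoint_mem hN hg1'
  refine sum_abs_sub_le_of_equalizing hA hI hJ hc (z := gridPoint g - gridPoint g')
    (by simp [Finset.sum_sub_distrib, hp.2, hp'.2])
    (fun i hi => by simp [gridPoint, hg2 i hi, hg2' i hi]) fun j hj j' hj' => ?_
  have hz : ∑ i, |(gridPoint g - gridPoint g') i| ≤ 2 := by
    calc ∑ i, |(gridPoint g - gridPoint g') i| ≤ ∑ i, (|gridPoint g i| + |gridPoint g' i|) :=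
          Finset.sum_le_sum fun i _ => abs_sub _ _
      _ = 2 := by
          rw [Finset.sum_add_distrib, sum_abs_of_mem_stdSimplex hp, sum_abs_of_mem_stdSimplex hp']
          norm_num
  have key : ∀ j, |((gridPoint g - gridPoint g') ᵥ* Matrix.of M) j -
      ((gridPoint g - gridPoint g') ᵥ* A) j| ≤ ε * 2 := fun j =>
    (abs_vecMul_sub_le (M := Matrix.of M) hM _ j).trans (by gcongr)
  have k1 := abs_le.1 (key j)
  have k2 := abs_le.1 (key j')
  have k3 := abs_le.1 (hg3 j hj j' hj')
  have k4 := abs_le.1 (hg3' j hj j' hj')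
  simp only [sub_vecMul, Pi.sub_apply] at k1 k2 ⊢
  exact abs_le.2 ⟨by linarith, by linarith⟩

/-- `A` itself lies in the `ε`-ball around `M`. So accurate data certify no pair of supports other
than the true one. -/
lemma Certified.supp_eq {ε : ℝ} {I : Finset (Fin n)} {J : Finset (Fin m)} {M : Fin n → Fin m → ℝ}
    (hcert : Certified ε I J M) (hε : 0 ≤ ε) {A : Matrix (Fin n) (Fin m) ℝ} {x : Fin n → ℝ}
    {y : Fin m → ℝ} (h : IsNash A x y) (hM : ∀ i j, |M i j - A i j| ≤ ε) :
    supp x = I ∧ supp y = J := by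
  by_contra hn
  have h1 : Metric.infEDist M {M' | ∃ x y, IsNash (Matrix.of M') x y ∧
      ¬(supp x = I ∧ supp y = J)} ≤ edist M (fun i j => A i j) :=
    Metric.infEDist_le_edist_of_mem ⟨x, y, h, hn⟩
  have h2 : edist M (fun i j => A i j) ≤ ENNReal.ofReal ε := by
    rw [edist_dist]
    exact ENNReal.ofReal_le_ofReal
      ((dist_pi_le_iff hε).2 fun i => (dist_pi_le_iff hε).2 fun j => hM i j)
  exact absurd (hcert.trans_le (h1.trans h2)) (lt_irrefl _)

/-- A game closer than `2 ε` to `M` is within `3 ε` of `A`, and stability applies with `54 = 18 *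
3`. The distance `2 ε` provides the strict inequality in `Certified`. -/
lemma IsUniqueNash.certified {A : Matrix (Fin n) (Fin m) ℝ} {x : Fin n → ℝ}
    {y : Fin m → ℝ} (h : IsUniqueNash A x y) (hA : ∀ i j, |A i j| ≤ 1) (hx : (supp x).card = k)
    (hy : (supp y).card = k) {c G ε : ℝ} (hc : AdjBound k c) (hG2 : G ≤ 2)
    (hG : (G : EReal) ≤ deltaG A x y) (hε : 0 < ε) {M : Fin n → Fin m → ℝ}
    (hM : ∀ i j, |M i j - A i j| ≤ ε)
    (hsmall : 54 * c * ε < G * deltaMin (subMatrix A (supp x) (supp y) hx hy)) :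
    Certified ε (supp x) (supp y) M := by
  have h1 : ENNReal.ofReal (2 * ε) ≤ Metric.infEDist M {M' | ∃ x' y', IsNash (Matrix.of M') x' y' ∧
      ¬(supp x' = supp x ∧ supp y' = supp y)} := by
    refine Metric.le_infEDist.2 fun M' ⟨x', y', hN, hne⟩ => ?_
    by_contra hlt
    rw [not_le, edist_dist, ENNReal.ofReal_lt_ofReal_iff (by positivity)] at hlt
    refine hne (h.supp_eq_of_near hA hx hy hc hG2 hG (δ := 3 * ε) (by positivity) (fun i j => ?_)
      (by linarith) hN)
    have h2 : |M i j - M' i j| < 2 * ε :=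
      ((dist_le_pi_dist (M i) (M' i) j).trans (dist_le_pi_dist M M' i)).trans_lt hlt
    have h3 := abs_lt.1 h2
    have h4 := abs_le.1 (hM i j)
    exact abs_le.2 ⟨by simp only [Matrix.of_apply]; linarith,
      by simp only [Matrix.of_apply]; linarith⟩
  exact lt_of_lt_of_le ((ENNReal.ofReal_lt_ofReal_iff (by positivity)).2 (by linarith)) h1

lemma supp_eq_univ_or_deltaG_le {A : Matrix (Fin n) (Fin m) ℝ} (hA : ∀ i j, |A i j| ≤ 1)
    {x : Fin n → ℝ} {y : Fin m → ℝ} (h : IsNash A x y) :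
    (supp x = Finset.univ ∧ supp y = Finset.univ) ∨ deltaG A x y ≤ ((2 : ℝ) : EReal) := by
  have hrow : ∀ i, |(A *ᵥ y) i| ≤ 1 := fun i => by
    simpa [sum_abs_of_mem_stdSimplex h.2.1] using abs_mulVec_le_sum hA y i
  have hcol : ∀ j, |(x ᵥ* A) j| ≤ 1 := fun j => by
    have := abs_mulVec_le_sum (A := Aᵀ) (fun j i => hA i j) x j
    rwa [sum_abs_of_mem_stdSimplex h.1, mulVec_transpose, mul_one] at this
  have hV : |payoff A x y| ≤ 1 := abs_sum_mul_le_of_mem_stdSimplex h.1 hrow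
  by_cases hx : supp x = Finset.univ
  · by_cases hy : supp y = Finset.univ
    · exact Or.inl ⟨hx, hy⟩
    · right
      obtain ⟨j, hj⟩ : ∃ j, j ∉ supp y := by
        by_contra hn
        push Not at hn
        exact hy (Finset.eq_univ_iff_forall.2 hn)
      refine (min_le_right _ _).trans ((iInf₂_le j hj).trans ?_)
      have h1 := abs_le.1 (hcol j)
      have h2 := abs_le.1 hV
      exact EReal.coe_le_coe_iff.2 (by linarith)
  · right
    obtain ⟨i, hi⟩ : ∃ i, i ∉ supp x := by
      by_contra hn
      push Not at hn
      exact hx (Finset.eq_univ_iff_forall.2 hn)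
    refine (min_le_left _ _).trans ((iInf₂_le i hi).trans ?_)
    have h1 := abs_le.1 (hrow i)
    have h2 := abs_le.1 hV
    exact EReal.coe_le_coe_iff.2 (by linarith)

/-- Nearly equalizing strategies of both players form an approximate equilibrium whatever the true
supports are. From the value to column `j` the losses are `5 ε` for the near-equalizer `q` evaluated
under `A`, `4 ε` for `g`, and `ε` for replacing `M` by `A`. -/
lemma le_vecMul_of_fullyMixedPlausible (hN : 0 < N) {A : Matrix (Fin n) (Fin m) ℝ} {x : Fin n → ℝ}
    {y : Fin m → ℝ} (h : IsNash A x y) {ε : ℝ} {M : Fin n → Fin m → ℝ}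
    (hM : ∀ i j, |M i j - A i j| ≤ ε) (hP : FullyMixedPlausible ε N M) {g : Fin n → Fin (N + 1)}
    (hg : g ∈ equalizingExperts ε N Finset.univ Finset.univ M) (j : Fin m) :
    payoff A x y - 10 * ε ≤ (gridPoint g ᵥ* A) j := by
  obtain ⟨-, -, q, hq⟩ := hP
  obtain ⟨hq1, -, hq3⟩ := mem_equalizingExperts.1 hq
  obtain ⟨hg1, -, hg3⟩ := mem_equalizingExperts.1 hg
  have hp := gridPoint_mem hN hg1
  have hqm := gridPoint_mem hN hq1
  have hT : Matrix.of (fun j i => M i j) = (Matrix.of M)ᵀ := rfl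
  rw [hT, vecMul_transpose] at hq3
  set v := payoff (Matrix.of M) (gridPoint g) (gridPoint q) with hv
  have h1 : v ≤ (gridPoint g ᵥ* Matrix.of M) j + 4 * ε := by
    rw [hv, payoff_eq_sum_right]
    simp_rw [mul_comm]
    refine sum_mul_le_of_mem_stdSimplex hqm fun j' => ?_
    linarith [(abs_le.1 (hg3 j (Finset.mem_univ _) j' (Finset.mem_univ _))).1]
  have h2 : payoff A x (gridPoint q) ≤ v + 5 * ε := by
    refine payoff_le_of_mulVec_le h.1 fun i => ?_
    have h3 : (Matrix.of M *ᵥ gridPoint q) i - 4 * ε ≤ v := by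
      rw [hv, payoff_eq_sum_left]
      refine le_sum_mul_of_mem_stdSimplex hp fun i' => ?_
      linarith [(abs_le.1 (hq3 i (Finset.mem_univ _) i' (Finset.mem_univ _))).2]
    have h4 := abs_vecMul_sub_le (A := Aᵀ) (M := (Matrix.of M)ᵀ) (fun j i => hM i j)
      (gridPoint q) i
    rw [sum_abs_of_mem_stdSimplex hqm, vecMul_transpose, vecMul_transpose, mul_one] at h4
    linarith [(abs_le.1 h4).1]
  have h5 := h.2.2.2 _ hqm
  have h6 := abs_vecMul_sub_le (M := Matrix.of M) hM (gridPoint g) j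
  rw [sum_abs_of_mem_stdSimplex hp, mul_one] at h6
  linarith [(abs_le.1 h6).2]

/-- What the experts look like when the empirical mean `M` is accurate: either they are a small set
around the equilibrium strategy, or the accuracy is still coarse in comparison with the gaps, and
then they are the pure strategies or are all nearly optimal. -/
lemma IsUniqueNash.experts_cases {A : Matrix (Fin n) (Fin m) ℝ} {x : Fin n → ℝ}
    {y : Fin m → ℝ} (h : IsUniqueNash A x y) (hA : ∀ i j, |A i j| ≤ 1) (hx : (supp x).card = k)
    (hy : (supp y).card = k) {c ε : ℝ} (hc : AdjBound k c) (hN : 0 < N) (hε0 : 0 < ε)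
    (hε : 2 * n / N ≤ ε) {M : Fin n → Fin m → ℝ} (hM : ∀ i j, |M i j - A i j| ≤ ε) :
    ((∃ u ∈ experts ε N M, ∑ i, |gridPoint u i - x i| ≤ 2 * n / N) ∧
      |detD (subMatrix A (supp x) (supp y) hx hy)| * expertDiam (experts ε N M) ≤
        k * (k * (12 * ε * c)) ∧ (experts ε N M).card ≤ (N + 1) ^ k) ∨
    ((∃ G : ℝ, 0 < G ∧ deltaG A x y = G ∧
        G * deltaMin (subMatrix A (supp x) (supp y) hx hy) ≤ 54 * c * ε) ∧
      (experts ε N M = pureExperts n N ∨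
        ∀ g ∈ experts ε N M, ∀ j, payoff A x y - 10 * ε ≤ (gridPoint g ᵥ* A) j)) := by
  have hgood : ∀ E, E = equalizingExperts ε N (supp x) (supp y) M →
      (∃ u ∈ E, ∑ i, |gridPoint u i - x i| ≤ 2 * n / N) ∧
      |detD (subMatrix A (supp x) (supp y) hx hy)| * expertDiam E ≤
        k * (k * (12 * ε * c)) ∧ E.card ≤ (N + 1) ^ k := by
    rintro E rfl
    exact ⟨exists_mem_equalizingExperts hN h.1 hA hM hε,
      detD_mul_expertDiam_le hN hA hc hε0.le hM hx hy (h.detD_ne_zero hx hy),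
      card_equalizingExperts_le ε hx _ _⟩
  obtain ⟨u, hu, -⟩ := exists_mem_equalizingExperts hN h.1 hA hM hε
  by_cases hcert : (certifiedExperts ε N M).Nonempty
  · left
    refine hgood _ ?_
    rw [experts, if_pos hcert]
    obtain ⟨g₀, hg₀⟩ := hcert
    obtain ⟨I₀, J₀, hIJ, -⟩ := mem_certifiedExperts.1 hg₀
    obtain ⟨rfl, rfl⟩ := hIJ.supp_eq hε0.le h.1 hM
    ext g
    rw [mem_certifiedExperts]
    constructor
    · rintro ⟨I, J, hc', hg⟩
      obtain ⟨rfl, rfl⟩ := hc'.supp_eq hε0.le h.1 hM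
      exact hg
    · exact fun hg => ⟨_, _, hIJ, hg⟩
  · have hnc : ¬ Certified ε (supp x) (supp y) M := fun hc' =>
      hcert ⟨u, mem_certifiedExperts.2 ⟨_, _, hc', hu⟩⟩
    -- Without a certificate: full supports pass the fully mixed test, with the roundings of `x` and
    -- `y` as witnesses; otherwise `deltaG` is a real number at most 2, and the missing certificate
    -- bounds it.
    rcases supp_eq_univ_or_deltaG_le hA h.1 with ⟨hxu, hyu⟩ | hG2
    · left
      have hnm : n = m := by
        rw [hxu, Finset.card_univ, Fintype.card_fin] at hx
        rw [hyu, Finset.card_univ, Fintype.card_fin] at hy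
        omega
      have hP : FullyMixedPlausible ε N M := by
        refine ⟨hnm, ⟨u, hxu ▸ hyu ▸ hu⟩, ?_⟩
        -- The column player is the row player of `-Aᵀ`; the sign does not affect equalization.
        obtain ⟨q, hq, -⟩ := exists_mem_equalizingExperts (N := N) hN h.1.swap
          (M := fun j i => -M i j) (fun j i => by simpa using hA i j) (ε := ε)
          (fun j i => by
            have := hM i j
            rw [abs_sub_comm] at this
            simpa [sub_eq_add_neg, add_comm] using this) (by rw [← hnm]; exact hε)
        obtain ⟨hq1, hq2, hq3⟩ := mem_equalizingExperts.1 hq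
        refine ⟨q, mem_equalizingExperts.2 ⟨hq1, by simp, fun i _ i' _ => ?_⟩⟩
        have h1 := hq3 i (by rw [hxu]; simp) i' (by rw [hxu]; simp)
        have e : Matrix.of (fun j i => -M i j) = -Matrix.of (fun j i => M i j) := rfl
        rw [e, vecMul_neg, Pi.neg_apply, Pi.neg_apply, abs_sub_comm] at h1
        simpa [sub_eq_add_neg, add_comm] using h1
      refine hgood _ ?_
      rw [experts, if_neg hcert, if_pos hP, hxu, hyu]
    · right
      have hG0 := h.deltaG_pos
      have hGe : deltaG A x y = ((deltaG A x y).toReal : EReal) :=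
        (EReal.coe_toReal (ne_top_of_le_ne_top (EReal.coe_ne_top 2) hG2)
          (ne_bot_of_gt hG0)).symm
      set G := (deltaG A x y).toReal with hGdef
      rw [hGe] at hG2 hG0
      refine ⟨⟨G, by exact_mod_cast hG0, hGe, ?_⟩, ?_⟩
      · by_contra hn
        exact hnc (h.certified hA hx hy hc (EReal.coe_le_coe_iff.1 hG2) hGe.ge hε0 hM
          (not_le.1 hn))
      · rw [experts, if_neg hcert]
        split_ifs with hP
        · exact Or.inr fun g hg j => le_vecMul_of_fullyMixedPlausible hN h.1 hM hP hg j
        · exact Or.inl rfl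

end MatrixGame

end

noncomputable section

namespace MatrixGame

variable {n m N : ℕ}

/-! ### The algorithm -/

/-- The accuracy of the empirical mean of `2 ^ q` payoff matrices. -/
def radius (n m T q : ℕ) : ℝ := Real.sqrt (4 * Real.log (n * m * T) / 2 ^ q)

/-- The mean of the first `2 ^ q` payoff matrices. -/
def empMean (q : ℕ) (M : ℕ → Fin n → Fin m → ℝ) : Fin n → Fin m → ℝ :=
  fun a b => (∑ s ∈ Finset.range (2 ^ q), M s a b) / 2 ^ q

/-- The payoff of the grid strategy `g` in round `s`. -/
def gain (M : ℕ → Fin n → Fin m → ℝ) (j : ℕ → Fin m) (s : ℕ) (g : Fin n → Fin (N + 1)) : ℝ :=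
  ∑ i, gridPoint g i * M s i (j s)

/-- The mixture of the experts in `E` with exponential weights for the cumulative gains `S`. -/
def expertMixture (E : Finset (Fin n → Fin (N + 1))) (L : ℕ) (S : (Fin n → Fin (N + 1)) → ℝ) :
    Fin n → ℝ :=
  fun i => ∑ g ∈ E, hedgeWeight (hedgeRate E L (expertDiam E)) E S g * gridPoint g i

/-- The experts of epoch `q`, which consists of the rounds `2 ^ q, …, 2 ^ (q + 1) - 1`. -/
def epochExperts (T q : ℕ) (M : ℕ → Fin n → Fin m → ℝ) : Finset (Fin n → Fin (n * T + 1)) :=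
  experts (radius n m T q) (n * T) (empMean q M)

/-- The strategy of the row player in round `t`, as a function of the whole sequence of payoff
matrices and columns. -/
def strat [NeZero n] (T t : ℕ) (M : ℕ → Fin n → Fin m → ℝ) (j : ℕ → Fin m) : Fin n → ℝ :=
  if t = 0 then Pi.single 0 1
  else expertMixture (epochExperts T (Nat.log 2 t) M) (2 ^ Nat.log 2 t)
    fun g => ∑ τ ∈ Finset.range (t - 2 ^ Nat.log 2 t), gain M j (2 ^ Nat.log 2 t + τ) g

/-- The strategy uses only data from before round `t`, so the default values inserted in
`epochHedge` are irrelevant. -/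
lemma strat_congr [NeZero n] (T t : ℕ) {M M' : ℕ → Fin n → Fin m → ℝ} {j j' : ℕ → Fin m}
    (hM : ∀ s < t, M s = M' s) (hj : ∀ s < t, j s = j' s) : strat T t M j = strat T t M' j' := by
  unfold strat
  split_ifs with h
  · rfl
  · have hle : 2 ^ Nat.log 2 t ≤ t := Nat.pow_log_le_self 2 h
    have h1 : empMean (Nat.log 2 t) M = empMean (Nat.log 2 t) M' := by
      ext a b
      unfold empMean
      congr 1
      refine Finset.sum_congr rfl fun s hs => ?_
      rw [hM s (by have := Finset.mem_range.1 hs; omega)]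
    have h2 : (fun g : Fin n → Fin (n * T + 1) => ∑ τ ∈ Finset.range (t - 2 ^ Nat.log 2 t),
        gain M j (2 ^ Nat.log 2 t + τ) g) =
        fun g => ∑ τ ∈ Finset.range (t - 2 ^ Nat.log 2 t), gain M' j' (2 ^ Nat.log 2 t + τ) g := by
      ext g
      refine Finset.sum_congr rfl fun τ hτ => ?_
      have : 2 ^ Nat.log 2 t + τ < t := by have := Finset.mem_range.1 hτ; omega
      unfold gain
      rw [hM _ this, hj _ this]
    rw [epochExperts, epochExperts, h1, h2]

lemma expertMixture_mem (hN : 0 < N) {E : Finset (Fin n → Fin (N + 1))} (hE : E.Nonempty)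
    (hg : ∀ g ∈ E, IsGridPoint g) (L : ℕ) (S : (Fin n → Fin (N + 1)) → ℝ) :
    expertMixture E L S ∈ stdSimplex ℝ (Fin n) := by
  have : expertMixture E L S =
      ∑ g ∈ E, hedgeWeight (hedgeRate E L (expertDiam E)) E S g • gridPoint g := by
    ext i; simp [expertMixture]
  rw [this]
  exact (convex_stdSimplex ℝ (Fin n)).sum_mem (fun g _ => hedgeWeight_nonneg _ _ _ _)
    (sum_hedgeWeight _ hE _) fun g h => gridPoint_mem hN (hg g h)

lemma strat_mem [NeZero n] {T : ℕ} (hT : 0 < T) (t : ℕ) (M : ℕ → Fin n → Fin m → ℝ)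
    (j : ℕ → Fin m) : strat T t M j ∈ stdSimplex ℝ (Fin n) := by
  unfold strat
  split_ifs with h
  · exact single_mem_stdSimplex ℝ 0
  · exact expertMixture_mem (Nat.mul_pos (Nat.pos_of_ne_zero (NeZero.ne n)) hT)
      (experts_nonempty _ _) (fun g hg => isGridPoint_of_mem_experts hg) _ _

/-! ### Measurability -/

lemma measurableSet_exists {α : Type*} {ι : Sort*} [MeasurableSpace α] [Countable ι]
    {p : ι → α → Prop} (h : ∀ i, MeasurableSet {a | p i a}) : MeasurableSet {a | ∃ i, p i a} := by
  have : {a | ∃ i, p i a} = ⋃ i, {a | p i a} := by ext; simp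
  rw [this]
  exact MeasurableSet.iUnion h

lemma measurableSet_forall {α : Type*} {ι : Sort*} [MeasurableSpace α] [Countable ι]
    {p : ι → α → Prop} (h : ∀ i, MeasurableSet {a | p i a}) : MeasurableSet {a | ∀ i, p i a} := by
  have : {a | ∀ i, p i a} = ⋂ i, {a | p i a} := by ext; simp
  rw [this]
  exact MeasurableSet.iInter h

lemma measurableSet_mem_equalizingExperts (ε : ℝ) (I : Finset (Fin n)) (J : Finset (Fin m))
    (g : Fin n → Fin (N + 1)) :
    MeasurableSet {M : Fin n → Fin m → ℝ | g ∈ equalizingExperts ε N I J M} := by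
  simp only [mem_equalizingExperts, Equalizes]
  refine (MeasurableSet.const _).inter ((MeasurableSet.const _).inter (measurableSet_forall fun j =>
    measurableSet_forall fun _ => measurableSet_forall fun j' => measurableSet_forall fun _ => ?_))
  refine measurableSet_le ?_ measurable_const
  simp only [vecMul, dotProduct, Matrix.of_apply]
  fun_prop

/-- The distance to an arbitrary set is measurable, so nothing has to be known about the set of
games with other supports. -/
lemma measurableSet_certified (ε : ℝ) (I : Finset (Fin n)) (J : Finset (Fin m)) :
    MeasurableSet {M : Fin n → Fin m → ℝ | Certified ε I J M} :=
  measurableSet_lt measurable_const measurable_infEDist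

lemma measurableSet_mem_certifiedExperts (ε : ℝ) (g : Fin n → Fin (N + 1)) :
    MeasurableSet {M : Fin n → Fin m → ℝ | g ∈ certifiedExperts ε N M} := by
  simp only [mem_certifiedExperts]
  exact measurableSet_exists fun I => measurableSet_exists fun J =>
    (measurableSet_certified ε I J).inter (measurableSet_mem_equalizingExperts ε I J g)

lemma measurableSet_fullyMixedPlausible (ε : ℝ) (N : ℕ) :
    MeasurableSet {M : Fin n → Fin m → ℝ | FullyMixedPlausible ε N M} := by
  have hT : Measurable fun (M : Fin n → Fin m → ℝ) (j : Fin m) (i : Fin n) => M i j := by fun_prop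
  exact (MeasurableSet.const _).inter ((measurableSet_exists fun g =>
    measurableSet_mem_equalizingExperts ε _ _ g).inter (measurableSet_exists fun g =>
      hT (measurableSet_mem_equalizingExperts ε _ _ g)))

lemma measurableSet_mem_experts (ε : ℝ) (g : Fin n → Fin (N + 1)) :
    MeasurableSet {M : Fin n → Fin m → ℝ | g ∈ experts ε N M} := by
  have h1 : MeasurableSet {M : Fin n → Fin m → ℝ | (certifiedExperts ε N M).Nonempty} :=
    measurableSet_exists fun g => measurableSet_mem_certifiedExperts ε g
  have h2 := measurableSet_fullyMixedPlausible (n := n) (m := m) ε N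
  have e : {M : Fin n → Fin m → ℝ | g ∈ experts ε N M} =
      Set.ite {M | (certifiedExperts ε N M).Nonempty} {M | g ∈ certifiedExperts ε N M}
        (Set.ite {M | FullyMixedPlausible ε N M}
          {M | g ∈ equalizingExperts ε N Finset.univ Finset.univ M} {_M | g ∈ pureExperts n N}) := by
    ext M
    simp only [Set.mem_ofPred_eq, experts, Set.ite, Set.mem_union, Set.mem_inter_iff,
      Set.mem_sdiff]
    split_ifs <;> simp [*]
  rw [e]
  exact h1.ite (measurableSet_mem_certifiedExperts ε g)
    (h2.ite (measurableSet_mem_equalizingExperts ε _ _ g) (MeasurableSet.const _))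

lemma measurableSet_experts_eq (ε : ℝ) (E : Finset (Fin n → Fin (N + 1))) :
    MeasurableSet {M : Fin n → Fin m → ℝ | experts ε N M = E} := by
  simp only [Finset.ext_iff]
  exact measurableSet_forall fun g => (measurableSet_mem_experts ε g).iff (MeasurableSet.const _)

lemma measurable_empMean (q : ℕ) :
    Measurable (empMean q : (ℕ → Fin n → Fin m → ℝ) → Fin n → Fin m → ℝ) := by
  unfold empMean
  fun_prop

lemma measurable_gain (s : ℕ) (g : Fin n → Fin (N + 1)) :
    Measurable fun p : (ℕ → Fin n → Fin m → ℝ) × (ℕ → Fin m) => gain p.1 p.2 s g := by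
  unfold gain
  refine Finset.measurable_fun_sum _ fun i _ => Measurable.const_mul ?_ _
  have h : Measurable fun q : (Fin m → ℝ) × Fin m => q.1 q.2 :=
    measurable_from_prod_countable_left fun b => measurable_pi_apply b
  exact h.comp (f := fun p : (ℕ → Fin n → Fin m → ℝ) × (ℕ → Fin m) => (p.1 s i, p.2 s))
    (by fun_prop)

lemma measurable_expertMixture (E : Finset (Fin n → Fin (N + 1))) (L : ℕ) :
    Measurable (expertMixture E L) := by
  unfold expertMixture hedgeWeight
  fun_prop

lemma measurable_strat [NeZero n] (T t : ℕ) :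
    Measurable fun p : (ℕ → Fin n → Fin m → ℝ) × (ℕ → Fin m) => strat T t p.1 p.2 := by
  unfold strat
  split_ifs with h
  · exact measurable_const
  -- The expert set takes finitely many values, each on a measurable set; for a fixed value the
  -- mixture is measurable in the gains. The discrete σ-algebra on the values joins the two facts.
  · let _ : MeasurableSpace (Finset (Fin n → Fin (n * T + 1))) := ⊤
    have hE : Measurable fun M : ℕ → Fin n → Fin m → ℝ => epochExperts T (Nat.log 2 t) M :=
      measurable_to_countable' fun E =>
        measurable_empMean (Nat.log 2 t) (measurableSet_experts_eq (radius n m T (Nat.log 2 t)) E)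
    have hF : Measurable fun r : Finset (Fin n → Fin (n * T + 1)) ×
        ((Fin n → Fin (n * T + 1)) → ℝ) => expertMixture r.1 (2 ^ Nat.log 2 t) r.2 :=
      measurable_from_prod_countable_right fun E => measurable_expertMixture E _
    refine hF.comp (f := fun p : (ℕ → Fin n → Fin m → ℝ) × (ℕ → Fin m) =>
      (epochExperts T (Nat.log 2 t) p.1, fun g => ∑ τ ∈ Finset.range (t - 2 ^ Nat.log 2 t),
        gain p.1 p.2 (2 ^ Nat.log 2 t + τ) g)) ((hE.comp measurable_fst).prodMk ?_)
    exact measurable_pi_lambda _ fun g => Finset.measurable_fun_sum _ fun τ _ => measurable_gain _ g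

/-- Extension of a finite sequence by a default value. -/
def extendSeq {α : Type*} (d : α) (t : ℕ) (f : Fin t → α) (s : ℕ) : α :=
  if hs : s < t then f ⟨s, hs⟩ else d

lemma measurable_extendSeq {α : Type*} [MeasurableSpace α] (d : α) (t : ℕ) :
    Measurable (extendSeq d t) := by
  refine measurable_pi_lambda _ fun s => ?_
  unfold extendSeq
  split_ifs
  · exact measurable_pi_apply _
  · exact measurable_const

lemma measurable_strat_extendSeq [NeZero n] [NeZero m] (T t : ℕ) :
    Measurable fun h : (Fin t → (Fin n → Fin m → ℝ)) × (Fin t → Fin m) =>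
      strat T t (extendSeq (0 : Fin n → Fin m → ℝ) t h.1) (extendSeq (0 : Fin m) t h.2) := by
  have h : Measurable fun h : (Fin t → (Fin n → Fin m → ℝ)) × (Fin t → Fin m) =>
      (extendSeq (0 : Fin n → Fin m → ℝ) t h.1, extendSeq (0 : Fin m) t h.2) :=
    ((measurable_extendSeq _ t).comp measurable_fst).prodMk
      ((measurable_extendSeq _ t).comp measurable_snd)
  have h2 := (measurable_strat (n := n) (m := m) T t).comp h
  simpa only [Function.comp_def] using h2

/-- Exponential weights over the experts, restarted with new experts in each epoch. -/
def epochHedge (n m T : ℕ) [NeZero n] [NeZero m] (hT : 0 < T) : RowAlgorithm n m where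
  play t h := strat T t (extendSeq (0 : Fin n → Fin m → ℝ) t h.1) (extendSeq (0 : Fin m) t h.2)
  play_mem _ _ := strat_mem hT _ _ _
  measurable_play t := measurable_strat_extendSeq T t

lemma strategy_epochHedge [NeZero n] [NeZero m] {T : ℕ} (hT : 0 < T) {Ω : Type*}
    (M : ℕ → Ω → (Fin n → Fin m → ℝ)) (j : ℕ → Ω → Fin m) (t : ℕ) (ω : Ω) :
    (epochHedge n m T hT).strategy M j t ω = strat T t (fun s => M s ω) (fun s => j s ω) :=
  strat_congr T t (fun s hs => by simp [extendSeq, hs]) (fun s hs => by simp [extendSeq, hs])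

/-! ### Regret in an epoch -/

lemma abs_gain_sub_le {M : ℕ → Fin n → Fin m → ℝ} {j : ℕ → Fin m} {s : ℕ}
    (h : ∀ i, |M s i (j s)| ≤ 1) {E : Finset (Fin n → Fin (N + 1))} {g g' : Fin n → Fin (N + 1)}
    (hg : g ∈ E) (hg' : g' ∈ E) : |gain M j s g - gain M j s g'| ≤ expertDiam E := by
  refine le_trans ?_ (le_expertDiam hg hg')
  simp only [gain, ← Finset.sum_sub_distrib, ← sub_mul]
  refine (Finset.abs_sum_le_sum_abs _ _).trans (Finset.sum_le_sum fun i _ => ?_)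
  rw [abs_mul]
  exact mul_le_of_le_one_right (abs_nonneg _) (h i)

lemma epoch_regret_le [NeZero n] {T q L : ℕ} (hL : L ≤ 2 ^ q) {M : ℕ → Fin n → Fin m → ℝ}
    {j : ℕ → Fin m} (hM : ∀ s < L, ∀ i, |M (2 ^ q + s) i (j (2 ^ q + s))| ≤ 1)
    {u : Fin n → Fin (n * T + 1)} (hu : u ∈ epochExperts T q M) :
    ∑ s ∈ Finset.range L, ∑ i, (gridPoint u i - strat T (2 ^ q + s) M j i) *
        M (2 ^ q + s) i (j (2 ^ q + s)) ≤
      2 * expertDiam (epochExperts T q M) *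
        Real.sqrt (2 ^ q * Real.log (epochExperts T q M).card) := by
  have h := hedge_regret_le_sqrt (a := fun s g => gain M j (2 ^ q + s) g) hL
    (expertDiam_nonneg (epochExperts T q M)) (fun s hs e he e' he' => abs_gain_sub_le (hM s hs) he he')
    hu two_le_card_of_expertDiam_pos
  push_cast at h
  refine le_trans (le_of_eq (Finset.sum_congr rfl fun s hs => ?_)) h
  have hs := Finset.mem_range.1 hs
  have hlog : Nat.log 2 (2 ^ q + s) = q :=
    Nat.log_eq_of_pow_le_of_lt_pow (by omega) (by rw [pow_succ]; omega)
  have hne : 2 ^ q + s ≠ 0 := by positivity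
  simp only [sub_mul, Finset.sum_sub_distrib]
  congr 1
  simp only [strat, if_neg hne, hlog, expertMixture, Nat.add_sub_cancel_left, Finset.sum_mul, gain,
    Finset.mul_sum]
  rw [Finset.sum_comm]
  refine Finset.sum_congr rfl fun g _ => Finset.sum_congr rfl fun i _ => by ring

end MatrixGame

end

noncomputable section

namespace MatrixGame

/-! ### Plays of the game -/

section Play

variable {n m T : ℕ} {alg : RowAlgorithm n m} {A : Matrix (Fin n) (Fin m) ℝ} {Ω : Type*}
  [mΩ : MeasurableSpace Ω] {P : Measure Ω} {ℱ : Filtration ℕ mΩ}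
  {M : ℕ → Ω → (Fin n → Fin m → ℝ)} {i : ℕ → Ω → Fin n} {j : ℕ → Ω → Fin m}
  {y : ℕ → Ω → (Fin m → ℝ)}

lemma IsPlay.measurable_matrix_of_lt (h : IsPlay alg A T P ℱ M i j y) {s t : ℕ} (hst : s < t)
    (ht : t ≤ T) : Measurable[ℱ t] (M s) :=
  (h.measurable_matrix s (by omega)).mono (ℱ.mono hst) le_rfl

lemma IsPlay.measurable_col_of_lt (h : IsPlay alg A T P ℱ M i j y) {s t : ℕ} (hst : s < t)
    (ht : t ≤ T) : Measurable[ℱ t] (j s) :=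
  (h.measurable_col s (by omega)).mono (ℱ.mono hst) le_rfl

lemma IsPlay.measurable_strategy (h : IsPlay alg A T P ℱ M i j y) {t : ℕ} (ht : t ≤ T) :
    Measurable[ℱ t] (alg.strategy M j t) := by
  refine (alg.measurable_play t).comp (Measurable.prodMk ?_ ?_)
  · exact @measurable_pi_lambda _ _ _ (ℱ t) _ _ fun s => h.measurable_matrix_of_lt s.2 ht
  · exact @measurable_pi_lambda _ _ _ (ℱ t) _ _ fun s => h.measurable_col_of_lt s.2 ht

lemma IsPlay.condExp_col [IsProbabilityMeasure P] (h : IsPlay alg A T P ℱ M i j y) {t : ℕ}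
    (ht : t < T) (b : Fin m) :
    P⟦{ω | j t ω = b} | ℱ t ⊔ MeasurableSpace.comap (M t) inferInstance⟧ =ᵐ[P]
      fun ω => y t ω b := by
  have hi : Measurable (i t) := (h.measurable_row t ht).mono (ℱ.le _) le_rfl
  have hj : Measurable (j t) := (h.measurable_col t ht).mono (ℱ.le _) le_rfl
  have e : ({ω | j t ω = b}.indicator fun _ => (1 : ℝ)) =
      ∑ a, ({ω | i t ω = a ∧ j t ω = b}.indicator fun _ => (1 : ℝ)) := by
    ext ω
    simp only [Finset.sum_apply, Set.indicator_apply, Set.mem_ofPred_eq]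
    by_cases hb : j t ω = b <;> simp [hb]
  rw [e]
  refine (condExp_finsetSum (fun a _ => ?_) _).trans ?_
  · refine (integrable_const (1 : ℝ)).indicator ?_
    exact (hi (measurableSet_singleton a)).inter (hj (measurableSet_singleton b))
  · have hall : ∀ᵐ ω ∂P, ∀ a,
        (P⟦{ω | i t ω = a ∧ j t ω = b} | ℱ t ⊔ MeasurableSpace.comap (M t) inferInstance⟧) ω =
          alg.strategy M j t ω a * y t ω b := ae_all_iff.2 fun a => h.sampling t ht a b
    filter_upwards [hall] with ω hω
    rw [Finset.sum_apply, Finset.sum_congr rfl fun a _ => hω a, ← Finset.sum_mul]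
    have hs : ∑ a, alg.strategy M j t ω a = 1 := (alg.play_mem t _).2
    rw [hs, one_mul]

/-- Given `ℱ t` and the matrix, the column has law `y t`, although the adversary is adaptive; then
the matrix, independent of `ℱ t`, averages to `A`. The factor `z` stands for a weight fixed before
round `t`. -/
lemma IsPlay.integral_mul_entry [IsProbabilityMeasure P] (h : IsPlay alg A T P ℱ M i j y)
    {t : ℕ} (ht : t < T)    {z : Ω → ℝ} (hz : Measurable[ℱ t] z) {K : ℝ} (hK : ∀ ω, |z ω| ≤ K) (a : Fin n) :
    Integrable (fun ω => z ω * M t ω a (j t ω)) P ∧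
    ∫ ω, z ω * M t ω a (j t ω) ∂P = ∫ ω, z ω * (A *ᵥ y t ω) a ∂P := by
  have hMm : Measurable (M t) := (h.measurable_matrix t ht).mono (ℱ.le _) le_rfl
  have hle : (ℱ t ⊔ MeasurableSpace.comap (M t) inferInstance) ≤ mΩ := sup_le (ℱ.le t) hMm.comap_le
  have hj : Measurable (j t) := (h.measurable_col t ht).mono (ℱ.le _) le_rfl
  have hz' : Measurable z := hz.mono (ℱ.le _) le_rfl
  have hy : Measurable (y t) := (h.measurable_adversary t ht).mono (ℱ.le _) le_rfl
  have hentry : ∀ b, Measurable fun ω => M t ω a b := fun b => by fun_prop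
  let g : Fin m → Ω → ℝ := fun b => {ω | j t ω = b}.indicator fun _ => 1
  have hgm : ∀ b, Measurable (g b) := fun b =>
    measurable_const.indicator (hj (measurableSet_singleton b))
  have hgi : ∀ b, Integrable (g b) P := fun b =>
    (integrable_const (1 : ℝ)).indicator (hj (measurableSet_singleton b))
  have hfb : ∀ b, ∀ᵐ ω ∂P, ‖z ω * M t ω a b‖ ≤ K := fun b => by
    filter_upwards [h.matrix_mem t ht] with ω hω
    rw [norm_mul, Real.norm_eq_abs, Real.norm_eq_abs]
    have h1 : |M t ω a b| ≤ 1 := abs_le.2 (hω a b)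
    exact (mul_le_of_le_one_right (abs_nonneg _) h1).trans (hK ω)
  have hfg : ∀ b, Integrable (fun ω => z ω * M t ω a b * g b ω) P := fun b =>
    (hgi b).bdd_mul (by fun_prop) (hfb b)
  have hyb : ∀ b ω, |y t ω b| ≤ 1 := fun b ω => by
    rw [abs_of_nonneg ((h.adversary_mem t ht ω).1 b)]
    exact (Finset.single_le_sum (fun b _ => (h.adversary_mem t ht ω).1 b)
      (Finset.mem_univ b)).trans_eq (h.adversary_mem t ht ω).2
  have hone : ∀ b, ∫ ω, z ω * M t ω a b * g b ω ∂P = ∫ ω, z ω * (A a b * y t ω b) ∂P := by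
    intro b
    have hsm : StronglyMeasurable[ℱ t ⊔ MeasurableSpace.comap (M t) inferInstance] fun ω => z ω * M t ω a b := by
      refine Measurable.stronglyMeasurable ?_
      refine Measurable.mul (hz.mono le_sup_left le_rfl) ?_
      have h1 : Measurable[MeasurableSpace.comap (M t) inferInstance] (M t) :=
        comap_measurable (M t)
      have h2 : Measurable[ℱ t ⊔ MeasurableSpace.comap (M t) inferInstance] (M t) := h1.mono le_sup_right le_rfl
      exact ((measurable_pi_apply b).comp (measurable_pi_apply a)).comp h2
    have h1 := condExp_stronglyMeasurable_mul_of_bound hle hsm (hgi b) K (hfb b)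
    have h2 : ∫ ω, z ω * M t ω a b * g b ω ∂P = ∫ ω, M t ω a b * (z ω * y t ω b) ∂P := by
      rw [← integral_condExp hle]
      refine integral_congr_ae ?_
      filter_upwards [h1, h.condExp_col ht b] with ω h1 h2
      have e : (fun ω => z ω * M t ω a b * g b ω) = (fun ω => z ω * M t ω a b) * g b := rfl
      rw [e, h1, Pi.mul_apply, h2]
      ring
    have hyt : Measurable[ℱ t] fun ω => y t ω b :=
      (measurable_pi_apply b).comp (h.measurable_adversary t ht)
    have hind : IndepFun (fun ω => M t ω a b) (fun ω => z ω * y t ω b) P := by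
      rw [IndepFun_iff_Indep]
      refine indep_of_indep_of_le_left (indep_of_indep_of_le_right (h.indep_matrix t ht) ?_) ?_
      · exact (Measurable.mul hz hyt).comap_le
      · have h1 : Measurable[MeasurableSpace.comap (M t) inferInstance] (M t) :=
          comap_measurable (M t)
        exact (((measurable_pi_apply b).comp (measurable_pi_apply a)).comp h1).comap_le
    rw [h2, hind.integral_fun_mul_eq_mul_integral (by fun_prop) (by fun_prop), h.mean_matrix t ht,
      ← integral_const_mul]
    refine integral_congr_ae (Filter.Eventually.of_forall fun ω => ?_)
    simp only
    ring
  have hsum : ∀ ω, z ω * M t ω a (j t ω) = ∑ b, z ω * M t ω a b * g b ω := by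
    intro ω
    simp [g, Set.indicator_apply]
  simp_rw [hsum]
  refine ⟨integrable_finsetSum _ fun b _ => hfg b, ?_⟩
  rw [integral_finsetSum _ fun b _ => hfg b, Finset.sum_congr rfl fun b _ => hone b,
    ← integral_finsetSum]
  · simp only [mulVec, dotProduct, Finset.mul_sum]
  · intro b _
    have : Integrable (fun ω => A a b * y t ω b) P :=
      Integrable.of_bound (by fun_prop) (|A a b| * 1) (Filter.Eventually.of_forall fun ω => by
        rw [norm_mul]
        exact mul_le_mul_of_nonneg_left (hyb b ω) (abs_nonneg _))
    exact this.bdd_mul (by fun_prop) (Filter.Eventually.of_forall hK)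

/-! ### Concentration of the empirical mean -/

/-- By Hoeffding's lemma a centered entry with range `[-1, 1]` has parameter 1. Parameters add up
because the new matrix is independent of `ℱ t`, which contains the earlier ones. -/
lemma IsPlay.hasSubgaussianMGF [IsProbabilityMeasure P] (h : IsPlay alg A T P ℱ M i j y)
    (a : Fin n) (b : Fin m) {t : ℕ}    (ht : t ≤ T) :
    HasSubgaussianMGF (fun ω => ∑ s ∈ Finset.range t, (M s ω a b - A a b)) t P := by
  induction t with
  | zero => simp
  | succ t ih =>
    have hMm : Measurable (M t) := (h.measurable_matrix t (by omega)).mono (ℱ.le _) le_rfl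
    have h1 := hasSubgaussianMGF_of_mem_Icc (μ := P) (X := fun ω => M t ω a b) (a := -1) (b := 1)
      (by fun_prop) (by filter_upwards [h.matrix_mem t (by omega)] with ω hω using hω a b)
    rw [h.mean_matrix t (by omega)] at h1
    have e : (‖(1 : ℝ) - -1‖₊ / 2) ^ 2 = 1 := by
      have : ‖(1 : ℝ) - -1‖₊ = 2 := by
        ext
        norm_num
      rw [this]; norm_num
    rw [e] at h1
    have hind : IndepFun (fun ω => ∑ s ∈ Finset.range t, (M s ω a b - A a b))
        (fun ω => M t ω a b - A a b) P := by
      refine IndepFun.symm ?_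
      rw [IndepFun_iff_Indep]
      refine indep_of_indep_of_le_left
        (indep_of_indep_of_le_right (h.indep_matrix t (by omega)) ?_) ?_
      · refine Measurable.comap_le ?_
        refine Finset.measurable_fun_sum _ fun s hs => Measurable.sub_const ?_ _
        exact ((measurable_pi_apply b).comp (measurable_pi_apply a)).comp
          (h.measurable_matrix_of_lt (Finset.mem_range.1 hs) (by omega))
      · have h1 : Measurable[MeasurableSpace.comap (M t) inferInstance] (M t) :=
          comap_measurable (M t)
        exact ((((measurable_pi_apply b).comp (measurable_pi_apply a)).comp h1).sub_const _).comap_le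
    have h2 := (ih (by omega)).add_of_indepFun h1 hind
    simp only [Finset.sum_range_succ]
    exact_mod_cast h2

/-- The event that the empirical mean after `2 ^ q` rounds is accurate. -/
def accurate (A : Matrix (Fin n) (Fin m) ℝ) (T q : ℕ) (M : ℕ → Ω → (Fin n → Fin m → ℝ)) : Set Ω :=
  {ω | ∀ a b, |empMean q (fun s => M s ω) a b - A a b| ≤ radius n m T q}

/-- The radius makes each tail at most `exp (-2 log (nmT)) = (nmT) ^ (-2)`; there are `2 n m` of
them. -/
lemma IsPlay.measureReal_compl_accurate_le [IsProbabilityMeasure P]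
    (h : IsPlay alg A T P ℱ M i j y) (hn : 0 < n) (hm : 0 < m) {q : ℕ} (hq : 2 ^ q ≤ T) : P.real (accurate A T q M)ᶜ ≤ 2 / T := by
  have hT : 0 < T := lt_of_lt_of_le (by positivity) hq
  set lam := Real.log (n * m * T) with hlam
  have hnmT : (1 : ℝ) ≤ n * m * T := by exact_mod_cast Nat.mul_pos (Nat.mul_pos hn hm) hT
  have hlam0 : 0 ≤ lam := Real.log_nonneg hnmT
  set ε := radius n m T q with hε
  have hε0 : 0 ≤ ε := Real.sqrt_nonneg _
  have hε2 : ε ^ 2 * 2 ^ q = 4 * lam := by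
    rw [hε, radius, ← hlam, Real.sq_sqrt (by positivity)]
    field_simp
  let S : Fin n → Fin m → Ω → ℝ := fun a b ω => ∑ s ∈ Finset.range (2 ^ q), (M s ω a b - A a b)
  have hS : ∀ a b ω, empMean q (fun s => M s ω) a b - A a b = S a b ω / 2 ^ q := by
    intro a b ω
    simp only [empMean, S, Finset.sum_sub_distrib]
    simp
    field_simp
  have htail : ∀ X : Ω → ℝ, HasSubgaussianMGF X ((2 ^ q : ℕ) : NNReal) P →
      P.real {ω | ε * 2 ^ q ≤ X ω} ≤ Real.exp (-(2 * lam)) := by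
    intro X hX
    refine (hX.measure_ge_le (by positivity)).trans (le_of_eq ?_)
    congr 1
    push_cast
    rw [mul_pow, neg_div]
    congr 1
    rw [div_eq_iff (by positivity)]
    calc ε ^ 2 * (2 ^ q) ^ 2 = (ε ^ 2 * 2 ^ q) * 2 ^ q := by ring
      _ = 2 * lam * (2 * 2 ^ q) := by rw [hε2]; ring
  have hsub : (accurate A T q M)ᶜ ⊆ ⋃ p : Fin n × Fin m,
      ({ω | ε * 2 ^ q ≤ S p.1 p.2 ω} ∪ {ω | ε * 2 ^ q ≤ -S p.1 p.2 ω}) := by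
    intro ω hω
    simp only [accurate, Set.mem_compl_iff, Set.mem_ofPred_eq, not_forall, not_le] at hω
    obtain ⟨a, b, hab⟩ := hω
    rw [← hε, hS, abs_div, abs_of_pos (by positivity : (0 : ℝ) < 2 ^ q),
      lt_div_iff₀ (by positivity)] at hab
    refine Set.mem_iUnion.2 ⟨(a, b), ?_⟩
    rcases lt_abs.1 hab with h | h
    · exact Or.inl h.le
    · exact Or.inr h.le
  have hexp : Real.exp (-(2 * lam)) = ((n * m * T : ℝ) ^ 2)⁻¹ := by
    rw [Real.exp_neg, two_mul, Real.exp_add, hlam, Real.exp_log (by linarith)]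
    ring
  calc P.real (accurate A T q M)ᶜ
      ≤ P.real (⋃ p : Fin n × Fin m,
        ({ω | ε * 2 ^ q ≤ S p.1 p.2 ω} ∪ {ω | ε * 2 ^ q ≤ -S p.1 p.2 ω})) :=
        measureReal_mono hsub
    _ ≤ ∑ p : Fin n × Fin m,
        P.real ({ω | ε * 2 ^ q ≤ S p.1 p.2 ω} ∪ {ω | ε * 2 ^ q ≤ -S p.1 p.2 ω}) :=
        measureReal_iUnion_fintype_le _
    _ ≤ ∑ _p : Fin n × Fin m, 2 * Real.exp (-(2 * lam)) := by
        refine Finset.sum_le_sum fun p _ => (measureReal_union_le _ _).trans ?_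
        have h1 := h.hasSubgaussianMGF p.1 p.2 hq
        rw [two_mul]
        exact add_le_add (htail _ h1) (htail _ h1.neg)
    _ ≤ 2 / T := by
        rw [hexp]
        simp only [Finset.sum_const, Finset.card_univ, Fintype.card_prod, Fintype.card_fin,
          nsmul_eq_mul]
        push_cast
        have hTR : (0 : ℝ) < T := by exact_mod_cast hT
        have hnm : (1 : ℝ) ≤ n * m := by exact_mod_cast Nat.mul_pos hn hm
        have hT1 : (1 : ℝ) ≤ T := by exact_mod_cast hT
        rw [← mul_assoc, ← div_eq_mul_inv, div_le_div_iff₀ (by positivity) hTR]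
        nlinarith [mul_nonneg (sub_nonneg.2 hnm) (sub_nonneg.2 hT1), mul_pos hTR hTR]

end Play

end MatrixGame

end

noncomputable section

namespace MatrixGame

variable {n m k T q : ℕ}

/-! ### Regret in an epoch on the event that the empirical mean is accurate -/

/-- The accuracy `ε` is too coarse for certifying the supports. -/
def IsCoarse (A : Matrix (Fin n) (Fin m) ℝ) (x : Fin n → ℝ) (y : Fin m → ℝ) (Δ c ε : ℝ) : Prop :=
  ∃ G : ℝ, 0 < G ∧ deltaG A x y = G ∧ G * Δ ≤ 54 * c * ε

/-- All grid strategies in `E` guarantee at least `v`. -/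
def Guarantees (A : Matrix (Fin n) (Fin m) ℝ) (v : ℝ) {N : ℕ} (E : Finset (Fin n → Fin (N + 1))) :
    Prop :=
  ∀ g ∈ E, ∀ b, v ≤ (gridPoint g ᵥ* A) b

lemma one_half_le_log (hnm : 2 ≤ n * m * T) : (1 / 2 : ℝ) ≤ Real.log (n * m * T) := by
  have h1 : (2 : ℝ) ≤ n * m * T := by exact_mod_cast hnm
  have h2 := Real.log_le_log (by norm_num) h1
  have h3 := Real.log_two_gt_d9
  linarith

lemma radius_sq_mul (h : 0 ≤ Real.log (n * m * T)) :
    radius n m T q ^ 2 * 2 ^ q = 4 * Real.log (n * m * T) := by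
  rw [radius, Real.sq_sqrt (by positivity)]
  field_simp

lemma radius_mul_sqrt {a b : ℝ} (h : 0 ≤ Real.log (n * m * T)) (ha : 0 ≤ a) (hb : 0 ≤ b)
    (hab : 4 * Real.log (n * m * T) * a ≤ b ^ 2) :
    radius n m T q * Real.sqrt (2 ^ q * a) ≤ b := by
  refine abs_le_of_sq_le_sq' ?_ hb |>.2
  rw [mul_pow, Real.sq_sqrt (by positivity), ← mul_assoc, radius_sq_mul h]
  exact hab

lemma radius_mul_two_pow (h : 0 ≤ Real.log (n * m * T)) :
    radius n m T q * 2 ^ q = 2 * Real.sqrt (2 ^ q * Real.log (n * m * T)) := by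
  have h1 : 0 ≤ radius n m T q := Real.sqrt_nonneg _
  refine (pow_left_inj₀ (by positivity) (by positivity) two_ne_zero).1 ?_
  rw [mul_pow, mul_pow, Real.sq_sqrt (by positivity)]
  linear_combination 2 ^ q * radius_sq_mul (n := n) (m := m) (T := T) (q := q) h

/-- With grid size `n * T` the rounding error is `2 / T`, so it never exceeds the statistical
accuracy. -/
lemma two_div_le_radius (hn : 0 < n) (hm : 0 < m) (hq : 2 ^ q < T) : 2 / T ≤ radius n m T q := by
  have hT2 : 2 ≤ T := by
    have := Nat.one_le_two_pow (n := q)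
    omega
  have hlam := one_half_le_log (n := n) (m := m) (T := T)
    (hT2.trans (Nat.le_mul_of_pos_left T (Nat.mul_pos hn hm)))
  set lam := Real.log (n * m * T) with hlamdef
  have hTR : (2 : ℝ) ≤ T := by exact_mod_cast hT2
  have hqR : (2 : ℝ) ^ q ≤ T := by exact_mod_cast hq.le
  refine Real.le_sqrt_of_sq_le ?_
  rw [← hlamdef, div_pow, div_le_div_iff₀ (by positivity) (by positivity)]
  have h1 : 1 ≤ lam * T := by nlinarith
  calc (2 : ℝ) ^ 2 * 2 ^ q ≤ 2 ^ 2 * T := by gcongr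
    _ ≤ 2 ^ 2 * (T * (lam * T)) := by
        have : (T : ℝ) * 1 ≤ T * (lam * T) := by gcongr
        linarith
    _ = 4 * lam * T ^ 2 := by ring

lemma log_card_le {E : ℕ} (hE : E ≤ (n * T + 1) ^ k) (hm : 0 < m)
    (hnm : 2 ≤ n * m * T) : Real.log E ≤ k * (2 * Real.log (n * m * T)) := by
  rcases E.eq_zero_or_pos with rfl | hE0
  · have := one_half_le_log hnm
    simp only [Nat.cast_zero, Real.log_zero]
    positivity
  · have h1 : n * T + 1 ≤ (n * m * T) ^ 2 := by
      have : n * T ≤ n * m * T := by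
        rw [mul_assoc, mul_comm m, ← mul_assoc]
        exact Nat.le_mul_of_pos_right _ hm
      nlinarith
    have h2 : E ≤ ((n * m * T) ^ 2) ^ k := hE.trans (Nat.pow_le_pow_left h1 k)
    have h3 : (E : ℝ) ≤ (((n : ℝ) * m * T) ^ 2) ^ k := by exact_mod_cast h2
    have h4 := Real.log_le_log (by exact_mod_cast hE0) h3
    rwa [Real.log_pow, Real.log_pow, Nat.cast_ofNat] at h4

lemma expertDiam_le_two {N : ℕ} (hN : 0 < N) {E : Finset (Fin n → Fin (N + 1))}
    (hE : ∀ g ∈ E, IsGridPoint g) : expertDiam E ≤ 2 := by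
  refine expertDiam_le (by norm_num) fun g hg g' hg' => ?_
  calc ∑ i, |gridPoint g i - gridPoint g' i| ≤ ∑ i, (|gridPoint g i| + |gridPoint g' i|) :=
        Finset.sum_le_sum fun i _ => abs_sub _ _
    _ = 2 := by
        rw [Finset.sum_add_distrib, sum_abs_of_mem_stdSimplex (gridPoint_mem hN (hE g hg)),
          sum_abs_of_mem_stdSimplex (gridPoint_mem hN (hE g' hg'))]
        norm_num

/-- The pathwise bound; `κ` switches on the cost of coarse epochs. Coarse epochs whose experts all
guarantee nearly the value are excluded by `hguar`: that guarantee concerns `A`, not realized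
payoffs, and is used in expectation later. -/
lemma IsUniqueNash.epoch_regret_le [NeZero n] [NeZero m] {A : Matrix (Fin n) (Fin m) ℝ}
    {x : Fin n → ℝ} {y : Fin m → ℝ} (h : IsUniqueNash A x y) (hA : ∀ i j, |A i j| ≤ 1)
    (hx : (supp x).card = k) (hy : (supp y).card = k) {c κ : ℝ} (hc : AdjBound k c) {L : ℕ}
    (hL : L ≤ 2 ^ q) (hq : 2 ^ q < T) (hκ0 : 0 ≤ κ)
    (hκ : IsCoarse A x y (deltaMin (subMatrix A (supp x) (supp y) hx hy)) c (radius n m T q) →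
      1 ≤ κ)
    {M : ℕ → Fin n → Fin m → ℝ} {j : ℕ → Fin m}
    (hM : ∀ s < L, ∀ i, |M (2 ^ q + s) i (j (2 ^ q + s))| ≤ 1)
    (hacc : ∀ a b, |empMean q M a b - A a b| ≤ radius n m T q)
    (hguar : IsCoarse A x y (deltaMin (subMatrix A (supp x) (supp y) hx hy)) c (radius n m T q) →
      ¬ Guarantees A (payoff A x y - 10 * radius n m T q) (epochExperts T q M)) :
    ∑ s ∈ Finset.range L, ∑ i, (x i - strat T (2 ^ q + s) M j i) *
        M (2 ^ q + s) i (j (2 ^ q + s)) ≤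
      2 + 72 * k ^ 3 * c * Real.log (n * m * T) /
          |detD (subMatrix A (supp x) (supp y) hx hy)| +
        κ * (4 * Real.sqrt (2 ^ q * Real.log (n * m * T))) := by
  have hn : 0 < n := Nat.pos_of_ne_zero (NeZero.ne n)
  have hm : 0 < m := Nat.pos_of_ne_zero (NeZero.ne m)
  have hT2 : 2 ≤ T := by
    have := Nat.one_le_two_pow (n := q)
    omega
  have hT : 0 < T := by omega
  have hnmT : 2 ≤ n * m * T := hT2.trans (Nat.le_mul_of_pos_left T (Nat.mul_pos hn hm))
  have hlam := one_half_le_log hnmT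
  have hN : 0 < n * T := Nat.mul_pos hn hT
  have hrad := two_div_le_radius hn hm hq
  have hTR : (0 : ℝ) < T := by exact_mod_cast hT
  have hnR : (0 : ℝ) < n := by exact_mod_cast hn
  have hkR : (1 : ℝ) ≤ k := by exact_mod_cast h.1.card_supp_pos hx
  have hNT : 2 * (n : ℝ) / (n * T : ℕ) = 2 / T := by push_cast; field_simp
  have hD : 0 < |detD (subMatrix A (supp x) (supp y) hx hy)| := abs_pos.2 (h.detD_ne_zero hx hy)
  set D := |detD (subMatrix A (supp x) (supp y) hx hy)| with hDdef
  set lam := Real.log (n * m * T) with hlamdef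
  set ε := radius n m T q with hε
  have hε0 : 0 < ε := lt_of_lt_of_le (by positivity) hrad
  have hc0 : 0 ≤ c := zero_le_one.trans hc.one_le
  set E := epochExperts T q M with hE
  have hfirst : 0 ≤ 72 * k ^ 3 * c * lam / D := by positivity
  have hsecond : 0 ≤ κ * (4 * Real.sqrt (2 ^ q * lam)) := by positivity
  rcases h.experts_cases hA hx hy hc hN hε0 (hNT.trans_le hrad) hacc with
    ⟨⟨u, hu, hux⟩, hdiam, hcard⟩ | ⟨hcoarse, hpure | hg⟩
  · have hlogE : Real.log E.card ≤ k * (2 * lam) := log_card_le hcard hm hnmT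
    have h1 := MatrixGame.epoch_regret_le hL hM hu
    have h2 : ∑ s ∈ Finset.range L, ∑ i, (x i - gridPoint u i) *
        M (2 ^ q + s) i (j (2 ^ q + s)) ≤ 2 := by
      calc ∑ s ∈ Finset.range L, ∑ i, (x i - gridPoint u i) * M (2 ^ q + s) i (j (2 ^ q + s))
          ≤ ∑ _s ∈ Finset.range L, 2 / (T : ℝ) := by
            refine Finset.sum_le_sum fun s hs => (Finset.sum_le_sum fun i _ => ?_).trans
              (hux.trans_eq hNT)
            refine (le_abs_self _).trans ?_
            rw [abs_mul, abs_sub_comm]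
            exact mul_le_of_le_one_right (abs_nonneg _) (hM s (Finset.mem_range.1 hs) i)
        _ = L * (2 / T) := by simp
        _ ≤ T * (2 / T) := by
            gcongr
            omega
        _ = 2 := by field_simp
    have h3 : 2 * expertDiam E * Real.sqrt (2 ^ q * Real.log E.card) ≤
        72 * k ^ 3 * c * lam / D := by
      have e1 : expertDiam E ≤ k * (k * (12 * ε * c)) / D := by
        rw [le_div_iff₀ hD, mul_comm]; exact hdiam
      -- The left side is `sqrt (8 k) * lam`. Together with the factor 2 and the `12` of the
      -- diameter this gives `72 = 2 * 12 * 3`.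
      have e2 : ε * Real.sqrt (2 ^ q * (k * (2 * lam))) ≤ 3 * k * lam :=
        radius_mul_sqrt (by positivity) (by positivity) (by positivity)
          (by nlinarith [mul_nonneg (sub_nonneg.2 hkR) (sq_nonneg lam),
            mul_nonneg (mul_nonneg (sub_nonneg.2 hkR) (zero_le_one.trans hkR)) (sq_nonneg lam)])
      calc 2 * expertDiam E * Real.sqrt (2 ^ q * Real.log E.card)
          ≤ 2 * (k * (k * (12 * ε * c)) / D) * Real.sqrt (2 ^ q * (k * (2 * lam))) := by gcongr
        _ = 24 * k ^ 2 * c / D * (ε * Real.sqrt (2 ^ q * (k * (2 * lam)))) := by ring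
        _ ≤ 24 * k ^ 2 * c / D * (3 * k * lam) := by gcongr
        _ = 72 * k ^ 3 * c * lam / D := by ring
    have h4 : ∑ s ∈ Finset.range L, ∑ i, (x i - strat T (2 ^ q + s) M j i) *
        M (2 ^ q + s) i (j (2 ^ q + s)) =
        ∑ s ∈ Finset.range L, ∑ i, (x i - gridPoint u i) * M (2 ^ q + s) i (j (2 ^ q + s)) +
        ∑ s ∈ Finset.range L, ∑ i, (gridPoint u i - strat T (2 ^ q + s) M j i) *
          M (2 ^ q + s) i (j (2 ^ q + s)) := by
      simp only [← Finset.sum_add_distrib]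
      exact Finset.sum_congr rfl fun s _ => Finset.sum_congr rfl fun i _ => by ring
    rw [h4]
    linarith
  · have hpure : E = pureExperts n (n * T) := hpure
    have hvalid : ∀ g ∈ E, IsGridPoint g := fun g hg => isGridPoint_of_mem_experts hg
    set C := ∑ s ∈ Finset.range L, ∑ i, strat T (2 ^ q + s) M j i *
      M (2 ^ q + s) i (j (2 ^ q + s)) with hC
    let G : Fin n → ℝ := fun i => ∑ s ∈ Finset.range L, M (2 ^ q + s) i (j (2 ^ q + s))
    have hF : ∀ v : Fin n → ℝ, ∑ s ∈ Finset.range L, ∑ i, (v i - strat T (2 ^ q + s) M j i) *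
        M (2 ^ q + s) i (j (2 ^ q + s)) = ∑ i, v i * G i - C := by
      intro v
      simp only [sub_mul, Finset.sum_sub_distrib, hC, G, Finset.mul_sum]
      rw [Finset.sum_comm]
    -- Regret is bounded against each pure strategy and then averaged with the weights `x`.
    have hbound : ∀ a, G a - C ≤ 4 * Real.sqrt (2 ^ q * lam) := by
      intro a
      have hmem : (Pi.single a (Fin.last (n * T)) : Fin n → Fin (n * T + 1)) ∈ E := by
        rw [hpure]; exact mem_pureExperts.2 ⟨a, rfl⟩
      have h1 := MatrixGame.epoch_regret_le hL hM hmem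
      rw [gridPoint_single hN, hF] at h1
      simp only [Pi.single_apply, ite_mul, one_mul, zero_mul, Finset.sum_ite_eq',
        Finset.mem_univ, if_true] at h1
      refine h1.trans ?_
      have e1 : expertDiam E ≤ 2 := expertDiam_le_two hN hvalid
      have e2 : Real.log E.card ≤ lam := by
        rw [hpure, hlamdef]
        have hp : 0 < (pureExperts n (n * T)).card := Finset.card_pos.2 ⟨_, hpure ▸ hmem⟩
        refine Real.log_le_log (by exact_mod_cast hp) ?_
        have : n ≤ n * m * T := by
          rw [mul_assoc]; exact Nat.le_mul_of_pos_right _ (Nat.mul_pos hm hT)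
        exact_mod_cast card_pureExperts_le.trans this
      calc 2 * expertDiam E * Real.sqrt (2 ^ q * Real.log E.card)
          ≤ 2 * 2 * Real.sqrt (2 ^ q * lam) := by gcongr
        _ = 4 * Real.sqrt (2 ^ q * lam) := by ring
    have h2 := sum_mul_le_of_mem_stdSimplex h.1.1 hbound
    simp only [mul_sub, Finset.sum_sub_distrib, ← Finset.sum_mul, h.1.1.2, one_mul] at h2
    rw [hF]
    have h3 : 4 * Real.sqrt (2 ^ q * lam) ≤ κ * (4 * Real.sqrt (2 ^ q * lam)) :=
      le_mul_of_one_le_left (by positivity) (hκ hcoarse)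
    linarith
  · exact absurd hg (hguar hcoarse)

end MatrixGame

end

noncomputable section

namespace MatrixGame

/-! ### Expected regret of one epoch -/

variable {n m k T q : ℕ}

lemma Guarantees.le_vecMul_expertMixture {A : Matrix (Fin n) (Fin m) ℝ} {v : ℝ} {N : ℕ}
    {E : Finset (Fin n → Fin (N + 1))} (h : Guarantees A v E) (hE : E.Nonempty) (L : ℕ)
    (S : (Fin n → Fin (N + 1)) → ℝ) (b : Fin m) : v ≤ (expertMixture E L S ᵥ* A) b := by
  set w := hedgeWeight (hedgeRate E L (expertDiam E)) E S with hw
  have e : (expertMixture E L S ᵥ* A) b = ∑ g ∈ E, w g * (gridPoint g ᵥ* A) b := by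
    simp only [vecMul, dotProduct, expertMixture, Finset.sum_mul, Finset.mul_sum]
    rw [Finset.sum_comm]
    exact Finset.sum_congr rfl fun g _ => Finset.sum_congr rfl fun i _ => by rw [mul_assoc]
  rw [e]
  calc v = ∑ g ∈ E, w g * v := by rw [← Finset.sum_mul, sum_hedgeWeight _ hE, one_mul]
    _ ≤ _ := Finset.sum_le_sum fun g hg =>
        mul_le_mul_of_nonneg_left (h g hg b) (hedgeWeight_nonneg _ _ _ _)

lemma Guarantees.le_vecMul_strat [NeZero n] {A : Matrix (Fin n) (Fin m) ℝ} {v : ℝ}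
    {M : ℕ → Fin n → Fin m → ℝ} (h : Guarantees A v (epochExperts T q M)) {s : ℕ} (hs : s < 2 ^ q)
    (j : ℕ → Fin m) (b : Fin m) : v ≤ (strat T (2 ^ q + s) M j ᵥ* A) b := by
  have hlog : Nat.log 2 (2 ^ q + s) = q :=
    Nat.log_eq_of_pow_le_of_lt_pow (by omega) (by rw [pow_succ]; omega)
  have hne : 2 ^ q + s ≠ 0 := by positivity
  simp only [strat, if_neg hne, hlog]
  exact h.le_vecMul_expertMixture (experts_nonempty _ _) _ _ b

lemma abs_payoff_le {A : Matrix (Fin n) (Fin m) ℝ} (hA : ∀ i j, |A i j| ≤ 1) {x : Fin n → ℝ}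
    {y : Fin m → ℝ} (hx : x ∈ stdSimplex ℝ (Fin n)) (hy : y ∈ stdSimplex ℝ (Fin m)) :
    |payoff A x y| ≤ 1 :=
  abs_sum_mul_le_of_mem_stdSimplex hx fun i => by
    simpa [sum_abs_of_mem_stdSimplex hy] using abs_mulVec_le_sum hA y i

section Play

variable {A : Matrix (Fin n) (Fin m) ℝ} {Ω : Type*}
  [mΩ : MeasurableSpace Ω] {P : Measure Ω} {ℱ : Filtration ℕ mΩ}
  {M : ℕ → Ω → (Fin n → Fin m → ℝ)} {i : ℕ → Ω → Fin n} {j : ℕ → Ω → Fin m}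
  {y : ℕ → Ω → (Fin m → ℝ)}

lemma IsPlay.integrable_payoff [IsProbabilityMeasure P] {alg : RowAlgorithm n m}
    (h : IsPlay alg A T P ℱ M i j y) (hA : ∀ i j, |A i j| ≤ 1) {t : ℕ} (ht : t < T) :
    Integrable (fun ω => payoff A (alg.strategy M j t ω) (y t ω)) P := by
  have h1 : Measurable (alg.strategy M j t) := (h.measurable_strategy ht.le).mono (ℱ.le _) le_rfl
  have h2 : Measurable (y t) := (h.measurable_adversary t ht).mono (ℱ.le _) le_rfl
  refine Integrable.of_bound (C := 1) ?_ (Filter.Eventually.of_forall fun ω =>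
    abs_payoff_le hA (alg.play_mem t _) (h.adversary_mem t ht ω))
  refine Measurable.aestronglyMeasurable ?_
  simp only [payoff, dotProduct, mulVec]
  fun_prop

lemma IsPlay.measurable_empMean {alg : RowAlgorithm n m} (h : IsPlay alg A T P ℱ M i j y)
    (hq : 2 ^ q ≤ T) : Measurable[ℱ (2 ^ q)] fun ω => empMean q fun s => M s ω := by
  refine @measurable_pi_lambda _ _ _ (ℱ (2 ^ q)) _ _ fun a =>
    @measurable_pi_lambda _ _ _ (ℱ (2 ^ q)) _ _ fun b => ?_
  unfold empMean
  refine Measurable.div_const (Finset.measurable_fun_sum _ fun s hs => ?_) _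
  exact ((measurable_pi_apply b).comp (measurable_pi_apply a)).comp
    (h.measurable_matrix_of_lt (Finset.mem_range.1 hs) hq)

/-- The event that the empirical mean of epoch `q` is accurate and that, if `p` holds, the experts of the
epoch do not all guarantee `v`. -/
def regularEvent (A : Matrix (Fin n) (Fin m) ℝ) (T q : ℕ) (p : Prop) (v : ℝ)
    (M : ℕ → Ω → (Fin n → Fin m → ℝ)) : Set Ω :=
  accurate A T q M ∩ {ω | p → ¬ Guarantees A v (epochExperts T q fun s => M s ω)}

lemma measurableSet_empMean_accurate (A : Matrix (Fin n) (Fin m) ℝ) (ε : ℝ) :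
    MeasurableSet {X : Fin n → Fin m → ℝ | ∀ a b, |X a b - A a b| ≤ ε} :=
  measurableSet_forall fun a => measurableSet_forall fun b =>
    measurableSet_le (f := fun X : Fin n → Fin m → ℝ => |X a b - A a b|)
      (by
        have : Measurable fun X : Fin n → Fin m → ℝ => X a b - A a b := by fun_prop
        exact this.abs) measurable_const

lemma IsPlay.measurableSet_accurate {alg : RowAlgorithm n m} (h : IsPlay alg A T P ℱ M i j y)
    (hq : 2 ^ q ≤ T) : MeasurableSet[ℱ (2 ^ q)] (accurate A T q M) :=
  (h.measurable_empMean hq) (measurableSet_empMean_accurate A _)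

lemma IsPlay.measurableSet_regularEvent {alg : RowAlgorithm n m}
    (h : IsPlay alg A T P ℱ M i j y) (hq : 2 ^ q ≤ T) (p : Prop) (v : ℝ) :
    MeasurableSet[ℱ (2 ^ q)] (regularEvent A T q p v M) := by
  refine MeasurableSet.inter (h.measurableSet_accurate hq) ?_
  have h1 : MeasurableSet {X : Fin n → Fin m → ℝ |
      p → ¬ Guarantees A v (experts (radius n m T q) (n * T) X)} := by
    have e : {X : Fin n → Fin m → ℝ |
        p → ¬ Guarantees A v (experts (radius n m T q) (n * T) X)} =
        {X | ∃ E, experts (radius n m T q) (n * T) X = E ∧ (p → ¬ Guarantees A v E)} := by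
      ext X; simp
    rw [e]
    exact measurableSet_exists fun E => (measurableSet_experts_eq _ E).inter (MeasurableSet.const _)
  exact (h.measurable_empMean hq) h1

/-- The event `H` is known when the epoch starts, so cutting off with its indicator keeps the
weights predictable, and on `H` the pathwise bound can be integrated. Off `H` either the mean is
inaccurate, costing at most 2 per round with probability at most `2 / T`, or the epoch is coarse and
each round costs at most `10 ε`. Hence `6 = 2 + 4` and `24 = 4 + 20`. -/
lemma IsUniqueNash.epoch_expected_regret_le [IsProbabilityMeasure P] [NeZero n] [NeZero m]
    {x : Fin n → ℝ} {yn : Fin m → ℝ} (h : IsUniqueNash A x yn) (hA : ∀ i j, |A i j| ≤ 1)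
    (hx : (supp x).card = k) (hy : (supp yn).card = k) {c κ : ℝ} (hc : AdjBound k c) {hT : 0 < T}
    (hplay : IsPlay (epochHedge n m T hT) A T P ℱ M i j y) {L : ℕ}
    (hL : L ≤ 2 ^ q) (hLT : 2 ^ q + L ≤ T) (hq : 2 ^ q < T) (hκ0 : 0 ≤ κ)
    (hκ : IsCoarse A x yn (deltaMin (subMatrix A (supp x) (supp yn) hx hy)) c (radius n m T q) →
      1 ≤ κ) :
    ∑ s ∈ Finset.range L, ∫ ω, (payoff A x yn -
        payoff A ((epochHedge n m T hT).strategy M j (2 ^ q + s) ω) (y (2 ^ q + s) ω)) ∂P ≤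
      6 + 72 * k ^ 3 * c * Real.log (n * m * T) /
          |detD (subMatrix A (supp x) (supp yn) hx hy)| +
        κ * (24 * Real.sqrt (2 ^ q * Real.log (n * m * T))) := by
  have hn : 0 < n := Nat.pos_of_ne_zero (NeZero.ne n)
  have hm : 0 < m := Nat.pos_of_ne_zero (NeZero.ne m)
  have hTR : (0 : ℝ) < T := by exact_mod_cast hT
  have hlam0 : 0 ≤ Real.log (n * m * T) := Real.log_nonneg (by
    exact_mod_cast Nat.mul_pos (Nat.mul_pos hn hm) hT)
  set alg := epochHedge n m T hT with halg
  set V := payoff A x yn with hV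
  set p := IsCoarse A x yn (deltaMin (subMatrix A (supp x) (supp yn) hx hy)) c (radius n m T q)
    with hp
  set ε := radius n m T q with hε
  have hε0 : 0 ≤ ε := Real.sqrt_nonneg _
  set H := regularEvent A T q p (V - 10 * ε) M with hH
  have hHm : MeasurableSet[ℱ (2 ^ q)] H := hplay.measurableSet_regularEvent hq.le p _
  have hAm : MeasurableSet (accurate A T q M) :=
    ℱ.le _ _ (hplay.measurableSet_accurate hq.le)
  let z : ℕ → Fin n → Ω → ℝ := fun s a => H.indicator fun ω => x a - alg.strategy M j (2 ^ q + s) ω a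
  have hXmem : ∀ t ω, alg.strategy M j t ω ∈ stdSimplex ℝ (Fin n) := fun t ω => alg.play_mem t _
  have hle1 : ∀ w ∈ stdSimplex ℝ (Fin n), ∀ a, w a ≤ 1 := fun w hw a =>
    (Finset.single_le_sum (fun a _ => hw.1 a) (Finset.mem_univ a)).trans_eq hw.2
  have hzb : ∀ s a ω, |z s a ω| ≤ 1 := by
    intro s a ω
    by_cases hω : ω ∈ H
    · simp only [z, Set.indicator_of_mem hω]
      have h1 := hle1 x h.1.1 a
      have h2 := hle1 _ (hXmem (2 ^ q + s) ω) a
      have h3 := h.1.1.1 a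
      have h4 := (hXmem (2 ^ q + s) ω).1 a
      exact abs_le.2 ⟨by linarith, by linarith⟩
    · simp [z, Set.indicator_of_notMem hω]
  have hzm : ∀ s < L, ∀ a, Measurable[ℱ (2 ^ q + s)] (z s a) := by
    intro s hs a
    have h1 : MeasurableSet[ℱ (2 ^ q + s)] H := ℱ.mono (by omega) _ hHm
    have h2 : Measurable[ℱ (2 ^ q + s)] fun ω => alg.strategy M j (2 ^ q + s) ω a :=
      (measurable_pi_apply a).comp (hplay.measurable_strategy (by omega))
    exact Measurable.indicator (measurable_const.sub h2) h1
  have hentry : ∀ s (hs : s < L) a, _ := fun s hs a =>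
    hplay.integral_mul_entry (t := 2 ^ q + s) (by omega) (hzm s hs a) (hzb s a) a
  have hyi : ∀ s < L, ∀ a, Integrable (fun ω => z s a ω * (A *ᵥ y (2 ^ q + s) ω) a) P := by
    intro s hs a
    have h1 : Measurable (z s a) := (hzm s hs a).mono (ℱ.le _) le_rfl
    have h2 : Measurable (y (2 ^ q + s)) :=
      (hplay.measurable_adversary _ (by omega)).mono (ℱ.le _) le_rfl
    refine Integrable.of_bound (C := 1 * 1) ?_ (Filter.Eventually.of_forall fun ω => ?_)
    · refine Measurable.aestronglyMeasurable (h1.mul ?_)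
      simp only [mulVec, dotProduct]
      fun_prop
    · rw [norm_mul]
      have h3 := abs_mulVec_le_sum hA (y (2 ^ q + s) ω) a
      rw [sum_abs_of_mem_stdSimplex (hplay.adversary_mem _ (by omega) ω), mul_one] at h3
      exact mul_le_mul (hzb s a ω) h3 (norm_nonneg _) zero_le_one
  have hround : ∀ s < L, ∫ ω, (V - payoff A (alg.strategy M j (2 ^ q + s) ω) (y (2 ^ q + s) ω)) ∂P ≤
      (∫ ω, ∑ a, z s a ω * M (2 ^ q + s) ω a (j (2 ^ q + s) ω) ∂P) + κ * (10 * ε) +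
        2 * (2 / T) := by
    intro s hs
    have hpt : ∀ ω, V - payoff A (alg.strategy M j (2 ^ q + s) ω) (y (2 ^ q + s) ω) ≤
        (∑ a, z s a ω * (A *ᵥ y (2 ^ q + s) ω) a) + κ * (10 * ε) +
          (accurate A T q M)ᶜ.indicator (fun _ => (2 : ℝ)) ω := by
      intro ω
      have hym := hplay.adversary_mem (2 ^ q + s) (by omega) ω
      have hκε : 0 ≤ κ * (10 * ε) := by positivity
      by_cases hω : ω ∈ H
      · have h1 : ∑ a, z s a ω * (A *ᵥ y (2 ^ q + s) ω) a =
            payoff A x (y (2 ^ q + s) ω) -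
              payoff A (alg.strategy M j (2 ^ q + s) ω) (y (2 ^ q + s) ω) := by
          simp only [z, Set.indicator_of_mem hω, payoff_eq_sum_left, sub_mul,
            Finset.sum_sub_distrib]
        have h2 := h.1.2.2.2 _ hym
        have h3 : 0 ≤ (accurate A T q M)ᶜ.indicator (fun _ => (2 : ℝ)) ω :=
          Set.indicator_nonneg (fun _ _ => by norm_num) ω
        rw [h1]
        linarith
      · have h1 : ∑ a, z s a ω * (A *ᵥ y (2 ^ q + s) ω) a = 0 := by
          simp [z, Set.indicator_of_notMem hω]
        rw [h1]
        by_cases hacc : ω ∈ accurate A T q M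
        · have h2 : ¬ (p → ¬ Guarantees A (V - 10 * ε) (epochExperts T q fun s => M s ω)) :=
            fun h2 => hω ⟨hacc, h2⟩
          push Not at h2
          obtain ⟨hp1, hg⟩ := h2
          have h3 : V - 10 * ε ≤ payoff A (alg.strategy M j (2 ^ q + s) ω) (y (2 ^ q + s) ω) := by
            rw [halg, strategy_epochHedge]
            exact le_payoff_of_le_vecMul hym fun b => hg.le_vecMul_strat (by omega) _ b
          rw [Set.indicator_of_notMem (Set.notMem_compl_iff.2 hacc)]
          have h4 : 10 * ε ≤ κ * (10 * ε) := le_mul_of_one_le_left (by positivity) (hκ hp1)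
          linarith
        · rw [Set.indicator_of_mem (by exact hacc)]
          have h2 := (abs_le.1 (abs_payoff_le hA h.1.1 h.1.2.1)).2
          have h3 := (abs_le.1 (abs_payoff_le hA (hXmem (2 ^ q + s) ω) hym)).1
          linarith
    have hi1 : Integrable (fun ω => ∑ a, z s a ω * (A *ᵥ y (2 ^ q + s) ω) a) P :=
      integrable_finsetSum _ fun a _ => hyi s hs a
    have hi2 : Integrable ((accurate A T q M)ᶜ.indicator fun _ => (2 : ℝ)) P :=
      (integrable_const _).indicator hAm.compl
    have hi3 : Integrable (fun ω => (∑ a, z s a ω * (A *ᵥ y (2 ^ q + s) ω) a) + κ * (10 * ε)) P :=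
      hi1.add (integrable_const _)
    refine (integral_mono ((integrable_const V).sub (hplay.integrable_payoff hA (by omega)))
      (hi3.add hi2) hpt).trans ?_
    simp only [Pi.add_apply]
    rw [integral_add hi3 hi2, integral_add hi1 (integrable_const _), integral_const,
      integral_indicator_const _ hAm.compl]
    have e1 : ∫ ω, ∑ a, z s a ω * (A *ᵥ y (2 ^ q + s) ω) a ∂P =
        ∫ ω, ∑ a, z s a ω * M (2 ^ q + s) ω a (j (2 ^ q + s) ω) ∂P := by
      rw [integral_finsetSum _ fun a _ => hyi s hs a,
        integral_finsetSum _ fun a _ => (hentry s hs a).1]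
      exact Finset.sum_congr rfl fun a _ => (hentry s hs a).2.symm
    have e2 := hplay.measureReal_compl_accurate_le hn hm hq.le
    rw [e1]
    simp only [probReal_univ, smul_eq_mul, one_mul]
    linarith
  have hpath : ∫ ω, ∑ s ∈ Finset.range L, ∑ a, z s a ω * M (2 ^ q + s) ω a (j (2 ^ q + s) ω) ∂P ≤
      2 + 72 * k ^ 3 * c * Real.log (n * m * T) /
          |detD (subMatrix A (supp x) (supp yn) hx hy)| +
        κ * (4 * Real.sqrt (2 ^ q * Real.log (n * m * T))) := by
    have hc0 : 0 ≤ c := zero_le_one.trans hc.one_le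
    set K := 2 + 72 * k ^ 3 * c * Real.log (n * m * T) /
          |detD (subMatrix A (supp x) (supp yn) hx hy)| +
        κ * (4 * Real.sqrt (2 ^ q * Real.log (n * m * T))) with hK
    have hK0 : 0 ≤ K := by positivity
    have hint : Integrable (fun ω => ∑ s ∈ Finset.range L,
        ∑ a, z s a ω * M (2 ^ q + s) ω a (j (2 ^ q + s) ω)) P :=
      integrable_finsetSum _ fun s hs => integrable_finsetSum _ fun a _ =>
        (hentry s (Finset.mem_range.1 hs) a).1
    have hbd : ∀ᵐ ω ∂P, ∀ s, s < L → ∀ a b, M (2 ^ q + s) ω a b ∈ Set.Icc (-1 : ℝ) 1 := by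
      refine ae_all_iff.2 fun s => ?_
      by_cases hs : s < L
      · filter_upwards [hplay.matrix_mem (2 ^ q + s) (by omega)] with ω hω _ using hω
      · exact Filter.Eventually.of_forall fun ω h => absurd h hs
    refine (integral_mono_ae hint (integrable_const K) ?_).trans (by simp)
    filter_upwards [hbd] with ω hω
    by_cases hωH : ω ∈ H
    · have := h.epoch_regret_le hA hx hy hc hL hq hκ0 hκ (M := fun s => M s ω)
        (j := fun s => j s ω) (fun s hs a => abs_le.2 (hω s hs a _)) hωH.1 hωH.2
      refine le_trans (le_of_eq ?_) this
      refine Finset.sum_congr rfl fun s _ => Finset.sum_congr rfl fun a _ => ?_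
      simp only [z, Set.indicator_of_mem hωH, halg, strategy_epochHedge]
    · simpa [z, Set.indicator_of_notMem hωH] using hK0
  rw [integral_finsetSum _ fun s hs => integrable_finsetSum _ fun a _ =>
        (hentry s (Finset.mem_range.1 hs) a).1] at hpath
  refine (Finset.sum_le_sum fun s hs => hround s (Finset.mem_range.1 hs)).trans ?_
  rw [Finset.sum_add_distrib, Finset.sum_add_distrib]
  simp only [Finset.sum_const, Finset.card_range, nsmul_eq_mul]
  have hLq : (L : ℝ) ≤ 2 ^ q := by exact_mod_cast hL
  have hLTR : (L : ℝ) ≤ T := by exact_mod_cast (by omega : L ≤ T)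
  have h1 : (L : ℝ) * (κ * (10 * ε)) ≤ κ * (20 * Real.sqrt (2 ^ q * Real.log (n * m * T))) := by
    calc (L : ℝ) * (κ * (10 * ε)) ≤ 2 ^ q * (κ * (10 * ε)) := by gcongr
      _ = κ * (10 * (ε * 2 ^ q)) := by ring
      _ = κ * (20 * Real.sqrt (2 ^ q * Real.log (n * m * T))) := by
        rw [hε, radius_mul_two_pow hlam0]; ring
  have h2 : (L : ℝ) * (2 * (2 / T)) ≤ 4 := by
    calc (L : ℝ) * (2 * (2 / T)) ≤ T * (2 * (2 / T)) := by gcongr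
      _ = 4 := by field_simp; norm_num
  linarith

end Play

/-! ### Summation over the epochs -/

/-- Round 0 belongs to no epoch and is paid for by `B`; the last epoch is cut at `T`. -/
lemma sum_range_min_le {f b : ℕ → ℝ} {B : ℝ} (hB : 0 ≤ B) (h0 : f 0 ≤ B) (hb : ∀ q, 0 ≤ b q)
    (h : ∀ q, 2 ^ q < T → ∑ s ∈ Finset.range (min (2 ^ q) (T - 2 ^ q)), f (2 ^ q + s) ≤ b q)
    (Q : ℕ) : ∑ t ∈ Finset.range (min T (2 ^ Q)), f t ≤ B + ∑ q ∈ Finset.range Q, b q := by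
  induction Q with
  | zero =>
    rcases T.eq_zero_or_pos with rfl | hT
    · simpa using hB
    · rw [pow_zero, min_eq_right (by omega)]
      simpa using h0
  | succ Q ih =>
    rw [Finset.sum_range_succ]
    rcases le_or_gt T (2 ^ Q) with hT | hT
    · have h2 : T ≤ 2 ^ (Q + 1) := hT.trans (Nat.pow_le_pow_right (by norm_num) (by omega))
      rw [min_eq_left h2]
      rw [min_eq_left hT] at ih
      linarith [hb Q]
    · have e : min T (2 ^ (Q + 1)) = 2 ^ Q + min (2 ^ Q) (T - 2 ^ Q) := by
        rw [pow_succ]; omega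
      rw [e, Finset.sum_range_add]
      rw [min_eq_right hT.le] at ih
      linarith [h Q hT]

/-- Growth by `5 / 4` keeps the sum of the earlier terms below `4 * b Q`, so at the last active
index the total is at most `5 * b Q ≤ 5 * X`. -/
lemma sum_geometric_le {b κ : ℕ → ℝ} {X : ℝ} (hb : ∀ q, 0 ≤ b q)
    (hgrow : ∀ q, 5 / 4 * b q ≤ b (q + 1)) (hX : 0 ≤ X)
    (hκ : ∀ q, κ q = 0 ∨ κ q = 1 ∧ b q ≤ X) (Q : ℕ) :
    ∑ q ∈ Finset.range Q, κ q * b q ≤ 5 * X ∧ ∑ q ∈ Finset.range Q, κ q * b q ≤ 4 * b Q := by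
  induction Q with
  | zero => simp [hX, hb]
  | succ Q ih =>
    rw [Finset.sum_range_succ]
    have h1 := hgrow Q
    have h2 := hb Q
    rcases hκ Q with h | ⟨h, h'⟩ <;> rw [h] <;> constructor <;> linarith [ih.1, ih.2]

lemma log_two_mul_le (hT : 0 < T) (hnmT : 2 ≤ n * m * T) :
    ((Nat.log 2 T + 1 : ℕ) : ℝ) ≤ 3 * Real.log (n * m * T) := by
  have hpos : (0 : ℝ) < T := by exact_mod_cast hT
  have hnm : (1 : ℝ) ≤ n * m := by
    have : 0 < n * m := Nat.pos_of_ne_zero fun h => by simp [h] at hnmT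
    exact_mod_cast this
  have h1 : Real.log T ≤ Real.log (n * m * T) := by
    refine Real.log_le_log hpos ?_
    nlinarith
  have h2 : (Nat.log 2 T : ℝ) * Real.log 2 ≤ Real.log T := by
    rw [← Real.log_pow]
    refine Real.log_le_log (by positivity) ?_
    exact_mod_cast Nat.pow_log_le_self 2 hT.ne'
  have h3 := Real.log_two_gt_d9
  have h4 : Real.log 2 ≤ Real.log (n * m * T) :=
    Real.log_le_log (by norm_num) (by exact_mod_cast hnmT)
  push_cast
  have h5 : (0 : ℝ) ≤ Nat.log 2 T := by positivity
  nlinarith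

end MatrixGame

end

noncomputable section

namespace MatrixGame

/-! ### Coarse epochs and the total Nash regret -/

variable {n m k T q : ℕ} {A : Matrix (Fin n) (Fin m) ℝ} {x : Fin n → ℝ} {yn : Fin m → ℝ}

/-- Coarse epochs are early: the radius times this square root is `2 log (nmT)`, and coarseness
bounds the radius from below. -/
lemma IsCoarse.sqrt_le {Δ c G : ℝ} (h : IsCoarse A x yn Δ c (radius n m T q)) (hc : 0 ≤ c)
    (hΔ : 0 < Δ) (hG : deltaG A x yn = G) (hlog : 0 ≤ Real.log (n * m * T)) :
    Real.sqrt (2 ^ q * Real.log (n * m * T)) ≤ 108 * c * Real.log (n * m * T) / (G * Δ) := by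
  obtain ⟨G', hG', e, hle⟩ := h
  obtain rfl : G' = G := by
    rw [hG] at e
    exact_mod_cast e.symm
  rw [le_div_iff₀ (by positivity)]
  have h1 : radius n m T q * Real.sqrt (2 ^ q * Real.log (n * m * T)) ≤
      2 * Real.log (n * m * T) := radius_mul_sqrt hlog hlog (by positivity) (by nlinarith)
  calc Real.sqrt (2 ^ q * Real.log (n * m * T)) * (G' * Δ)
      ≤ Real.sqrt (2 ^ q * Real.log (n * m * T)) * (54 * c * radius n m T q) := by gcongr
    _ = 54 * c * (radius n m T q * Real.sqrt (2 ^ q * Real.log (n * m * T))) := by ring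
    _ ≤ 54 * c * (2 * Real.log (n * m * T)) := by gcongr
    _ = 108 * c * Real.log (n * m * T) := by ring

-- The square roots grow by `√2 ≥ 5 / 4` per epoch, so the coarse ones sum to five times the bound
-- on the largest, `540 = 5 * 108`. For an infinite gap no epoch is coarse and the inverse is 0.
open Classical in
lemma sum_coarse_le {Δ c : ℝ} (hc : 0 ≤ c) (hΔ : 0 < Δ) (hpos : 0 < deltaG A x yn)
    (hlog : 0 ≤ Real.log (n * m * T)) (Q : ℕ) :
    ∑ q ∈ Finset.range Q, (if IsCoarse A x yn Δ c (radius n m T q) then (1 : ℝ) else 0) *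
        Real.sqrt (2 ^ q * Real.log (n * m * T)) ≤
      540 * c * Real.log (n * m * T) / Δ * ((deltaG A x yn)⁻¹).toReal := by
  induction hG : deltaG A x yn with
  | bot => simp [hG] at hpos
  | top =>
    have h : ∀ q, ¬ IsCoarse A x yn Δ c (radius n m T q) := by
      rintro q ⟨G, -, e, -⟩
      rw [hG] at e
      exact EReal.coe_ne_top G e.symm
    simp [h]
  | coe G =>
    have hG0 : 0 < G := by
      rw [hG] at hpos
      exact_mod_cast hpos
    have hgrow : ∀ q : ℕ, 5 / 4 * Real.sqrt (2 ^ q * Real.log (n * m * T)) ≤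
        Real.sqrt (2 ^ (q + 1) * Real.log (n * m * T)) := by
      intro q
      have h1 : (2 : ℝ) ^ (q + 1) * Real.log (n * m * T) =
          2 * (2 ^ q * Real.log (n * m * T)) := by ring
      have h2 : (5 / 4 : ℝ) ≤ Real.sqrt 2 := Real.le_sqrt_of_sq_le (by norm_num)
      rw [h1, Real.sqrt_mul zero_le_two (2 ^ q * _)]
      exact mul_le_mul_of_nonneg_right h2 (Real.sqrt_nonneg _)
    refine (sum_geometric_le (fun q => Real.sqrt_nonneg _) hgrow
      (X := 108 * c * Real.log (n * m * T) / (G * Δ)) (by positivity) (fun q => ?_) Q).1.trans_eq ?_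
    · by_cases h : IsCoarse A x yn Δ c (radius n m T q)
      · exact Or.inr ⟨if_pos h, h.sqrt_le hc hΔ hG hlog⟩
      · exact Or.inl (if_neg h)
    · rw [← EReal.coe_inv, EReal.toReal_coe]
      field_simp
      ring

variable {Ω : Type*} [mΩ : MeasurableSpace Ω] {P : Measure Ω} {ℱ : Filtration ℕ mΩ}
  {M : ℕ → Ω → (Fin n → Fin m → ℝ)} {i : ℕ → Ω → Fin n} {j : ℕ → Ω → Fin m}
  {y : ℕ → Ω → (Fin m → ℝ)}

lemma IsPlay.nashRegret_eq [IsProbabilityMeasure P] {alg : RowAlgorithm n m}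
    (h : IsPlay alg A T P ℱ M i j y) (hA : ∀ i j, |A i j| ≤ 1) (V : ℝ) :
    nashRegret alg A V T P M j y = ∑ t ∈ Finset.range T,
      ∫ ω, (V - payoff A (alg.strategy M j t ω) (y t ω)) ∂P := by
  have e : ∀ t ∈ Finset.range T, ∫ ω, (V - payoff A (alg.strategy M j t ω) (y t ω)) ∂P =
      V - ∫ ω, payoff A (alg.strategy M j t ω) (y t ω) ∂P := by
    intro t ht
    rw [integral_sub (integrable_const V) (h.integrable_payoff hA (Finset.mem_range.1 ht))]
    simp
  rw [Finset.sum_congr rfl e, Finset.sum_sub_distrib, nashRegret]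
  simp

lemma eq_of_mem_stdSimplex_of_subsingleton {ι : Type*} [Fintype ι] [Subsingleton ι] {u v : ι → ℝ}
    (hu : u ∈ stdSimplex ℝ ι) (hv : v ∈ stdSimplex ℝ ι) : u = v := by
  ext a
  have h1 := hu.2
  have h2 := hv.2
  rw [Fintype.sum_subsingleton _ a] at h1 h2
  rw [h1, h2]

lemma IsNash.nashRegret_nonpos [IsProbabilityMeasure P] [Subsingleton (Fin n)]
    {alg : RowAlgorithm n m} (h : IsNash A x yn) (hA : ∀ i j, |A i j| ≤ 1)
    (hplay : IsPlay alg A T P ℱ M i j y) : nashRegret alg A (payoff A x yn) T P M j y ≤ 0 := by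
  rw [hplay.nashRegret_eq hA]
  refine Finset.sum_nonpos fun t ht => integral_nonpos fun ω => ?_
  have e : alg.strategy M j t ω = x :=
    eq_of_mem_stdSimplex_of_subsingleton (alg.play_mem t _) h.1
  have := h.2.2.2 _ (hplay.adversary_mem t (Finset.mem_range.1 ht) ω)
  simp only [e, Pi.zero_apply]
  linarith

lemma IsUniqueNash.nashRegret_le [IsProbabilityMeasure P] [NeZero n] [NeZero m]
    (h : IsUniqueNash A x yn) (hA : ∀ i j, |A i j| ≤ 1)
    (hx : (supp x).card = k) (hy : (supp yn).card = k) {c : ℝ} (hc : AdjBound k c) {hT : 0 < T}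
    (hplay : IsPlay (epochHedge n m T hT) A T P ℱ M i j y) :
    nashRegret (epochHedge n m T hT) A (payoff A x yn) T P M j y ≤
      12960 * c * Real.log (n * m * T) / deltaMin (subMatrix A (supp x) (supp yn) hx hy) *
          ((deltaG A x yn)⁻¹).toReal +
        (44 + 216 * k ^ 3) * c * Real.log (n * m * T) ^ 2 /
          |detD (subMatrix A (supp x) (supp yn) hx hy)| := by
  classical
  have hn : 0 < n := Nat.pos_of_ne_zero (NeZero.ne n)
  have hm : 0 < m := Nat.pos_of_ne_zero (NeZero.ne m)
  have hpos : 0 < n * m * T := Nat.mul_pos (Nat.mul_pos hn hm) hT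
  -- For `n * m * T = 1` the right side vanishes, and the only row strategy has no regret. Otherwise
  -- the logarithm is at least `1 / 2`.
  rcases (Nat.succ_le_of_lt hpos).eq_or_lt with h1 | h2
  · have hlog : Real.log (n * m * T) = 0 := by
      have : (n * m * T : ℝ) = 1 := by exact_mod_cast h1.symm
      rw [this, Real.log_one]
    obtain rfl : n = 1 := Nat.eq_one_of_mul_eq_one_right
      (Nat.eq_one_of_mul_eq_one_right h1.symm)
    rw [hlog]
    simpa using h.1.nashRegret_nonpos hA hplay
  have hlam := one_half_le_log (Nat.succ_le_of_lt h2)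
  have hQ := log_two_mul_le (n := n) (m := m) hT (Nat.succ_le_of_lt h2)
  have hΔ := h.deltaMin_pos hx hy
  have hD : 0 < |detD (subMatrix A (supp x) (supp yn) hx hy)| := abs_pos.2 (h.detD_ne_zero hx hy)
  have hDc : |detD (subMatrix A (supp x) (supp yn) hx hy)| ≤ c := hc.detD_le _ fun _ _ => hA _ _
  have hc0 : 0 ≤ c := zero_le_one.trans hc.one_le
  have hcoarse := sum_coarse_le hc0 hΔ h.deltaG_pos (by linarith) (Nat.log 2 T + 1)
  rw [hplay.nashRegret_eq hA]
  set lam := Real.log (n * m * T) with hlamdef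
  set D := |detD (subMatrix A (supp x) (supp yn) hx hy)|
  set Δ := deltaMin (subMatrix A (supp x) (supp yn) hx hy)
  set f : ℕ → ℝ := fun t => ∫ ω, (payoff A x yn -
        payoff A ((epochHedge n m T hT).strategy M j t ω) (y t ω)) ∂P
  have hf0 : f 0 ≤ 2 := by
    refine (integral_mono ((integrable_const _).sub (hplay.integrable_payoff hA hT))
      (integrable_const (2 : ℝ)) fun ω => ?_).trans (by simp)
    have h2 := (abs_le.1 (abs_payoff_le hA h.1.1 h.1.2.1)).2
    have h3 := (abs_le.1 (abs_payoff_le (x := (epochHedge n m T hT).strategy M j 0 ω) hA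
      ((epochHedge n m T hT).play_mem 0 _) (hplay.adversary_mem 0 hT ω))).1
    simp only [Pi.sub_apply]
    exact (sub_le_sub h2 h3).trans (by norm_num)
  set κ : ℕ → ℝ := fun q => if IsCoarse A x yn Δ c (radius n m T q) then (1 : ℝ) else 0
  have hκ0 : ∀ q, 0 ≤ κ q := fun q => by simp only [κ]; split_ifs <;> norm_num
  have hsum := sum_range_min_le (T := T) (f := f) (B := 2)
    (b := fun q => 6 + 72 * k ^ 3 * c * lam / D + κ q * (24 * Real.sqrt (2 ^ q * lam)))
    (by norm_num) hf0
    (fun q => by have := hκ0 q; have : 0 ≤ lam := by linarith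
                 positivity)
    (fun q hq => h.epoch_expected_regret_le hA hx hy hc hplay (min_le_left _ _) (by omega) hq
      (hκ0 q) fun hco => (if_pos hco).ge) (Nat.log 2 T + 1)
  rw [min_eq_left (Nat.lt_pow_succ_log_self (by norm_num) T).le] at hsum
  refine hsum.trans ?_
  rw [Finset.sum_add_distrib, Finset.sum_const, Finset.card_range, nsmul_eq_mul]
  have e1 : ∑ q ∈ Finset.range (Nat.log 2 T + 1), κ q * (24 * Real.sqrt (2 ^ q * lam)) ≤
      12960 * c * lam / Δ * ((deltaG A x yn)⁻¹).toReal := by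
    calc ∑ q ∈ Finset.range (Nat.log 2 T + 1), κ q * (24 * Real.sqrt (2 ^ q * lam))
        = 24 * ∑ q ∈ Finset.range (Nat.log 2 T + 1), κ q * Real.sqrt (2 ^ q * lam) := by
          rw [Finset.mul_sum]
          exact Finset.sum_congr rfl fun q _ => by ring
      _ ≤ 24 * (540 * c * lam / Δ * ((deltaG A x yn)⁻¹).toReal) := by gcongr
      _ = _ := by ring
  have e2 : ((Nat.log 2 T + 1 : ℕ) : ℝ) * (6 + 72 * k ^ 3 * c * lam / D) ≤
      18 * lam + 216 * k ^ 3 * c * lam ^ 2 / D := by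
    calc ((Nat.log 2 T + 1 : ℕ) : ℝ) * (6 + 72 * k ^ 3 * c * lam / D)
        ≤ 3 * lam * (6 + 72 * k ^ 3 * c * lam / D) := by
          have : 0 ≤ lam := by linarith
          gcongr
      _ = _ := by ring
  -- Round 0 and the additive constant of each epoch fit into the second term because `lam ≥ 1 / 2`
  -- and `|D| ≤ c`.
  have e3 : 2 + 18 * lam ≤ 44 * c * lam ^ 2 / D := by
    have h3 : 1 ≤ c / D := (one_le_div hD).2 hDc
    calc 2 + 18 * lam ≤ 44 * lam ^ 2 * 1 := by nlinarith
      _ ≤ 44 * lam ^ 2 * (c / D) := by gcongr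
      _ = _ := by ring
  have e4 : (44 + 216 * k ^ 3) * c * lam ^ 2 / D =
      44 * c * lam ^ 2 / D + 216 * k ^ 3 * c * lam ^ 2 / D := by ring
  rw [e4]
  linarith

end MatrixGame

end

theorem theorem4 :
    ∃ α₁ α₂ : ℕ → ℝ, ∀ n m T : ℕ, 0 < n → 0 < m → 0 < T →
      ∃ alg : MatrixGame.RowAlgorithm n m,
        ∀ A : Matrix (Fin n) (Fin m) ℝ, (∀ a b, A a b ∈ Set.Icc (-1 : ℝ) 1) →
        ∀ (xs : Fin n → ℝ) (ys : Fin m → ℝ), MatrixGame.IsUniqueNash A xs ys →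
        ∀ (k : ℕ) (hx : (MatrixGame.supp xs).card = k),
        ∃ hy : (MatrixGame.supp ys).card = k,
          0 < MatrixGame.deltaMin
            (MatrixGame.subMatrix A (MatrixGame.supp xs) (MatrixGame.supp ys) hx hy) ∧
          MatrixGame.detD
            (MatrixGame.subMatrix A (MatrixGame.supp xs) (MatrixGame.supp ys) hx hy) ≠ 0 ∧
          0 < MatrixGame.deltaG A xs ys ∧
          ∀ (Ω : Type*) [mΩ : MeasurableSpace Ω] (P : Measure Ω) [IsProbabilityMeasure P]
            (ℱ : Filtration ℕ mΩ) (M : ℕ → Ω → (Fin n → Fin m → ℝ)) (i : ℕ → Ω → Fin n)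
            (j : ℕ → Ω → Fin m) (y : ℕ → Ω → (Fin m → ℝ)),
            MatrixGame.IsPlay alg A T P ℱ M i j y →
            MatrixGame.nashRegret alg A (MatrixGame.payoff A xs ys) T P M j y ≤
              α₁ k * Real.log (n * m * T) /
                  MatrixGame.deltaMin
                    (MatrixGame.subMatrix A (MatrixGame.supp xs) (MatrixGame.supp ys) hx hy) *
                  ((MatrixGame.deltaG A xs ys)⁻¹).toReal +
                α₂ k * (Real.log (n * m * T)) ^ 2 /
                  |MatrixGame.detD
                    (MatrixGame.subMatrix A (MatrixGame.supp xs) (MatrixGame.supp ys) hx hy)| := by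
  refine ⟨fun k => 12960 * MatrixGame.adjConst k,
    fun k => (44 + 216 * k ^ 3) * MatrixGame.adjConst k, fun n m T hn hm hT => ?_⟩
  have : NeZero n := ⟨hn.ne'⟩
  have : NeZero m := ⟨hm.ne'⟩
  refine ⟨MatrixGame.epochHedge n m T hT, fun A hA xs ys h k hx => ?_⟩
  have hy := h.card_supp_eq.trans hx
  exact ⟨hy, h.deltaMin_pos hx hy, h.detD_ne_zero hx hy, h.deltaG_pos,
    fun Ω _ P _ ℱ M i j y hplay => h.nashRegret_le (fun a b => abs_le.2 (hA a b)) hx hy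
      (MatrixGame.adjBound_adjConst k) hplay⟩
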